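/- All vector spaces are over $\mathbb{C}$, and modules over Lie superalgebras are supermodules ($\mathbb{Z}_2$-graded). A homomorphism of supermodules is a homogeneous linear map $f$ of some degree $|f|\in\mathbb{Z}_2$ with $f(xv)=(-1)^{|f||x|}xf(v)$; isomorphisms are bijective homomorphisms. **Setting.** Let $\mathfrak{g}$ be a basic classical Lie superalgebra (finite-dimensional, simple, with $\mathfrak g_{\bar 1}$ completely reducible over $\mathfrak g_{\bar 0}$ and with a nondegenerate consistent supersymmetric invariant bilinear form), with Chevalley generators $e_i,f_i,h_i$ ($1\le i\le n$), $[e_i,f_j]=\delta_{ij}h_i$, $[h_i,h_j]=0$, $[h_i,e_j]=a_{ij}e_j$, $[h_i,f_j]=-a_{ij}f_j$, $h_i\neq 0$. Let $\mathfrak{h}$ be the span of the $h_i$ and $\mathfrak{n}^+$, $\mathfrak{n}^-$ the subalgebras generated by the $e_i$ and by the $f_i$, respectively. Let $\Gamma$ be a finite group that acts on $\mathfrak{g}$ by diagram automorphisms ($e_i\mapsto c\,e_{\sigma(i)}$, $f_i\mapsto f_{\sigma(i)}$, $h_i\mapsto c\,h_{\sigma(i)}$ for a permutation $\sigma$ and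 a scalar $c\ne0$ with $a_{ij}=c\,a_{\sigma(i)\sigma(j)}$) and on a commutative associative unital $\mathbb{C}$-algebra $A$ by algebra automorphisms. Let $(\mathfrak{g}\otimes A)^\Gamma$ be the Lie superalgebra of fixed points of $\mathfrak{g}\otimes A$ under the diagonal action. Assume that $\mathfrak{g}^\Gamma$ is a basic classical Lie superalgebra. Put $\mathfrak{h}_\Gamma=\mathfrak{h}\cap\mathfrak{g}^\Gamma$, and let $\Delta\subset\mathfrak{h}_\Gamma^*$ be a linearly independent set of roots of $\mathfrak{g}^\Gamma$ such that each root of $\mathfrak{g}^\Gamma$ lies in $Q^+$ or in $-Q^+$, where $Q^+=\sum_{\alpha\in\Delta}\mathbb{N}\alpha$, and such that the triangular decomposition $\mathfrak{g}^\Gamma=\mathfrak{n}_\Gamma^-\oplus\mathfrak{h}_\Gamma\oplus\mathfrak{n}_\Gamma^+$ defined by $\Delta$ is consistent with that of $\mathfrak{g}$: $\mathfrak{n}_\Gamma^\pm=\mathfrak{n}^\pm\cap\mathfrak{g}^\Gamma$. Let $\Delta_{\bar0}$ be the set of simple roots of $\mathfrak{g}^\Gamma_{\bar 0}$, i.e.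 of the positive even roots of $\mathfrak{g}^\Gamma$ that are not sums of two positive even roots. For $\alpha\in\Delta_{\bar0}$ let $x_\alpha^\pm$ be even root vectors of $\mathfrak g^\Gamma$ for $\pm\alpha$ such that $h_\alpha=[x_\alpha^+,x_\alpha^-]\in\mathfrak{h}_\Gamma$ satisfies $\alpha(h_\alpha)=2$. Let $\Lambda^+$ be the set of $\lambda\in\mathfrak{h}_\Gamma^*$ for which the irreducible $\mathfrak{g}^\Gamma$-module of highest weight $\lambda$ is finite-dimensional. **Definitions.** $\mathcal{I}^\Gamma$ is the category of those $(\mathfrak{g}\otimes A)^\Gamma$-modules that are direct sums of irreducible finite-dimensional modules over $\mathfrak{g}^\Gamma_{\bar0}$ (acting through $x\mapsto x\otimes1$). A highest weight vector of weight $\lambda$ in a $(\mathfrak{g}\otimes A)^\Gamma$-module is a nonzero homogeneous vector $v$ with $(\mathfrak{n}^+\otimes A)^\Gamma v=0$ and $hv=\lambda(h)v$ for all $h\in\mathfrak{h}_\Gamma$. For $\lambda\in\Lambda^+$ let $\bar V(\lambda)$ be the $\mathfrak{g}^\Gamma$-module generated by an even vector $v_\lambda$ with defining relations $\mathfrak{n}_\Gamma^+v_\lambda=0$,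 $hv_\lambda=\lambda(h)v_\lambda$ ($h\in\mathfrak h_\Gamma$) and $(x_\alpha^-)^{\lambda(h_\alpha)+1}v_\lambda=0$ ($\alpha\in\Delta_{\bar0}$), and let $P^\Gamma(\bar V(\lambda))=\mathbf{U}((\mathfrak{g}\otimes A)^\Gamma)\otimes_{\mathbf{U}(\mathfrak{g}^\Gamma)}\bar V(\lambda)$. The twisted global Weyl module $W^\Gamma(\lambda)$ is the quotient of $P^\Gamma(\bar V(\lambda))$ by the submodule generated by its weight spaces of all weights $\mu\notin\lambda-Q^+$; let $w_\lambda$ be the image of $1\otimes v_\lambda$. **Proposition.** Let $\lambda\in\Lambda^+$. Then: 1. $W^\Gamma(\lambda)$ is an object of $\mathcal{I}^\Gamma$ and is generated by $w_\lambda$; if $W^\Gamma(\lambda)\neq0$, then $w_\lambda$ is a highest weight vector of weight $\lambda$. 2. If $V$ is an object of $\mathcal{I}^\Gamma$ that is generated by a highest weight vector $v$ of weight $\lambda$, then there is a surjective homomorphism $W^\Gamma(\lambda)\to V$ that maps $w_\lambda$ to $v$. (In particular, no such $V$ exists if $W^\Gamma(\lambda)=0$.) 3. If $W$ is an object of $\mathcal{I}^\Gamma$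 that is generated by a highest weight vector of weight $\lambda$ and that admits a surjective homomorphism onto every object of $\mathcal{I}^\Gamma$ generated by a highest weight vector of weight $\lambda$, then $W\cong W^\Gamma(\lambda)$. -/

import Mathlib

universe u v w w₁ w₂

open scoped TensorProduct

noncomputable section

namespace TwistedWeyl

/-! ### Superspaces -/

/-- The sign `(-1) ^ (i j)` of the rule of signs. -/
def koszul (i j : ZMod 2) : ℂ := (-1) ^ (i.val * j.val)

/-- A vector superspace `V = V₀ ⊕ V₁` over `ℂ`. -/
class SuperSpace (V : Type*) [AddCommGroup V] [Module ℂ V] where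
  part : ZMod 2 → Submodule ℂ V
  isCompl : IsCompl (part 0) (part 1)

section Super

variable {V : Type*} [AddCommGroup V] [Module ℂ V]

/-- The homogeneous component `V_i`. -/
abbrev part (V : Type*) [AddCommGroup V] [Module ℂ V] [SuperSpace V] (i : ZMod 2) :
    Submodule ℂ V := SuperSpace.part i

/-- The parity operator `v₀ + v₁ ↦ v₀ - v₁`. A subspace is graded, i.e. contains the homogeneous
components of its elements, if and only if it is stable under the parity operator. -/
def parity (V : Type*) [AddCommGroup V] [Module ℂ V] [SuperSpace V] : V →ₗ[ℂ] V :=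
  (part V 0).projection (part V 1) SuperSpace.isCompl -
    (part V 1).projection (part V 0) SuperSpace.isCompl.symm

theorem sign_add (i j : ZMod 2) :
    (-1 : ℂ) ^ (i + j).val = (-1) ^ i.val * (-1) ^ j.val := by
  have h2 : ∀ k : ZMod 2, k = 0 ∨ k = 1 := by decide
  have h11 : (1 + 1 : ZMod 2) = 0 := by decide
  have hv : (1 : ZMod 2).val = 1 := by decide
  rcases h2 i with rfl | rfl <;> rcases h2 j with rfl | rfl <;> simp [h11, hv]

theorem parity_of_mem [SuperSpace V] {i : ZMod 2} {x : V} (hx : x ∈ part V i) :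
    parity V x = (-1 : ℂ) ^ i.val • x := by
  have h2 : ∀ k : ZMod 2, k = 0 ∨ k = 1 := by decide
  have hv : (1 : ZMod 2).val = 1 := by decide
  rcases h2 i with rfl | rfl
  · have h1 := Submodule.projection_apply_of_mem_left (SuperSpace.isCompl (V := V)) hx
    have h3 := (Submodule.projection_apply_eq_zero_iff
      (SuperSpace.isCompl (V := V)).symm (x := x)).2 hx
    simp [parity, part, h1, h3]
  · have h1 := Submodule.projection_apply_of_mem_left (SuperSpace.isCompl (V := V)).symm hx
    have h3 := (Submodule.projection_apply_eq_zero_iff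
      (SuperSpace.isCompl (V := V)) (x := x)).2 hx
    simp [parity, part, h1, h3, hv]

theorem exists_add_eq [SuperSpace V] (x : V) :
    ∃ a ∈ part V 0, ∃ b ∈ part V 1, a + b = x :=
  Submodule.mem_sup.1 (by
    rw [(SuperSpace.isCompl (V := V)).sup_eq_top]
    exact Submodule.mem_top)

theorem parity_parity [SuperSpace V] (x : V) : parity V (parity V x) = x := by
  have hv : (1 : ZMod 2).val = 1 := by decide
  obtain ⟨a, ha, b, hb, rfl⟩ := exists_add_eq x
  simp [parity_of_mem ha, parity_of_mem hb, hv]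

theorem two_smul_cancel {x : V} (h : x = -x) : x = 0 := by
  have h2 : (2 : ℂ) • x = 0 := by
    rw [two_smul]
    nth_rewrite 2 [h]
    simp
  simpa using h2

theorem mem_part_of_parity [SuperSpace V] {i : ZMod 2} {x : V}
    (h : parity V x = (-1 : ℂ) ^ i.val • x) : x ∈ part V i := by
  have h2 : ∀ k : ZMod 2, k = 0 ∨ k = 1 := by decide
  have hv : (1 : ZMod 2).val = 1 := by decide
  obtain ⟨a, ha, b, hb, rfl⟩ := exists_add_eq x
  rw [map_add, parity_of_mem ha, parity_of_mem hb] at h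
  rcases h2 i with rfl | rfl
  · have hb0 : b = 0 := two_smul_cancel (by simpa [hv] using h.symm)
    simpa [hb0] using ha
  · have ha0 : a = 0 := two_smul_cancel (by simpa [hv] using h)
    simpa [ha0] using hb

/-- The grading of `V` by the eigenspaces of an involution `ε`: `V₀` is the `1`-eigenspace and
`V₁` is the `(-1)`-eigenspace. -/
abbrev SuperSpace.ofInvolution (ε : V →ₗ[ℂ] V) (h : ∀ x, ε (ε x) = x) : SuperSpace V where
  part i := LinearMap.ker (ε - (-1 : ℂ) ^ i.val • LinearMap.id)
  isCompl := by
    have hv : (1 : ZMod 2).val = 1 := by decide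
    refine IsCompl.of_le (fun x hx => ?_) (fun x _ => ?_)
    · have h0 : ε x = x := by simpa [sub_eq_zero] using hx.1
      have h1 : ε x = -x := by simpa [hv, add_eq_zero_iff_eq_neg] using hx.2
      exact (Submodule.mem_bot ℂ).2 (two_smul_cancel (h0.symm.trans h1))
    · refine Submodule.mem_sup.2 ⟨(2⁻¹ : ℂ) • (x + ε x), ?_, (2⁻¹ : ℂ) • (x - ε x), ?_, ?_⟩
      · simp [h, add_comm]
      · simp only [hv, LinearMap.mem_ker, LinearMap.sub_apply, LinearMap.smul_apply,
          LinearMap.id_apply, map_smul, map_sub, h]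
        module
      · module

theorem mem_part_ofInvolution (ε : V →ₗ[ℂ] V) (h : ∀ x, ε (ε x) = x) (i : ZMod 2) (x : V) :
    x ∈ (SuperSpace.ofInvolution ε h).part i ↔ ε x = (-1 : ℂ) ^ i.val • x :=
  sub_eq_zero

/-- A graded subspace is a superspace. -/
abbrev SuperSpace.ofSubmodule [SuperSpace V] (N : Submodule ℂ V)
    (hN : ∀ x ∈ N, parity V x ∈ N) : SuperSpace N where
  part i := (SuperSpace.part i).comap N.subtype
  isCompl := by
    have hd := (SuperSpace.isCompl (V := V)).disjoint
    refine IsCompl.of_le (fun x hx => ?_) (fun x _ => ?_)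
    · have : (x : V) = 0 := (Submodule.mem_bot ℂ).1 (hd.le_bot ⟨hx.1, hx.2⟩)
      simpa using this
    · obtain ⟨a, ha, b, hb, hab⟩ := exists_add_eq (x : V)
      have hv : (1 : ZMod 2).val = 1 := by decide
      have hp := hN x x.2
      rw [← hab, map_add, parity_of_mem ha, parity_of_mem hb] at hp
      have hx := x.2
      rw [← hab] at hx
      have haN : a ∈ N := by
        have := N.smul_mem (2⁻¹ : ℂ) (N.add_mem hx hp)
        simp only [hv, ZMod.val_zero] at this
        convert this using 1
        module
      have hbN : b ∈ N := by simpa using N.sub_mem hx haN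
      exact Submodule.mem_sup.2 ⟨⟨a, haN⟩, ha, ⟨b, hbN⟩, hb, Subtype.ext hab⟩

/-- The quotient of a superspace by a graded subspace is a superspace. -/
abbrev SuperSpace.ofQuotient [SuperSpace V] (N : Submodule ℂ V)
    (hN : ∀ x ∈ N, parity V x ∈ N) : SuperSpace (V ⧸ N) where
  part i := (SuperSpace.part i).map N.mkQ
  isCompl := by
    refine IsCompl.of_le ?_ (fun x _ => ?_)
    · rintro x ⟨⟨a, ha, rfl⟩, ⟨b, hb, hab⟩⟩
      have hv : (1 : ZMod 2).val = 1 := by decide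
      have h1 : b - a ∈ N := (Submodule.Quotient.eq N).1 hab
      have h2 := hN _ h1
      rw [map_sub, parity_of_mem ha, parity_of_mem hb] at h2
      have h3 : a ∈ N := by
        have := N.smul_mem (-(2⁻¹ : ℂ)) (N.add_mem h1 h2)
        simp only [hv, ZMod.val_zero] at this
        convert this using 1
        module
      exact (Submodule.mem_bot ℂ).2 ((Submodule.Quotient.mk_eq_zero N).2 h3)
    · obtain ⟨y, rfl⟩ := N.mkQ_surjective x
      obtain ⟨a, ha, b, hb, rfl⟩ := exists_add_eq y
      exact Submodule.mem_sup.2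
        ⟨N.mkQ a, ⟨a, ha, rfl⟩, N.mkQ b, ⟨b, hb, rfl⟩, (map_add _ _ _).symm⟩

end Super

/-! ### Lie superalgebras -/

/-- A Lie superalgebra over `ℂ`. -/
class LieSuperalgebra (L : Type*) [AddCommGroup L] [Module ℂ L] [SuperSpace L] where
  bracket : L →ₗ[ℂ] L →ₗ[ℂ] L
  bracket_mem : ∀ {i j : ZMod 2} {x y : L}, x ∈ part L i → y ∈ part L j →
    bracket x y ∈ part L (i + j)
  skew : ∀ {i j : ZMod 2} {x y : L}, x ∈ part L i → y ∈ part L j →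
    bracket x y = -(koszul i j • bracket y x)
  jacobi : ∀ {i j k : ZMod 2} {x y z : L}, x ∈ part L i → y ∈ part L j → z ∈ part L k →
    bracket x (bracket y z) = bracket (bracket x y) z + koszul i j • bracket y (bracket x z)

/-- The bracket `[x, y]` of a Lie superalgebra. -/
abbrev br {L : Type*} [AddCommGroup L] [Module ℂ L] [SuperSpace L] [LieSuperalgebra L]
    (x y : L) : L := LieSuperalgebra.bracket x y

section Lie

variable {L : Type*} [AddCommGroup L] [Module ℂ L] [SuperSpace L] [LieSuperalgebra L]

/-- The subalgebra generated by a set `S`. (It is graded if `S` consists of homogeneous elements.) -/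
def lieSpan (S : Set L) : Submodule ℂ L :=
  sInf {N | S ⊆ N ∧ ∀ x ∈ N, ∀ y ∈ N, br x y ∈ N}

variable (L) in
/-- Basic classical Lie superalgebras: finite-dimensional simple Lie superalgebras `L` such that
`L₁` is a completely reducible `L₀`-module and such that `L` has a nondegenerate consistent
(even), supersymmetric, invariant bilinear form. -/
structure IsBasicClassical : Prop where
  finiteDimensional : FiniteDimensional ℂ L
  nonabelian : ∃ x y : L, br x y ≠ 0
  simple : ∀ I : Submodule ℂ L, (∀ x ∈ I, parity L x ∈ I) → (∀ x ∈ I, ∀ y, br x y ∈ I) →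
    I = ⊥ ∨ I = ⊤
  classical : ∀ N : Submodule ℂ L, N ≤ part L 1 → (∀ x ∈ part L 0, ∀ y ∈ N, br x y ∈ N) →
    ∃ N' : Submodule ℂ L, N' ≤ part L 1 ∧ (∀ x ∈ part L 0, ∀ y ∈ N', br x y ∈ N') ∧
      N ⊓ N' = ⊥ ∧ N ⊔ N' = part L 1
  basic : ∃ B : LinearMap.BilinForm ℂ L,
    (∀ x ∈ part L 0, ∀ y ∈ part L 1, B x y = 0) ∧
    (∀ i j, ∀ x ∈ part L i, ∀ y ∈ part L j, B x y = koszul i j * B y x) ∧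
    (∀ x y z, B (br x y) z = B x (br y z)) ∧ B.Nondegenerate

variable (L) in
/-- Chevalley generators `e i`, `f i`, `h i` of a Lie superalgebra, with Cartan matrix `a`. -/
structure ChevalleyGenerators (n : ℕ) where
  e : Fin n → L
  f : Fin n → L
  h : Fin n → L
  a : Matrix (Fin n) (Fin n) ℂ
  deg : Fin n → ZMod 2
  e_mem : ∀ i, e i ∈ part L (deg i)
  f_mem : ∀ i, f i ∈ part L (deg i)
  h_ne_zero : ∀ i, h i ≠ 0
  bracket_h_h : ∀ i j, br (h i) (h j) = 0
  bracket_e_f : ∀ i, br (e i) (f i) = h i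
  bracket_e_f_of_ne : ∀ i j, i ≠ j → br (e i) (f j) = 0
  bracket_h_e : ∀ i j, br (h i) (e j) = a i j • e j
  bracket_h_f : ∀ i j, br (h i) (f j) = -(a i j • f j)
  generate : lieSpan (Set.range e ∪ Set.range f) = ⊤

namespace ChevalleyGenerators

variable {n : ℕ} (C : ChevalleyGenerators L n)

/-- The Cartan subalgebra `𝔥` of the triangular decomposition `𝔫⁻ ⊕ 𝔥 ⊕ 𝔫⁺`. -/
def cartan : Submodule ℂ L := Submodule.span ℂ (Set.range C.h)

/-- The subalgebra `𝔫⁺`. -/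
def nPos : Submodule ℂ L := lieSpan (Set.range C.e)

/-- The subalgebra `𝔫⁻`. -/
def nNeg : Submodule ℂ L := lieSpan (Set.range C.f)

/-- Diagram automorphisms: `e i ↦ c e (σ i)`, `f i ↦ f (σ i)`, `h i ↦ c h (σ i)` for a permutation
`σ` of the nodes and a scalar `c ≠ 0` with `a i j = c a (σ i) (σ j)`. -/
def IsDiagramAutomorphism (ν : L →ₗ[ℂ] L) : Prop :=
  ∃ (σ : Equiv.Perm (Fin n)) (c : ℂ), c ≠ 0 ∧ (∀ i j, C.a i j = c * C.a (σ i) (σ j)) ∧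
    ∀ i, ν (C.e i) = c • C.e (σ i) ∧ ν (C.f i) = C.f (σ i) ∧ ν (C.h i) = c • C.h (σ i)

end ChevalleyGenerators

variable (L) in
/-- A subsuperalgebra: a graded subspace that is closed under the bracket. -/
structure SubSuperalgebra extends Submodule ℂ L where
  parity_mem : ∀ x ∈ toSubmodule, parity L x ∈ toSubmodule
  bracket_mem : ∀ x ∈ toSubmodule, ∀ y ∈ toSubmodule, br x y ∈ toSubmodule

instance (S : SubSuperalgebra L) : SuperSpace S.toSubmodule :=
  SuperSpace.ofSubmodule S.toSubmodule S.parity_mem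

instance (S : SubSuperalgebra L) : LieSuperalgebra S.toSubmodule where
  bracket := LinearMap.mk₂ ℂ (fun x y => ⟨br (x : L) (y : L), S.bracket_mem x x.2 y y.2⟩)
    (by intros; ext; simp [br]) (by intros; ext; simp [br]) (by intros; ext; simp [br])
    (by intros; ext; simp [br])
  bracket_mem {i j x y} hx hy := LieSuperalgebra.bracket_mem (L := L) (x := x) (y := y) hx hy
  skew {i j x y} hx hy := Subtype.ext (LieSuperalgebra.skew (L := L) (i := i) (j := j) hx hy)
  jacobi {i j k x y z} hx hy hz :=
    Subtype.ext (LieSuperalgebra.jacobi (L := L) (i := i) (j := j) (k := k) hx hy hz)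

/-- An action of a group `Γ` on `L` by automorphisms of Lie superalgebras. -/
structure SuperAction (Γ : Type*) [Group Γ] (L : Type*) [AddCommGroup L] [Module ℂ L]
    [SuperSpace L] [LieSuperalgebra L] where
  toHom : Γ →* Module.End ℂ L
  map_part : ∀ γ i, ∀ x ∈ part L i, toHom γ x ∈ part L i
  map_bracket : ∀ γ x y, toHom γ (br x y) = br (toHom γ x) (toHom γ y)

theorem SuperAction.map_parity {Γ : Type*} [Group Γ] (ρ : SuperAction Γ L) (γ : Γ) (x : L) :
    ρ.toHom γ (parity L x) = parity L (ρ.toHom γ x) := by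
  obtain ⟨a, ha, b, hb, rfl⟩ := exists_add_eq x
  simp [parity_of_mem ha, parity_of_mem hb, parity_of_mem (ρ.map_part γ _ _ ha),
    parity_of_mem (ρ.map_part γ _ _ hb)]

/-- The subsuperalgebra `L^Γ` of fixed points. -/
def SuperAction.fixed {Γ : Type*} [Group Γ] (ρ : SuperAction Γ L) : SubSuperalgebra L where
  carrier := {x | ∀ γ, ρ.toHom γ x = x}
  add_mem' hx hy γ := by rw [map_add, hx γ, hy γ]
  zero_mem' γ := map_zero _
  smul_mem' c x hx γ := by rw [map_smul, hx γ]
  parity_mem x hx γ := by rw [ρ.map_parity, hx γ]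
  bracket_mem x hx y hy γ := by rw [ρ.map_bracket, hx γ, hy γ]

end Lie

/-! ### Map superalgebras -/

section MapAlgebra

variable {L : Type*} [AddCommGroup L] [Module ℂ L]
variable (A : Type*) [CommRing A] [Algebra ℂ A]

/-- The subspace `N ⊗ A` of `L ⊗ A`. -/
def tensorSub (N : Submodule ℂ L) : Submodule ℂ (L ⊗[ℂ] A) :=
  Submodule.span ℂ {z | ∃ x ∈ N, ∃ a : A, z = x ⊗ₜ[ℂ] a}


theorem tmul_mem_tensorSub {N : Submodule ℂ L} {x : L} (hx : x ∈ N) (a : A) :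
    x ⊗ₜ[ℂ] a ∈ tensorSub A N :=
  Submodule.subset_span ⟨x, hx, a, rfl⟩

theorem tensorSub_le {N : Submodule ℂ L} {P : Submodule ℂ (L ⊗[ℂ] A)}
    (h : ∀ x ∈ N, ∀ a : A, x ⊗ₜ[ℂ] a ∈ P) : tensorSub A N ≤ P :=
  Submodule.span_le.2 (by rintro _ ⟨x, hx, a, rfl⟩; exact h x hx a)

variable [SuperSpace L]

/-- The superspace `L ⊗ A`, graded by `(L ⊗ A)_i = L_i ⊗ A`. -/
instance : SuperSpace (L ⊗[ℂ] A) where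
  part i := tensorSub A (SuperSpace.part i)
  isCompl := by
    refine IsCompl.of_le (fun z hz => ?_) (fun z _ => ?_)
    · have hv : (1 : ZMod 2).val = 1 := by decide
      have key : ∀ i : ZMod 2, tensorSub A (part L i) ≤
          LinearMap.ker ((parity L).rTensor A - (-1 : ℂ) ^ i.val • LinearMap.id) := by
        intro i
        refine tensorSub_le A fun x hx a => ?_
        simp [parity_of_mem hx, TensorProduct.smul_tmul']
      have h0 := key 0 hz.1
      have h1 := key 1 hz.2
      simp only [hv, LinearMap.mem_ker, LinearMap.sub_apply, LinearMap.smul_apply,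
        LinearMap.id_apply, sub_eq_zero, ZMod.val_zero, pow_zero, one_smul, pow_one] at h0 h1
      exact (Submodule.mem_bot ℂ).2 (two_smul_cancel (h0.symm.trans (by rw [h1, neg_one_smul])))
    · induction z using TensorProduct.induction_on with
      | zero => exact Submodule.zero_mem _
      | tmul x a =>
        obtain ⟨y, hy, z, hz, rfl⟩ := exists_add_eq x
        rw [TensorProduct.add_tmul]
        exact Submodule.add_mem_sup (tmul_mem_tensorSub A hy a) (tmul_mem_tensorSub A hz a)
      | add y z hy hz => exact Submodule.add_mem _ (hy trivial) (hz trivial)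

variable [LieSuperalgebra L]

/-- The map superalgebra `L ⊗ A` with bracket `[x ⊗ a, y ⊗ b] = [x, y] ⊗ a b`. -/
instance : LieSuperalgebra (L ⊗[ℂ] A) where
  bracket := TensorProduct.map₂ LieSuperalgebra.bracket (LinearMap.mul ℂ A)
  bracket_mem {i j x y} hx hy := by
    induction hx using Submodule.span_induction with
    | mem x hx =>
      obtain ⟨x, hx, a, rfl⟩ := hx
      induction hy using Submodule.span_induction with
      | mem y hy =>
        obtain ⟨y, hy, b, rfl⟩ := hy
        exact tmul_mem_tensorSub A (LieSuperalgebra.bracket_mem hx hy) (a * b)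
      | zero => rw [map_zero]; exact Submodule.zero_mem _
      | add y z _ _ hy hz => rw [map_add]; exact Submodule.add_mem _ hy hz
      | smul c y _ hy => rw [map_smul]; exact Submodule.smul_mem _ c hy
    | zero => rw [map_zero]; exact Submodule.zero_mem _
    | add y z _ _ hy hz => rw [map_add]; exact Submodule.add_mem _ hy hz
    | smul c y _ hy => rw [map_smul]; exact Submodule.smul_mem _ c hy
  skew {i j x y} hx hy := by
    induction hx using Submodule.span_induction with
    | mem x hx =>
      obtain ⟨x, hx, a, rfl⟩ := hx
      induction hy using Submodule.span_induction with
      | mem y hy =>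
        obtain ⟨y, hy, b, rfl⟩ := hy
        simp only [TensorProduct.map₂_apply_tmul, TensorProduct.map_tmul, LinearMap.mul_apply']
        rw [LieSuperalgebra.skew hx hy, TensorProduct.neg_tmul, TensorProduct.smul_tmul',
          mul_comm a b]
      | zero => simp
      | add y z _ _ hy hz => simp only [map_add, LinearMap.add_apply, hy, hz]; module
      | smul c y _ hy => simp only [map_smul, LinearMap.smul_apply, hy]; module
    | zero => simp
    | add y z _ _ hy hz => simp only [map_add, LinearMap.add_apply, hy, hz]; module
    | smul c y _ hy => simp only [map_smul, LinearMap.smul_apply, hy]; module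
  jacobi {i j k x y z} hx hy hz := by
    induction hx using Submodule.span_induction with
    | mem x hx =>
      obtain ⟨x, hx, a, rfl⟩ := hx
      induction hy using Submodule.span_induction with
      | mem y hy =>
        obtain ⟨y, hy, b, rfl⟩ := hy
        induction hz using Submodule.span_induction with
        | mem z hz =>
          obtain ⟨z, hz, c, rfl⟩ := hz
          simp only [TensorProduct.map₂_apply_tmul, TensorProduct.map_tmul, LinearMap.mul_apply']
          rw [LieSuperalgebra.jacobi hx hy hz, TensorProduct.add_tmul, TensorProduct.smul_tmul',
            mul_assoc, mul_left_comm b a c]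
        | zero => simp
        | add y z _ _ hy hz => simp only [map_add, hy, hz]; module
        | smul c y _ hy => simp only [map_smul, hy]; module
      | zero => simp
      | add y z _ _ hy hz => simp only [map_add, LinearMap.add_apply, hy, hz]; module
      | smul c y _ hy => simp only [map_smul, LinearMap.smul_apply, hy]; module
    | zero => simp
    | add y z _ _ hy hz => simp only [map_add, LinearMap.add_apply, hy, hz]; module
    | smul c y _ hy => simp only [map_smul, LinearMap.smul_apply, hy]; module

variable {A} {Γ : Type*} [Group Γ]

/-- The diagonal action of `Γ` on `L ⊗ A`, `γ (x ⊗ a) = γ x ⊗ γ a`. -/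
def mapAction (ρ : SuperAction Γ L) (τ : Γ →* (A ≃ₐ[ℂ] A)) : SuperAction Γ (L ⊗[ℂ] A) where
  toHom :=
    { toFun := fun γ => TensorProduct.map (ρ.toHom γ) (τ γ).toLinearMap
      map_one' := by ext; simp
      map_mul' := fun γ δ => by ext; simp }
  map_part γ i z hz := by
    induction hz using Submodule.span_induction with
    | mem x hx =>
      obtain ⟨x, hx, a, rfl⟩ := hx
      exact tmul_mem_tensorSub A (ρ.map_part γ i x hx) (τ γ a)
    | zero => rw [map_zero]; exact Submodule.zero_mem _
    | add y z _ _ hy hz => rw [map_add]; exact Submodule.add_mem _ hy hz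
    | smul c y _ hy => rw [map_smul]; exact Submodule.smul_mem _ c hy
  map_bracket γ x y := by
    induction x using TensorProduct.induction_on with
    | zero => simp [br]
    | tmul x a =>
      induction y using TensorProduct.induction_on with
      | zero => simp [br]
      | tmul y b =>
        have h : ρ.toHom γ (br x y) ⊗ₜ[ℂ] τ γ (a * b) =
            br (ρ.toHom γ x) (ρ.toHom γ y) ⊗ₜ[ℂ] (τ γ a * τ γ b) := by
          rw [ρ.map_bracket, map_mul]
        exact h
      | add y z hy hz => simp only [map_add, br] at *; simp only [hy, hz]
    | add y z hy hz =>
      simp only [map_add, LinearMap.add_apply, br] at *; simp only [hy, hz]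

/-- The equivariant map superalgebra `(L ⊗ A)^Γ`. -/
def equivariantMap (ρ : SuperAction Γ L) (τ : Γ →* (A ≃ₐ[ℂ] A)) : SubSuperalgebra (L ⊗[ℂ] A) :=
  (mapAction ρ τ).fixed

end MapAlgebra

/-! ### The universal enveloping superalgebra -/

section Enveloping

variable (L : Type*) [AddCommGroup L] [Module ℂ L] [SuperSpace L] [LieSuperalgebra L]

/-- The relations `[x, y] = x y - (-1)^{|x||y|} y x` of the universal enveloping superalgebra. -/
inductive UEnvRel : TensorAlgebra ℂ L → TensorAlgebra ℂ L → Prop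
  | mk {i j : ZMod 2} {x y : L} (hx : x ∈ part L i) (hy : y ∈ part L j) :
      UEnvRel (TensorAlgebra.ι ℂ (br x y))
        (TensorAlgebra.ι ℂ x * TensorAlgebra.ι ℂ y -
          koszul i j • (TensorAlgebra.ι ℂ y * TensorAlgebra.ι ℂ x))

/-- The universal enveloping superalgebra `U(L)`. -/
def UEnv : Type _ := RingQuot (UEnvRel L)

instance : Ring (UEnv L) := inferInstanceAs (Ring (RingQuot (UEnvRel L)))

instance : Algebra ℂ (UEnv L) := inferInstanceAs (Algebra ℂ (RingQuot (UEnvRel L)))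

namespace UEnv

variable {L}

/-- The canonical map `L → U(L)`. -/
def ι : L →ₗ[ℂ] UEnv L :=
  (RingQuot.mkAlgHom ℂ (UEnvRel L)).toLinearMap ∘ₗ TensorAlgebra.ι ℂ

theorem ι_br {i j : ZMod 2} {x y : L} (hx : x ∈ part L i) (hy : y ∈ part L j) :
    ι (br x y) = ι x * ι y - koszul i j • (ι y * ι x) := by
  have h := RingQuot.mkAlgHom_rel ℂ (UEnvRel.mk hx hy)
  rw [map_sub, map_smul, map_mul, map_mul] at h
  exact h

theorem parityHom_rel {p q : TensorAlgebra ℂ L} (h : UEnvRel L p q) :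
    TensorAlgebra.lift ℂ (ι ∘ₗ parity L) p = TensorAlgebra.lift ℂ (ι ∘ₗ parity L) q := by
  obtain ⟨hx, hy⟩ := h
  simp only [map_sub, map_mul, map_smul, TensorAlgebra.lift_ι_apply, LinearMap.comp_apply,
    parity_of_mem hx, parity_of_mem hy, parity_of_mem (LieSuperalgebra.bracket_mem hx hy),
    ι_br hx hy, sign_add, smul_mul_smul_comm]
  module

/-- The parity automorphism of `U(L)`, which extends the parity operator of `L`. -/
def parityHom : UEnv L →ₐ[ℂ] UEnv L :=
  RingQuot.liftAlgHom ℂ ⟨TensorAlgebra.lift ℂ (ι ∘ₗ parity L), fun _ _ h => parityHom_rel h⟩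

theorem parityHom_ι (x : L) : parityHom (ι x) = ι (parity L x) := by
  have h := RingQuot.liftAlgHom_mkAlgHom_apply ℂ (TensorAlgebra.lift ℂ (ι ∘ₗ parity L))
    (fun _ _ h => parityHom_rel h) (TensorAlgebra.ι ℂ x)
  rw [TensorAlgebra.lift_ι_apply] at h
  exact h

theorem hom_ext {B : Type*} [Ring B] [Algebra ℂ B] {F G : UEnv L →ₐ[ℂ] B}
    (h : ∀ x, F (ι x) = G (ι x)) : F = G :=
  RingQuot.ringQuot_ext' ℂ _ _ (TensorAlgebra.hom_ext (LinearMap.ext h))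

theorem parityHom_parityHom (u : UEnv L) : parityHom (parityHom u) = u := by
  have h : (parityHom (L := L)).comp parityHom = AlgHom.id ℂ (UEnv L) :=
    hom_ext fun x => by simp [parityHom_ι, parity_parity]
  exact DFunLike.congr_fun h u

/-- `U(L)` is graded by the eigenspaces of the parity automorphism: the products of `k` even and
`l` odd elements of `L` have parity `l` mod `2`. -/
instance : SuperSpace (UEnv L) :=
  SuperSpace.ofInvolution parityHom.toLinearMap parityHom_parityHom

theorem mem_part {i : ZMod 2} {u : UEnv L} :
    u ∈ part (UEnv L) i ↔ parityHom u = (-1 : ℂ) ^ i.val • u :=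
  mem_part_ofInvolution (parityHom (L := L)).toLinearMap parityHom_parityHom i u

theorem parity_eq (u : UEnv L) : parity (UEnv L) u = parityHom u := by
  obtain ⟨a, ha, b, hb, rfl⟩ := exists_add_eq u
  rw [map_add, map_add, parity_of_mem ha, parity_of_mem hb, mem_part.1 ha, mem_part.1 hb]

end UEnv

end Enveloping

/-! ### Supermodules -/

/-- A supermodule `V` over the Lie superalgebra `L`. -/
class LieSupermodule (L : Type*) [AddCommGroup L] [Module ℂ L] [SuperSpace L] [LieSuperalgebra L]
    (V : Type*) [AddCommGroup V] [Module ℂ V] [SuperSpace V] where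
  act : L →ₗ[ℂ] V →ₗ[ℂ] V
  act_mem : ∀ {i j : ZMod 2} {x : L} {v : V}, x ∈ part L i → v ∈ part V j →
    act x v ∈ part V (i + j)
  act_bracket : ∀ {i j : ZMod 2} {x y : L}, x ∈ part L i → y ∈ part L j → ∀ v : V,
    act (br x y) v = act x (act y v) - koszul i j • act y (act x v)

section Modules

variable {L : Type*} [AddCommGroup L] [Module ℂ L] [SuperSpace L] [LieSuperalgebra L]

/-- The action of `x : L` on a supermodule. -/
abbrev act {V : Type*} [AddCommGroup V] [Module ℂ V] [SuperSpace V] [LieSupermodule L V]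
    (x : L) : V →ₗ[ℂ] V := LieSupermodule.act x

theorem parity_act {V : Type*} [AddCommGroup V] [Module ℂ V] [SuperSpace V] [LieSupermodule L V]
    {i : ZMod 2} {x : L} (hx : x ∈ part L i) (v : V) :
    parity V (act x v) = (-1 : ℂ) ^ i.val • act x (parity V v) := by
  obtain ⟨a, ha, b, hb, rfl⟩ := exists_add_eq v
  simp only [map_add, parity_of_mem ha, parity_of_mem hb, map_smul,
    parity_of_mem (LieSupermodule.act_mem hx ha), parity_of_mem (LieSupermodule.act_mem hx hb),
    sign_add]
  module

/-- `U(L)` as a supermodule over `L`, by left multiplication. -/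
instance : LieSupermodule L (UEnv L) where
  act := LinearMap.mul ℂ (UEnv L) ∘ₗ UEnv.ι
  act_mem {i j x u} hx hu := by
    rw [UEnv.mem_part] at hu ⊢
    simp only [LinearMap.comp_apply, LinearMap.mul_apply', map_mul, UEnv.parityHom_ι,
      parity_of_mem hx, hu, map_smul, smul_mul_smul_comm, sign_add]
  act_bracket {i j x y} hx hy u := by
    simp only [LinearMap.comp_apply, LinearMap.mul_apply', UEnv.ι_br hx hy, sub_mul,
      smul_mul_assoc, mul_assoc]

variable (L) (V : Type*) [AddCommGroup V] [Module ℂ V] [SuperSpace V] [LieSupermodule L V]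

/-- A subsupermodule: a graded subspace that is stable under `L`. -/
structure SubSupermodule extends Submodule ℂ V where
  parity_mem : ∀ v ∈ toSubmodule, parity V v ∈ toSubmodule
  act_mem : ∀ (x : L), ∀ v ∈ toSubmodule, act x v ∈ toSubmodule

variable {L V}

/-- The smallest subsupermodule that contains the set `S`. -/
def SubSupermodule.gen (L : Type*) [AddCommGroup L] [Module ℂ L] [SuperSpace L]
    [LieSuperalgebra L] {V : Type*} [AddCommGroup V] [Module ℂ V] [SuperSpace V]
    [LieSupermodule L V] (S : Set V) : SubSupermodule L V where
  toSubmodule := sInf {N | S ⊆ N ∧ (∀ v ∈ N, parity V v ∈ N) ∧ ∀ x : L, ∀ v ∈ N, act x v ∈ N}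
  parity_mem v hv := by
    rw [Submodule.mem_sInf] at hv ⊢
    exact fun N hN => hN.2.1 v (hv N hN)
  act_mem x v hv := by
    rw [Submodule.mem_sInf] at hv ⊢
    exact fun N hN => hN.2.2 x v (hv N hN)

instance (N : SubSupermodule L V) : SuperSpace (V ⧸ N.toSubmodule) :=
  SuperSpace.ofQuotient N.toSubmodule N.parity_mem

/-- The quotient of a supermodule by a subsupermodule. -/
instance (N : SubSupermodule L V) : LieSupermodule L (V ⧸ N.toSubmodule) where
  act :=
    { toFun := fun x => N.toSubmodule.mapQ N.toSubmodule (act x) (N.act_mem x)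
      map_add' := fun x y => by ext; simp [act]
      map_smul' := fun c x => by ext; simp [act] }
  act_mem {i j x q} hx hq := by
    obtain ⟨v, hv, rfl⟩ := hq
    exact ⟨act x v, LieSupermodule.act_mem hx hv, rfl⟩
  act_bracket {i j x y} hx hy q := by
    obtain ⟨v, rfl⟩ := N.toSubmodule.mkQ_surjective q
    exact congrArg N.toSubmodule.mkQ (LieSupermodule.act_bracket hx hy v)

/-- The vector `v` generates the `L`-module `V`, i.e. `V = U(L) v`. -/
def Generates (L : Type*) [AddCommGroup L] [Module ℂ L] [SuperSpace L] [LieSuperalgebra L]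
    {V : Type*} [AddCommGroup V] [Module ℂ V] [SuperSpace V] [LieSupermodule L V] (v : V) : Prop :=
  ∀ N : Submodule ℂ V, v ∈ N → (∀ x : L, ∀ w ∈ N, act x w ∈ N) → N = ⊤

/-- Irreducible supermodules. -/
def IsIrreducible (L : Type*) [AddCommGroup L] [Module ℂ L] [SuperSpace L] [LieSuperalgebra L]
    (V : Type*) [AddCommGroup V] [Module ℂ V] [SuperSpace V] [LieSupermodule L V] : Prop :=
  Nontrivial V ∧ ∀ N : SubSupermodule L V, N.toSubmodule = ⊥ ∨ N.toSubmodule = ⊤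

/-- Homomorphisms of `L`-supermodules that are homogeneous of degree `d`:
`f (V_i) ⊆ V'_{i + d}` and `f (x v) = (-1)^{d |x|} x f(v)`. -/
def IsHom (L : Type*) [AddCommGroup L] [Module ℂ L] [SuperSpace L] [LieSuperalgebra L]
    {V : Type*} [AddCommGroup V] [Module ℂ V] [SuperSpace V] [LieSupermodule L V]
    {V' : Type*} [AddCommGroup V'] [Module ℂ V'] [SuperSpace V'] [LieSupermodule L V']
    (d : ZMod 2) (f : V →ₗ[ℂ] V') : Prop :=
  (∀ i, ∀ v ∈ part V i, f v ∈ part V' (i + d)) ∧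
    ∀ i, ∀ x ∈ part L i, ∀ v, f (act x v) = koszul d i • act x (f v)

/-- For a set `t` of operators on `V`, given by the action of a Lie algebra: `V` is the direct sum
of irreducible finite-dimensional `t`-submodules. -/
def IsFinitelySemisimple {V : Type*} [AddCommGroup V] [Module ℂ V]
    (t : Set (V →ₗ[ℂ] V)) : Prop :=
  ∃ S : Set (Submodule ℂ V), sSupIndep S ∧ sSup S = ⊤ ∧ ∀ N ∈ S,
    FiniteDimensional ℂ N ∧ N ≠ ⊥ ∧ (∀ T ∈ t, ∀ v ∈ N, T v ∈ N) ∧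
    ∀ N' ≤ N, (∀ T ∈ t, ∀ v ∈ N', T v ∈ N') → N' = ⊥ ∨ N' = N

end Modules

/-! ### Induced modules -/

section Induced

variable (K : Type*) [AddCommGroup K] [Module ℂ K] [SuperSpace K] [LieSuperalgebra K]
variable (L : Type*) [AddCommGroup L] [Module ℂ L] [SuperSpace L] [LieSuperalgebra L]

/-- Homomorphisms of Lie superalgebras. -/
structure LieSuperHom extends K →ₗ[ℂ] L where
  map_part : ∀ i, ∀ x ∈ part K i, toFun x ∈ part L i
  map_bracket : ∀ x y, toFun (br x y) = br (toFun x) (toFun y)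

variable {K L}

theorem LieSuperHom.map_parity (φ : LieSuperHom K L) (x : K) :
    φ.toLinearMap (parity K x) = parity L (φ.toLinearMap x) := by
  obtain ⟨a, ha, b, hb, rfl⟩ := exists_add_eq x
  have h0 : parity L (φ.toLinearMap a) = _ := parity_of_mem (φ.map_part _ _ ha)
  have h1 : parity L (φ.toLinearMap b) = _ := parity_of_mem (φ.map_part _ _ hb)
  simp only [map_add, parity_of_mem ha, parity_of_mem hb, map_smul, h0, h1]

variable (φ : LieSuperHom K L)
variable (V : Type*) [AddCommGroup V] [Module ℂ V] [SuperSpace V] [LieSupermodule K V]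

/-- For a homomorphism `φ : K → L` of Lie superalgebras: the subspace of `U(L) ⊗_ℂ V` by which one
has to divide to get `U(L) ⊗_{U(K)} V`. It is spanned by the elements `u φ(y) ⊗ v - u ⊗ y v`, where
it suffices to take `y ∈ K` because `K` generates the algebra `U(K)`. -/
def balanced : Submodule ℂ (UEnv L ⊗[ℂ] V) :=
  Submodule.span ℂ {z | ∃ (u : UEnv L) (y : K) (v : V),
    z = (u * UEnv.ι (φ.toLinearMap y)) ⊗ₜ[ℂ] v - u ⊗ₜ[ℂ] act y v}

/-- The parity operator of `U(L) ⊗_ℂ V`. -/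
def tensorParity : UEnv L ⊗[ℂ] V →ₗ[ℂ] UEnv L ⊗[ℂ] V :=
  TensorProduct.map (parity (UEnv L)) (parity V)

theorem balanced_parity : balanced φ V ≤ (balanced φ V).comap (tensorParity V) := by
  refine Submodule.span_le.2 ?_
  rintro _ ⟨u, y, v, rfl⟩
  obtain ⟨a, ha, b, hb, rfl⟩ := exists_add_eq y
  have key : ∀ (i : ZMod 2) (y : K), y ∈ part K i →
      tensorParity V ((u * UEnv.ι (φ.toLinearMap y)) ⊗ₜ[ℂ] v - u ⊗ₜ[ℂ] act y v) ∈
        balanced φ V := by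
    intro i y hy
    have h : tensorParity V ((u * UEnv.ι (φ.toLinearMap y)) ⊗ₜ[ℂ] v - u ⊗ₜ[ℂ] act y v) =
        (-1 : ℂ) ^ i.val • ((parity _ u * UEnv.ι (φ.toLinearMap y)) ⊗ₜ[ℂ] parity V v -
          parity _ u ⊗ₜ[ℂ] act y (parity V v)) := by
      simp only [tensorParity, map_sub, TensorProduct.map_tmul, parity_act hy, UEnv.parity_eq,
        map_mul, UEnv.parityHom_ι, ← φ.map_parity, parity_of_mem hy, map_smul, mul_smul_comm,
        TensorProduct.tmul_smul, ← TensorProduct.smul_tmul', smul_sub]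
    rw [h]
    exact Submodule.smul_mem _ _ (Submodule.subset_span ⟨_, _, _, rfl⟩)
  have h := Submodule.add_mem _ (key 0 a ha) (key 1 b hb)
  rw [← map_add] at h
  refine Submodule.mem_comap.2 ?_
  convert h using 2
  simp only [map_add, act, LinearMap.add_apply, mul_add, TensorProduct.add_tmul,
    TensorProduct.tmul_add]
  abel

theorem balanced_mul (x : L) :
    balanced φ V ≤ (balanced φ V).comap ((LinearMap.mulLeft ℂ (UEnv.ι x)).rTensor V) := by
  refine Submodule.span_le.2 ?_
  rintro _ ⟨u, y, v, rfl⟩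
  refine Submodule.mem_comap.2 (Submodule.subset_span ⟨UEnv.ι x * u, y, v, ?_⟩)
  simp [mul_assoc]

theorem tensorParity_mul {i : ZMod 2} {x : L} (hx : x ∈ part L i) (z : UEnv L ⊗[ℂ] V) :
    tensorParity V ((LinearMap.mulLeft ℂ (UEnv.ι x)).rTensor V z) =
      (-1 : ℂ) ^ i.val • (LinearMap.mulLeft ℂ (UEnv.ι x)).rTensor V (tensorParity V z) := by
  induction z using TensorProduct.induction_on with
  | zero => simp
  | tmul u v =>
    simp [tensorParity, UEnv.parity_eq, UEnv.parityHom_ι, parity_of_mem hx,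
      ← TensorProduct.smul_tmul']
  | add y z hy hz => simp only [map_add, hy, hz, smul_add]

/-- The induced module `U(L) ⊗_{U(K)} V`. -/
abbrev Induced : Type _ := (UEnv L ⊗[ℂ] V) ⧸ balanced φ V

/-- The image of `u ⊗ v` in the induced module. -/
def Induced.mk (u : UEnv L) (v : V) : Induced φ V := (balanced φ V).mkQ (u ⊗ₜ[ℂ] v)

/-- The parity operator of the induced module. -/
def inducedParity : Induced φ V →ₗ[ℂ] Induced φ V :=
  (balanced φ V).mapQ (balanced φ V) (tensorParity V) (balanced_parity φ V)

theorem inducedParity_inducedParity (q : Induced φ V) :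
    inducedParity φ V (inducedParity φ V q) = q := by
  obtain ⟨z, rfl⟩ := (balanced φ V).mkQ_surjective q
  refine congrArg (balanced φ V).mkQ (?_ : tensorParity V (tensorParity V z) = z)
  induction z using TensorProduct.induction_on with
  | zero => simp
  | tmul u v => simp [tensorParity, parity_parity]
  | add y z hy hz => rw [map_add, map_add, hy, hz]

/-- The grading of the induced module, in which `u ⊗ v` has parity `|u| + |v|`. -/
instance : SuperSpace (Induced φ V) :=
  SuperSpace.ofInvolution (inducedParity φ V) (inducedParity_inducedParity φ V)

theorem mem_part_induced {i : ZMod 2} {q : Induced φ V} :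
    q ∈ part (Induced φ V) i ↔ inducedParity φ V q = (-1 : ℂ) ^ i.val • q :=
  mem_part_ofInvolution (inducedParity φ V) (inducedParity_inducedParity φ V) i q

/-- The action on the induced module: `x (u ⊗ v) = x u ⊗ v`. -/
instance : LieSupermodule L (Induced φ V) where
  act :=
    { toFun := fun x => (balanced φ V).mapQ (balanced φ V)
        ((LinearMap.mulLeft ℂ (UEnv.ι x)).rTensor V) (balanced_mul φ V x)
      map_add' := fun x y => by ext; simp [add_mul, TensorProduct.add_tmul]
      map_smul' := fun c x => by ext; simp [← TensorProduct.smul_tmul'] }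
  act_mem {i j x q} hx hq := by
    obtain ⟨z, rfl⟩ := (balanced φ V).mkQ_surjective q
    have hq' : (balanced φ V).mkQ (tensorParity V z) =
        (-1 : ℂ) ^ j.val • (balanced φ V).mkQ z := (mem_part_induced φ V).1 hq
    refine (mem_part_induced φ V).2
      (?_ : (balanced φ V).mkQ (tensorParity V ((LinearMap.mulLeft ℂ (UEnv.ι x)).rTensor V z)) =
        (-1 : ℂ) ^ (i + j).val •
          (balanced φ V).mkQ ((LinearMap.mulLeft ℂ (UEnv.ι x)).rTensor V z))
    have h := congrArg ((balanced φ V).mapQ (balanced φ V)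
      ((LinearMap.mulLeft ℂ (UEnv.ι x)).rTensor V) (balanced_mul φ V x)) hq'
    simp only [map_smul, Submodule.mkQ_apply, Submodule.mapQ_apply] at h
    rw [tensorParity_mul V hx, map_smul, sign_add, mul_smul]
    simp only [Submodule.mkQ_apply, h]
  act_bracket {i j x y} hx hy q := by
    obtain ⟨z, rfl⟩ := (balanced φ V).mkQ_surjective q
    refine congrArg (balanced φ V).mkQ (?_ : (LinearMap.mulLeft ℂ (UEnv.ι (br x y))).rTensor V z =
      (LinearMap.mulLeft ℂ (UEnv.ι x)).rTensor V ((LinearMap.mulLeft ℂ (UEnv.ι y)).rTensor V z) -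
      koszul i j • (LinearMap.mulLeft ℂ (UEnv.ι y)).rTensor V
        ((LinearMap.mulLeft ℂ (UEnv.ι x)).rTensor V z))
    induction z using TensorProduct.induction_on with
    | zero => simp
    | tmul u v =>
      simp [UEnv.ι_br hx hy, sub_mul, mul_assoc, TensorProduct.sub_tmul,
        ← TensorProduct.smul_tmul']
    | add y z hy hz => simp only [map_add, hy, hz]; module

end Induced

/-! ### The twisted global Weyl module -/

section Weyl

variable {g : Type u} [AddCommGroup g] [Module ℂ g] [SuperSpace g] [LieSuperalgebra g]
variable {A : Type v} [CommRing A] [Algebra ℂ A] {Γ : Type w} [Group Γ]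
variable (ρ : SuperAction Γ g) (τ : Γ →* (A ≃ₐ[ℂ] A)) {n : ℕ} (C : ChevalleyGenerators g n)

/-- The type of elements of the fixed point superalgebra `𝔤^Γ`. -/
abbrev Fixed : Type u := ρ.fixed.toSubmodule

/-- The type of elements of the equivariant map superalgebra `(𝔤 ⊗ A)^Γ`. -/
abbrev EqMap : Type (max u v) := (equivariantMap ρ τ).toSubmodule

/-- The inclusion `𝔤^Γ → (𝔤 ⊗ A)^Γ`, `x ↦ x ⊗ 1`. -/
def incl : LieSuperHom (Fixed ρ) (EqMap ρ τ) where
  toFun x := ⟨(x : g) ⊗ₜ[ℂ] (1 : A), fun γ => by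
    have h : ρ.toHom γ x ⊗ₜ[ℂ] τ γ 1 = (x : g) ⊗ₜ[ℂ] (1 : A) := by rw [x.2 γ, map_one]
    exact h⟩
  map_add' x y := Subtype.ext (TensorProduct.add_tmul _ _ _)
  map_smul' c x := Subtype.ext (TensorProduct.smul_tmul' c (x : g) (1 : A)).symm
  map_part i x hx := by
    have hx' : (x : g) ∈ part g i := hx
    have h : (x : g) ⊗ₜ[ℂ] (1 : A) ∈ tensorSub A (part g i) := tmul_mem_tensorSub A hx' 1
    exact h
  map_bracket x y := Subtype.ext (by
    have h : br (x : g) (y : g) ⊗ₜ[ℂ] (1 : A) = br (x : g) (y : g) ⊗ₜ[ℂ] ((1 : A) * 1) := by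
      rw [mul_one]
    exact h)

/-- The Cartan subalgebra `𝔥_Γ = 𝔥 ∩ 𝔤^Γ` of `𝔤^Γ`. -/
def cartanFixed : Submodule ℂ g := C.cartan ⊓ ρ.fixed.toSubmodule

/-- The inclusion `𝔥_Γ → 𝔤^Γ`. -/
def cartanIncl : cartanFixed ρ C →ₗ[ℂ] Fixed ρ := Submodule.inclusion inf_le_right

/-- The dual space `𝔥_Γ^*`. -/
abbrev Weight : Type u := Module.Dual ℂ (cartanFixed ρ C)

/-- The weight space `(𝔤^Γ)_α` for `α ∈ 𝔥_Γ^*`, as a subspace of `𝔤`. -/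
def rootSpace (α : Weight ρ C) : Submodule ℂ g where
  carrier := {x | x ∈ ρ.fixed.toSubmodule ∧ ∀ h : cartanFixed ρ C, br (h : g) x = α h • x}
  add_mem' hx hy := ⟨Submodule.add_mem _ hx.1 hy.1, fun h => by
    rw [br, map_add, smul_add, ← hx.2 h, ← hy.2 h]⟩
  zero_mem' := ⟨Submodule.zero_mem _, fun h => by rw [br, map_zero, smul_zero]⟩
  smul_mem' c x hx := ⟨Submodule.smul_mem _ c hx.1, fun h => by
    rw [br, map_smul, smul_comm, ← hx.2 h]⟩

/-- `α` is a root of `𝔤^Γ`. -/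
def IsRoot (α : Weight ρ C) : Prop := α ≠ 0 ∧ rootSpace ρ C α ≠ ⊥

/-- `α` is an even root of `𝔤^Γ`, i.e. a root of `(𝔤^Γ)₀`. -/
def IsEvenRoot (α : Weight ρ C) : Prop := α ≠ 0 ∧ rootSpace ρ C α ⊓ part g 0 ≠ ⊥

variable {ρ C}

/-- The monoid `Q⁺` of all sums of elements of `Δ`. -/
abbrev posLattice (Δ : Set (Weight ρ C)) : AddSubmonoid (Weight ρ C) := AddSubmonoid.closure Δ

variable (ρ C) in
/-- `Δ` is a set of simple roots of `𝔤^Γ` whose triangular decomposition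
`𝔤^Γ = 𝔫_Γ⁻ ⊕ 𝔥_Γ ⊕ 𝔫_Γ⁺` is consistent with the triangular decomposition
`𝔤 = 𝔫⁻ ⊕ 𝔥 ⊕ 𝔫⁺`, i.e. `𝔫_Γ⁺ = 𝔤^Γ ∩ 𝔫⁺` and `𝔫_Γ⁻ = 𝔤^Γ ∩ 𝔫⁻`, where `𝔫_Γ⁺` and `𝔫_Γ⁻` are
the sums of the root spaces for the positive and the negative roots. -/
structure IsConsistentSimpleSystem (Δ : Set (Weight ρ C)) : Prop where
  isRoot : ∀ α ∈ Δ, IsRoot ρ C α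
  linearIndependent : LinearIndepOn ℂ id Δ
  pos_or_neg : ∀ α, IsRoot ρ C α → α ∈ posLattice Δ ∨ -α ∈ posLattice Δ
  nPos_eq : ⨆ α ∈ {α | IsRoot ρ C α ∧ α ∈ posLattice Δ}, rootSpace ρ C α =
    C.nPos ⊓ ρ.fixed.toSubmodule
  nNeg_eq : ⨆ α ∈ {α | IsRoot ρ C α ∧ -α ∈ posLattice Δ}, rootSpace ρ C α =
    C.nNeg ⊓ ρ.fixed.toSubmodule

/-- `α` belongs to the set `Δ₀` of simple roots of `(𝔤^Γ)₀`: it is a positive even root that is not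
the sum of two positive even roots. -/
def IsEvenSimple (Δ : Set (Weight ρ C)) (α : Weight ρ C) : Prop :=
  (IsEvenRoot ρ C α ∧ α ∈ posLattice Δ) ∧
    ¬∃ β γ, (IsEvenRoot ρ C β ∧ β ∈ posLattice Δ) ∧ (IsEvenRoot ρ C γ ∧ γ ∈ posLattice Δ) ∧
      α = β + γ

/-- `xp = x_α⁺`, `xm = x_α⁻` are even root vectors for `α` and `-α`, and `h = h_α ∈ 𝔥_Γ` is the
coroot of `α`: `[x_α⁺, x_α⁻] = h_α` and `α(h_α) = 2`. -/
structure IsCorootTriple (α : Weight ρ C) (xp xm : Fixed ρ) (h : cartanFixed ρ C) : Prop where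
  xp_mem : (xp : g) ∈ rootSpace ρ C α ⊓ part g 0
  xm_mem : (xm : g) ∈ rootSpace ρ C (-α) ⊓ part g 0
  bracket_eq : br xp xm = cartanIncl ρ C h
  apply_eq_two : α h = 2

variable (ρ C) in
/-- The set `Λ⁺` of all `lam ∈ 𝔥_Γ^*` for which the irreducible `𝔤^Γ`-module of highest weight `lam`
is finite-dimensional. -/
def dominantWeights : Set (Weight ρ C) :=
  {lam | ∃ (M : Type) (_ : AddCommGroup M) (_ : Module ℂ M) (_ : SuperSpace M)
    (_ : LieSupermodule (Fixed ρ) M), FiniteDimensional ℂ M ∧ IsIrreducible (Fixed ρ) M ∧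
      ∃ m : M, m ≠ 0 ∧ (∀ x : Fixed ρ, (x : g) ∈ C.nPos → act x m = 0) ∧
        ∀ h, act (cartanIncl ρ C h) m = lam h • m}

/-- The defining relations of `V̄(lam)`, as elements of `U(𝔤^Γ)`. -/
def kacRelations (Δ : Set (Weight ρ C)) (lam : Weight ρ C) : Set (UEnv (Fixed ρ)) :=
  {r | ∃ x : Fixed ρ, (x : g) ∈ C.nPos ∧ r = UEnv.ι x} ∪
  {r | ∃ h, r = UEnv.ι (cartanIncl ρ C h) - lam h • 1} ∪
  {r | ∃ α xp xm h, ∃ m : ℕ, IsEvenSimple Δ α ∧ IsCorootTriple α xp xm h ∧ lam h = m ∧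
    r = UEnv.ι xm ^ (m + 1)}

/-- The `𝔤^Γ`-module `V̄(lam)` that is generated by a vector `v` with the defining relations
`𝔫_Γ⁺ v = 0`, `h v = lam(h) v` and `(x_α⁻) ^ (lam(h_α) + 1) v = 0` for `α ∈ Δ₀`. -/
abbrev KacModule (Δ : Set (Weight ρ C)) (lam : Weight ρ C) : Type u :=
  UEnv (Fixed ρ) ⧸ (SubSupermodule.gen (Fixed ρ) (kacRelations Δ lam)).toSubmodule

/-- The generator `v` of `V̄(lam)`. -/
def kacVector (Δ : Set (Weight ρ C)) (lam : Weight ρ C) : KacModule Δ lam :=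
  Submodule.Quotient.mk 1

/-- The module `P^Γ(V̄(lam)) = U((𝔤 ⊗ A)^Γ) ⊗_{U(𝔤^Γ)} V̄(lam)`. -/
abbrev InducedKac (Δ : Set (Weight ρ C)) (lam : Weight ρ C) : Type (max u v) :=
  Induced (incl ρ τ) (KacModule Δ lam)

section Objects

variable {V : Type*} [AddCommGroup V] [Module ℂ V] [SuperSpace V] [LieSupermodule (EqMap ρ τ) V]

variable (V) in
/-- The weight space `V_μ` of a `(𝔤 ⊗ A)^Γ`-module. -/
def weightSpace (μ : Weight ρ C) : Set V :=
  {v | ∀ h : cartanFixed ρ C, act ((incl ρ τ).toLinearMap (cartanIncl ρ C h)) v = μ h • v}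

variable (V) in
/-- The submodule `∑ U((𝔤 ⊗ A)^Γ) V_μ`, where the sum is over all `μ ∉ ν - Q⁺`. -/
def truncation (Δ : Set (Weight ρ C)) (ν : Weight ρ C) : SubSupermodule (EqMap ρ τ) V :=
  SubSupermodule.gen (EqMap ρ τ) {v | ∃ μ, ν - μ ∉ posLattice Δ ∧ v ∈ weightSpace τ V μ}

variable (ρ V) in
/-- `V` is an object of the category `𝓘^Γ`: as a module over `(𝔤^Γ)₀`, it is a direct sum of
irreducible finite-dimensional modules. -/
def InCategory : Prop :=
  IsFinitelySemisimple {T : V →ₗ[ℂ] V |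
    ∃ x ∈ part (Fixed ρ) 0, T = act ((incl ρ τ).toLinearMap x)}

/-- `v` is a highest weight vector of weight `lam`: it is a nonzero homogeneous vector with
`(𝔫⁺ ⊗ A)^Γ v = 0` and `h v = lam(h) v` for all `h ∈ 𝔥_Γ`. -/
structure IsHighestWeightVector (lam : Weight ρ C) (v : V) : Prop where
  ne_zero : v ≠ 0
  homogeneous : ∃ i, v ∈ part V i
  nPos_act : ∀ z : EqMap ρ τ, (z : g ⊗[ℂ] A) ∈ tensorSub A C.nPos → act z v = 0
  cartan_act : v ∈ weightSpace τ V lam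

variable (V) in
/-- `V` is an object of `𝓘^Γ` that is generated by a highest weight vector of weight `lam`. -/
def IsHighestWeightObject (lam : Weight ρ C) : Prop :=
  InCategory ρ τ V ∧ ∃ v : V, IsHighestWeightVector τ lam v ∧ Generates (EqMap ρ τ) v

end Objects

/-- The twisted global Weyl module `W^Γ(lam) = P^Γ(V̄(lam))^lam`: the largest quotient of
`P^Γ(V̄(lam))` all of whose weights lie in `lam - Q⁺`. -/
abbrev WeylModule (Δ : Set (Weight ρ C)) (lam : Weight ρ C) : Type (max u v) :=
  InducedKac τ Δ lam ⧸ (truncation τ (InducedKac τ Δ lam) Δ lam).toSubmodule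

/-- The image `w` in `W^Γ(lam)` of the generator `v` of `V̄(lam)`. -/
def weylVector (Δ : Set (Weight ρ C)) (lam : Weight ρ C) : WeylModule τ Δ lam :=
  Submodule.Quotient.mk (Induced.mk (incl ρ τ) (KacModule Δ lam) 1 (kacVector Δ lam))

end Weyl

end TwistedWeyl
end

open TwistedWeyl

/-! Write W for the twisted global Weyl module, w for its generator and λ for its weight. The proof
has three ingredients.

Membership in the category. W is generated by a weight vector, hence is the sum of its weight
spaces, and the truncation removes every weight outside λ - Q⁺. The simple root vectors of 𝔤
restrict to nonzero weights in Q⁺ (`IsConsistentSimpleSystem.simpleWeight_mem`, by summing f_i over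
Γ), so averaging over Γ gives a triangular spanning set of (𝔤 ⊗ A)^Γ, and (𝔫⁺ ⊗ A)^Γ kills w because
it would raise λ. Since λ is dominant, a power of each negative even simple root vector kills w;
these vectors act ad-nilpotently on (𝔤 ⊗ A)^Γ, so they are locally nilpotent on W. Reflections and
the upper bound on the weights extend this to all even root vectors, and ordered monomials then show
that W is locally finite over the even part of 𝔤^Γ (`SplitReductive.finitePart_eq_top`).

Locally finite weight modules are completely reducible (`SplitReductive.isFinitelySemisimple`). This
is proved directly, for a Lie algebra packaged as `SplitReductive`, with a Casimir operator:
comparable distinct dominant weights have distinct Casimir eigenvalues, so a highest weight vector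
generates an irreducible module, and a module larger than the sum of its irreducible submodules
would contain two such weights with the same eigenvalue. The invariant form is the trace form of the
even part acting on the whole of 𝔤^Γ. Its nondegeneracy and its positivity on coroots follow from
the invariant form and the trivial center of the simple superalgebra 𝔤^Γ, by
`RootDecomposition.exists_splitReductive`.

Universality. In an object of the category, 𝔰𝔩₂-theory forces the defining relations of the Kac-type
module on every highest weight vector, and the weights of the module it generates lie in λ - Q⁺.
Frobenius reciprocity gives a map from the induced module, which kills the truncation
(`exists_weyl_hom`).

Uniqueness. If W' is another universal object, there are surjections W → W' → W, and it suffices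
that surjective endomorphisms of W are injective (`weyl_endomorphism_injective`). The λ-weight space
of W is cyclic over the commutative algebra generated by (𝔥 ⊗ A)^Γ. An endomorphism therefore acts
on w by an element a of that algebra; surjectivity provides b with b a w = w, and the universal
property turns b into a left inverse. -/

namespace TwistedWeyl

/-! ### Operators satisfying 𝔰𝔩₂ relations, nilpotency and local finiteness. -/

section Operators

variable {V : Type*} [AddCommGroup V] [Module ℂ V]

/-- Operators that satisfy the relations of `𝔰𝔩₂`. -/
structure IsSl2 (e f h : Module.End ℂ V) : Prop where
  e_f : e * f - f * e = h
  h_e : h * e - e * h = (2 : ℂ) • e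
  h_f : h * f - f * h = -((2 : ℂ) • f)

/-- Operators `h`, `e` with `[h, e] = c e`: the powers of `e` shift the eigenvalues of `h`. -/
theorem eigen_pow {h e : Module.End ℂ V} {c : ℂ} (he : h * e - e * h = c • e) {w : ℂ} {u : V}
    (hu : h u = w • u) (p : ℕ) : h ((e ^ p) u) = (w + p * c) • (e ^ p) u := by
  induction p with
  | zero => simpa using hu
  | succ p ih =>
    have h1 := DFunLike.congr_fun he ((e ^ p) u)
    simp only [LinearMap.sub_apply, Module.End.mul_apply, LinearMap.smul_apply, ih, map_smul,
      sub_eq_iff_eq_add] at h1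
    rw [pow_succ', Module.End.mul_apply, h1]
    push_cast
    module

namespace IsSl2

variable {e f h : Module.End ℂ V}

theorem symm (H : IsSl2 e f h) : IsSl2 f e (-h) where
  e_f := by rw [← H.e_f]; noncomm_ring
  h_e := by have := H.h_f; rw [neg_mul, mul_neg, ← neg_eq_iff_eq_neg] at *; rw [← this]; abel
  h_f := by have := H.h_e; rw [neg_mul, mul_neg, ← this]; abel

/-- The Casimir operator of `𝔰𝔩₂`. -/
def casimir (e f h : Module.End ℂ V) : Module.End ℂ V := (4 : ℂ) • (f * e) + h * h + (2 : ℂ) • h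

/-- The symmetry exchanging e and f lets one Casimir operator be controlled from both ends of a
weight string. -/
theorem casimir_symm (H : IsSl2 e f h) : casimir f e (-h) = casimir e f h := by
  have h1 := H.e_f
  simp only [casimir]
  rw [sub_eq_iff_eq_add.1 h1, neg_mul_neg]
  module

theorem casimir_e (H : IsSl2 e f h) : casimir e f h * e = e * casimir e f h := by
  have h1 : e * f = h + f * e := sub_eq_iff_eq_add.1 H.e_f
  have h2 : e * h = h * e - (2 : ℂ) • e := by rw [← H.h_e]; abel
  simp only [casimir, mul_add, add_mul, smul_mul_assoc, mul_smul_comm, ← mul_assoc, h1, h2,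
    sub_mul, smul_sub]
  simp only [mul_assoc, h2, mul_sub, mul_smul_comm]
  module

theorem casimir_h (H : IsSl2 e f h) : casimir e f h * h = h * casimir e f h := by
  have h2 : h * e = e * h + (2 : ℂ) • e := by rw [← H.h_e]; abel
  have h3 : h * f = f * h - (2 : ℂ) • f := by rw [sub_eq_add_neg, ← H.h_f]; abel
  simp only [casimir, mul_add, add_mul, smul_mul_assoc, mul_smul_comm, ← mul_assoc, h3, sub_mul]
  simp only [mul_assoc, h2, mul_add, mul_smul_comm]
  module

variable {N : Submodule ℂ V}

/-- On the vector e^p u, of weight w + 2p, the Casimir operator is 4fe plus the scalar (w + 2p)(w +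
2p + 2). Hence, if e^(p+1) u lies in N, subtracting this scalar from the Casimir operator turns u
into a vector of the same weight whose image under e^p lies in N. Iterating removes all powers of e.
-/
theorem prod_casimir_mem (H : IsSl2 e f h) (hf : ∀ v ∈ N, f v ∈ N) (p : ℕ) :
    ∀ (w : ℂ) (u : V), h u = w • u → (e ^ p) u ∈ N →
    Polynomial.aeval (casimir e f h) (∏ i ∈ Finset.range p,
      (Polynomial.X - Polynomial.C ((w + 2 * i) * (w + 2 * i + 2)))) u ∈ N := by
  induction p with
  | zero => intro w u _ h; simpa using h
  | succ p ih =>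
    intro w u hu hp
    have hC : ∀ k : ℕ, (e ^ k) (casimir e f h u) = casimir e f h ((e ^ k) u) := fun k => by
      have : Commute (casimir e f h) (e ^ k) := Commute.pow_right H.casimir_e k
      exact (DFunLike.congr_fun this u).symm
    have hq : h ((e ^ p) u) = (w + 2 * p) • (e ^ p) u := by
      rw [eigen_pow H.h_e hu, mul_comm (p : ℂ)]
    rw [Finset.prod_range_succ, map_mul, Module.End.mul_apply]
    refine ih w _ ?_ ?_
    · have : h (casimir e f h u) = casimir e f h (h u) :=
        (DFunLike.congr_fun H.casimir_h u).symm
      simp only [map_sub, Polynomial.aeval_X, Polynomial.aeval_C, LinearMap.sub_apply,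
        Module.algebraMap_end_apply, map_smul, this, hu]
      module
    · have h3 : (e ^ p) ((Polynomial.aeval (casimir e f h)
          (Polynomial.X - Polynomial.C ((w + 2 * p) * (w + 2 * p + 2)))) u) =
          (4 : ℂ) • f ((e ^ (p + 1)) u) := by
        simp only [map_sub, Polynomial.aeval_X, Polynomial.aeval_C, LinearMap.sub_apply,
          Module.algebraMap_end_apply, map_smul, hC]
        rw [pow_succ', Module.End.mul_apply]
        simp only [casimir, LinearMap.add_apply, LinearMap.smul_apply, Module.End.mul_apply, hq,
          map_smul]
        module
      rw [h3]
      exact N.smul_mem _ (hf _ hp)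

/-- If a weight vector `u` is killed modulo `N` by `e ^ p` and by `f ^ q`, then `u ∈ N` unless its
weight is `k - i` with `i < p` and `k < q`. -/
theorem mem_of_pow_mem (H : IsSl2 e f h) (he : ∀ v ∈ N, e v ∈ N) (hf : ∀ v ∈ N, f v ∈ N)
    (hh : ∀ v ∈ N, h v ∈ N) {w : ℂ} {u : V} (hu : h u = w • u) {p q : ℕ} (hp : (e ^ p) u ∈ N)
    (hq : (f ^ q) u ∈ N) (hw : ∀ i < p, ∀ k < q, w ≠ (k : ℂ) - i) : u ∈ N := by
  have h1 := H.prod_casimir_mem hf p w u hu hp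
  have h2 := H.symm.prod_casimir_mem he q (-w) u (by simp [hu]) hq
  rw [H.casimir_symm] at h2
  -- Both products of linear factors send u into N. The difference of a root of the first and a root
  -- of the second is 4(i + k + 1)(w - (k - i)), which is nonzero for the excluded weights. A Bézout
  -- identity then puts u itself in N.
  have hcop : IsCoprime (∏ i ∈ Finset.range p,
      (Polynomial.X - Polynomial.C ((w + 2 * i) * (w + 2 * i + 2))))
      (∏ k ∈ Finset.range q,
      (Polynomial.X - Polynomial.C ((-w + 2 * (k : ℂ)) * (-w + 2 * k + 2)))) := by
    refine IsCoprime.prod_left fun i hi => IsCoprime.prod_right fun k hk =>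
      Polynomial.isCoprime_X_sub_C_of_isUnit_sub (isUnit_iff_ne_zero.2 fun h0 => ?_)
    have h3 : (4 : ℂ) * (i + k + 1) * (w - (k - i)) = 0 := by linear_combination h0
    have h4 : (i + k + 1 : ℂ) ≠ 0 := by exact_mod_cast Nat.succ_ne_zero (i + k)
    have h5 : w - (k - i) = 0 := by simpa [h4] using h3
    exact hw i (Finset.mem_range.1 hi) k (Finset.mem_range.1 hk) (sub_eq_zero.1 h5)
  have hC : ∀ v ∈ N, casimir e f h v ∈ N := fun v hv =>
    N.add_mem (N.add_mem (N.smul_mem _ (hf _ (he _ hv))) (hh _ (hh _ hv)))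
      (N.smul_mem _ (hh _ hv))
  have hP : ∀ P : Polynomial ℂ, ∀ v ∈ N, Polynomial.aeval (casimir e f h) P v ∈ N := by
    intro P
    induction P using Polynomial.induction_on' with
    | add P Q hP hQ => intro v hv; rw [map_add]; exact N.add_mem (hP v hv) (hQ v hv)
    | monomial n a =>
      intro v hv
      rw [Polynomial.aeval_monomial]
      refine N.smul_mem _ ?_
      induction n with
      | zero => simpa using hv
      | succ n ih => rw [pow_succ', Module.End.mul_apply]; exact hC _ ih
  obtain ⟨a, b, hab⟩ := hcop
  have h6 := congrArg (fun P => Polynomial.aeval (casimir e f h) P u) hab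
  rw [map_add, map_mul, map_mul, map_one, LinearMap.add_apply, Module.End.mul_apply,
    Module.End.mul_apply, Module.End.one_apply] at h6
  rw [← h6]
  exact N.add_mem (hP a _ h1) (hP b _ h2)

/-- The weights of locally nilpotent `𝔰𝔩₂`-modules are integers. -/
theorem exists_int (H : IsSl2 e f h) {w : ℂ} {u : V} (hu0 : u ≠ 0) (hu : h u = w • u) {p q : ℕ}
    (hp : (e ^ p) u = 0) (hq : (f ^ q) u = 0) : ∃ n : ℤ, w = n := by
  by_contra! hn
  refine hu0 ((Submodule.mem_bot ℂ).1 (H.mem_of_pow_mem (N := ⊥) (by simp) (by simp) (by simp) hu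
    (by simpa using hp) (by simpa using hq) fun i _ k _ h => hn (k - i) ?_))
  rw [h]; push_cast; rfl

/-- A vector that is primitive modulo `N` has nonnegative integral weight. -/
theorem exists_nat (H : IsSl2 e f h) (he : ∀ v ∈ N, e v ∈ N) (hf : ∀ v ∈ N, f v ∈ N)
    (hh : ∀ v ∈ N, h v ∈ N) {w : ℂ} {u : V} (hu0 : u ∉ N) (hu : h u = w • u) {q : ℕ}
    (hp : e u ∈ N) (hq : (f ^ q) u ∈ N) : ∃ n : ℕ, w = n := by
  by_contra! hn
  refine hu0 (H.mem_of_pow_mem (p := 1) he hf hh hu (by simpa using hp) hq fun i hi k _ h =>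
    hn k ?_)
  obtain rfl : i = 0 := by omega
  simpa using h

/-- By `mem_of_pow_mem`, a nonzero u would have weight k - i with i < m, which exceeds -m. This
gives the injectivity of e^m on the weight space of weight -m. -/
theorem eq_zero_of_e_pow (H : IsSl2 e f h) {m : ℕ} {u : V} (hu : h u = -(m : ℂ) • u)
    (hp : (e ^ m) u = 0) {q : ℕ} (hq : (f ^ q) u = 0) : u = 0 := by
  refine (Submodule.mem_bot ℂ).1 (H.mem_of_pow_mem (N := ⊥) (by simp) (by simp) (by simp) hu
    (by simpa using hp) (by simpa using hq) fun i hi k _ h => ?_)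
  have : ((i : ℤ) : ℂ) = ((k + m : ℤ) : ℂ) := by push_cast; linear_combination h
  have := Int.cast_injective this
  omega

theorem eq_zero_of_f_pow (H : IsSl2 e f h) {m : ℕ} {u : V} (hu : h u = (m : ℂ) • u)
    (hp : (f ^ m) u = 0) {q : ℕ} (hq : (e ^ q) u = 0) : u = 0 :=
  H.symm.eq_zero_of_e_pow (by simp [hu]) hp hq

/-- `f ^ (m + 1)` kills the primitive vectors of weight `m` of locally nilpotent modules. -/
theorem f_pow_eq_zero (H : IsSl2 e f h) {m : ℕ} {u : V} (hu : h u = (m : ℂ) • u) (he : e u = 0)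
    {q : ℕ} (hq : (f ^ q) u = 0) : (f ^ (m + 1)) u = 0 := by
  have hw : ∀ k : ℕ, h ((f ^ k) u) = (m - 2 * k : ℂ) • (f ^ k) u := fun k => by
    rw [eigen_pow (c := -2) (by rw [H.h_f, neg_smul]) hu]; congr 1; ring
  have h1 : ∀ k : ℕ, ∃ c : ℂ, e ((f ^ (k + 1)) u) = c • (f ^ k) u := by
    intro k
    have hs : ∀ x : V, e (f x) = h x + f (e x) := fun x => by
      have := DFunLike.congr_fun H.e_f x
      simpa [sub_eq_iff_eq_add] using this
    induction k with
    | zero => exact ⟨m, by simp [hs, hu, he]⟩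
    | succ k ih =>
      obtain ⟨c, hc⟩ := ih
      refine ⟨(m - 2 * (k + 1 : ℕ) : ℂ) + c, ?_⟩
      rw [pow_succ', Module.End.mul_apply, hs, hw, hc, map_smul, ← Module.End.mul_apply,
        ← pow_succ', add_smul]
  have h2 : ∀ k : ℕ, (e ^ (k + 1)) ((f ^ k) u) = 0 := by
    intro k
    induction k with
    | zero => simpa using he
    | succ k ih =>
      obtain ⟨c, hc⟩ := h1 k
      rw [pow_succ, Module.End.mul_apply, hc, map_smul, ih, smul_zero]
  -- The vector f^(m+1) u has weight -(m + 2) and is killed by e^(m+2).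
  refine H.eq_zero_of_e_pow (m := m + 2) ?_ (h2 (m + 1)) (q := q) ?_
  · rw [hw]; congr 1; push_cast; ring
  · rw [← Module.End.mul_apply, ← pow_add, add_comm, pow_add, Module.End.mul_apply, hq, map_zero]

end IsSl2

/-- If `[h, e] = c e` with `c ≠ 0`, then `e` is nilpotent on finite-dimensional subspaces. -/
theorem exists_pow_eq_zero {h e : Module.End ℂ V} {c : ℂ} (hc : c ≠ 0)
    (he : h * e - e * h = c • e) (U : Submodule ℂ V) [FiniteDimensional ℂ U]
    (hU : ∀ v ∈ U, h v ∈ U) (eU : ∀ v ∈ U, e v ∈ U) : ∃ p : ℕ, ∀ u ∈ U, (e ^ p) u = 0 := by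
  let h' : Module.End ℂ U := h.restrict hU
  let e' : Module.End ℂ U := e.restrict eU
  have he' : h' * e' - e' * h' = c • e' := by
    ext x
    exact DFunLike.congr_fun he (x : V)
  -- Under commutation with h', the power e'^p is an eigenvector of eigenvalue p c. If no power
  -- vanished, these distinct eigenvalues would give infinitely many independent elements of a
  -- finite-dimensional space.
  let D : Module.End ℂ (Module.End ℂ U) := LinearMap.mulLeft ℂ h' - LinearMap.mulRight ℂ h'
  have hD : ∀ p : ℕ, D (e' ^ p) = (p * c) • e' ^ p := by
    intro p
    induction p with
    | zero => simp [D]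
    | succ p ih =>
      have h1 : D (e' ^ (p + 1)) = D (e' ^ p) * e' + e' ^ p * (h' * e' - e' * h') := by
        simp only [D, LinearMap.sub_apply, LinearMap.mulLeft_apply, LinearMap.mulRight_apply,
          pow_succ, mul_sub, sub_mul, mul_assoc]
        abel
      rw [h1, ih, he', smul_mul_assoc, mul_smul_comm, ← pow_succ, ← add_smul]
      push_cast
      congr 1
      ring
  have hz : ∃ p, e' ^ p = 0 := by
    by_contra! hne
    have hli := Module.End.eigenvectors_linearIndependent' D (fun p : ℕ => (p : ℂ) * c)
      (fun a b hab => by simpa [hc] using hab) (fun p => e' ^ p)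
      fun p => ⟨Module.End.mem_eigenspace_iff.2 (hD p), hne p⟩
    exact not_finite_iff_infinite.2 inferInstance hli.finite
  obtain ⟨p, hp⟩ := hz
  refine ⟨p, fun u hu => ?_⟩
  have h2 : ∀ k : ℕ, (((e' ^ k) ⟨u, hu⟩ : U) : V) = (e ^ k) u := by
    intro k
    induction k with
    | zero => rfl
    | succ k ih => rw [pow_succ', pow_succ', Module.End.mul_apply, Module.End.mul_apply, ← ih]; rfl
  rw [← h2, hp]
  rfl

/-- The smallest subspace that contains `M` and is stable under a set of operators. -/
def closureUnder (S : Set (Module.End ℂ V)) (M : Set V) : Submodule ℂ V :=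
  sInf {N | M ⊆ N ∧ ∀ T ∈ S, ∀ v ∈ N, T v ∈ N}

theorem subset_closureUnder (S : Set (Module.End ℂ V)) (M : Set V) :
    M ⊆ closureUnder S M := fun _ hv => Submodule.mem_sInf.2 fun _ hN => hN.1 hv

theorem closureUnder_stable {S : Set (Module.End ℂ V)} {M : Set V} {T : Module.End ℂ V}
    (hT : T ∈ S) {v : V} (hv : v ∈ closureUnder S M) : T v ∈ closureUnder S M :=
  Submodule.mem_sInf.2 fun N hN => hN.2 T hT v (Submodule.mem_sInf.1 hv N hN)

theorem closureUnder_le {S : Set (Module.End ℂ V)} {M : Set V} {N : Submodule ℂ V} (hM : M ⊆ N)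
    (hN : ∀ T ∈ S, ∀ v ∈ N, T v ∈ N) : closureUnder S M ≤ N :=
  sInf_le ⟨hM, hN⟩

/-- The weak form of the theorem of Poincaré, Birkhoff and Witt: let a space `L` of operators be
spanned by `X ∪ Y`, where the elements of `X` and `Y` commute up to scalars modulo `L`. If `M` is
stable under `X`, then the closure of `M` under `Y` is stable under `L`. -/
theorem closureUnder_stable_of_span {L : Submodule ℂ (Module.End ℂ V)}
    {X Y : Set (Module.End ℂ V)} (hL : L ≤ Submodule.span ℂ (X ∪ Y))
    (hXY : ∀ x ∈ X, ∀ y ∈ Y, ∃ c : ℂ, x * y - c • (y * x) ∈ L) {M : Submodule ℂ V}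
    (hM : ∀ x ∈ X, ∀ v ∈ M, x v ∈ M) {z : Module.End ℂ V} (hz : z ∈ L) {v : V}
    (hv : v ∈ closureUnder Y (M : Set V)) : z v ∈ closureUnder Y (M : Set V) := by
  set Z := closureUnder Y (M : Set V) with hZ
  have red : ∀ v ∈ Z, (∀ x ∈ X, x v ∈ Z) → ∀ z ∈ L, z v ∈ Z := by
    intro v hv hx z hz
    have : L ≤ Z.comap (LinearMap.applyₗ v) :=
      hL.trans (Submodule.span_le.2 (by
        rintro t (ht | ht)
        · exact hx t ht
        · exact closureUnder_stable ht hv))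
    exact this hz
  -- These are the vectors of Z that X sends into Z. For such v, the identity x y = (x y - c y x) +
  -- c y x shows that y v is again of this kind, because the bracketed operator lies in L and `red`
  -- applies to it.
  let Z' : Submodule ℂ V :=
    { carrier := {v | v ∈ Z ∧ ∀ x ∈ X, x v ∈ Z}
      add_mem' := fun ha hb => ⟨Z.add_mem ha.1 hb.1, fun x hx => by
        rw [map_add]; exact Z.add_mem (ha.2 x hx) (hb.2 x hx)⟩
      zero_mem' := ⟨Z.zero_mem, fun x _ => by rw [map_zero]; exact Z.zero_mem⟩
      smul_mem' := fun c a ha => ⟨Z.smul_mem c ha.1, fun x hx => by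
        rw [map_smul]; exact Z.smul_mem c (ha.2 x hx)⟩ }
  have hZ' : Z ≤ Z' := by
    refine closureUnder_le (fun m hm => ⟨subset_closureUnder _ _ hm, fun x hx =>
      subset_closureUnder _ _ (hM x hx m hm)⟩) fun y hy v hv => ?_
    refine ⟨closureUnder_stable hy hv.1, fun x hx => ?_⟩
    obtain ⟨c, hc⟩ := hXY x hx y hy
    have h1 := red v hv.1 hv.2 _ hc
    have h2 : y (x v) ∈ Z := closureUnder_stable hy (hv.2 x hx)
    have h3 : x (y v) = (x * y - c • (y * x)) v + c • y (x v) := by simp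
    rw [h3]
    exact Z.add_mem h1 (Z.smul_mem c h2)
  exact red v hv (hZ' hv).2 z hz

/-- The subspace of the vectors on which an operator is locally finite. -/
def locallyFinitePart (T : Module.End ℂ V) : Submodule ℂ V where
  carrier := {v | ∃ U : Submodule ℂ V, FiniteDimensional ℂ U ∧ v ∈ U ∧ ∀ u ∈ U, T u ∈ U}
  add_mem' := by
    rintro a b ⟨U, hU, ha, h⟩ ⟨U', hU', hb, h'⟩
    refine ⟨U ⊔ U', inferInstance, Submodule.add_mem_sup ha hb, fun u hu => ?_⟩
    obtain ⟨x, hx, y, hy, rfl⟩ := Submodule.mem_sup.1 hu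
    rw [map_add]
    exact Submodule.add_mem_sup (h x hx) (h' y hy)
  zero_mem' := ⟨⊥, inferInstance, Submodule.zero_mem _, by simp⟩
  smul_mem' := by
    rintro c a ⟨U, hU, ha, h⟩
    exact ⟨U, hU, U.smul_mem c ha, h⟩

theorem mem_locallyFinitePart_of_pow {T : Module.End ℂ V} {v : V} {p : ℕ} (h : (T ^ p) v = 0) :
    v ∈ locallyFinitePart T := by
  induction p generalizing v with
  | zero => simp only [pow_zero, Module.End.one_apply] at h; rw [h]; exact Submodule.zero_mem _
  | succ p ih =>
    obtain ⟨U, hU, h1, h2⟩ := ih (v := T v) (by rwa [pow_succ] at h)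
    refine ⟨U ⊔ ℂ ∙ v, inferInstance,
      Submodule.mem_sup_right (Submodule.mem_span_singleton_self v), fun u hu => ?_⟩
    obtain ⟨x, hx, y, hy, rfl⟩ := Submodule.mem_sup.1 hu
    obtain ⟨c, rfl⟩ := Submodule.mem_span_singleton.1 hy
    rw [map_add, map_smul]
    exact Submodule.mem_sup_left (U.add_mem (h2 x hx) (U.smul_mem c h1))

theorem mem_locallyFinitePart_of_eigen {T : Module.End ℂ V} {v : V} {c : ℂ} (h : T v = c • v) :
    v ∈ locallyFinitePart T := by
  refine ⟨ℂ ∙ v, inferInstance, Submodule.mem_span_singleton_self v, fun u hu => ?_⟩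
  obtain ⟨a, rfl⟩ := Submodule.mem_span_singleton.1 hu
  rw [map_smul, h]
  exact Submodule.smul_mem _ _ (Submodule.smul_mem _ _ (Submodule.mem_span_singleton_self v))

theorem exists_finite_stable {T : Module.End ℂ V} (hT : locallyFinitePart T = ⊤)
    (U : Submodule ℂ V) [FiniteDimensional ℂ U] :
    ∃ U' : Submodule ℂ V, FiniteDimensional ℂ U' ∧ U ≤ U' ∧ ∀ u ∈ U', T u ∈ U' := by
  obtain ⟨s, hs⟩ := (Submodule.fg_iff_finiteDimensional U).2 inferInstance
  have : ∀ v : V, ∃ U : Submodule ℂ V, FiniteDimensional ℂ U ∧ v ∈ U ∧ ∀ u ∈ U, T u ∈ U :=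
    fun v => (hT ▸ Submodule.mem_top : v ∈ locallyFinitePart T)
  choose F hF1 hF2 hF3 using this
  refine ⟨⨆ v ∈ s, F v, Submodule.finiteDimensional_finset_sup s F |> fun h => by
    rwa [Finset.sup_eq_iSup] at h, ?_, fun u hu => ?_⟩
  · rw [← hs]
    exact Submodule.span_le.2 fun v hv =>
      (le_iSup₂ (f := fun v (_ : v ∈ s) => F v) v hv) (hF2 v)
  · have : (⨆ v ∈ s, F v) ≤ (⨆ v ∈ s, F v).comap T := iSup₂_le fun v hv x hx =>
      (le_iSup₂ (f := fun v (_ : v ∈ s) => F v) v hv) (hF3 v x hx)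
    exact this hu

/-! ### Words in finitely many operators spanning a Lie algebra. -/

section Words

variable {N : ℕ} (x : Fin N → Module.End ℂ V)

/-- The span of the words of length less than `d` in the operators `x i`. -/
def words (d : ℕ) : Submodule ℂ (Module.End ℂ V) :=
  Submodule.span ℂ {T | ∃ l : List (Fin N), l.length < d ∧ T = (l.map x).prod}

theorem mul_words {d : ℕ} (i : Fin N) {T : Module.End ℂ V} (hT : T ∈ words x d) :
    x i * T ∈ words x (d + 1) := by
  have : words x d ≤ (words x (d + 1)).comap (LinearMap.mulLeft ℂ (x i)) :=
    Submodule.span_le.2 (by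
      rintro _ ⟨l, hl, rfl⟩
      exact Submodule.subset_span ⟨i :: l, by simpa using hl, by simp⟩)
  exact this hT

/-- Interchanging two adjacent letters changes a word by a commutator, which is a combination of
single letters and so produces shorter words. -/
theorem perm_sub_mem_words
    (hx : ∀ i j, x i * x j - x j * x i ∈ Submodule.span ℂ (Set.range x))
    {l l' : List (Fin N)} (h : l.Perm l') :
    (l.map x).prod - (l'.map x).prod ∈ words x l.length := by
  induction h with
  | nil => simp
  | cons i h ih =>
    simp only [List.map_cons, List.prod_cons, ← mul_sub, List.length_cons]
    exact mul_words x i ih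
  | swap i j l =>
    have h1 : (((j :: i :: l).map x).prod - ((i :: j :: l).map x).prod) =
        (x j * x i - x i * x j) * (l.map x).prod := by
      simp [sub_mul, mul_assoc]
    rw [h1]
    have : Submodule.span ℂ (Set.range x) ≤
        (words x (j :: i :: l).length).comap (LinearMap.mulRight ℂ (l.map x).prod) :=
      Submodule.span_le.2 (by
        rintro _ ⟨k, rfl⟩
        exact Submodule.subset_span ⟨k :: l, by simp, by simp⟩)
    exact this (hx j i)
  | trans h1 h2 ih1 ih2 =>
    rw [← h1.length_eq] at ih2
    rw [← sub_add_sub_cancel]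
    exact Submodule.add_mem _ ih1 ih2

/-- A finite-dimensional Lie algebra that is spanned by locally finite operators is locally
finite. -/
theorem exists_finite_stable_of_span
    (hx : ∀ i j, x i * x j - x j * x i ∈ Submodule.span ℂ (Set.range x))
    (hfin : ∀ i, locallyFinitePart (x i) = ⊤) (v : V) :
    ∃ U : Submodule ℂ V, FiniteDimensional ℂ U ∧ v ∈ U ∧ ∀ i, ∀ u ∈ U, x i u ∈ U := by
  -- For each k, one finite-dimensional space contains all increasing monomials in the last k
  -- operators, applied to v. In an increasing word a new, smaller letter stands on the left, so it
  -- suffices to enlarge the space to a finite-dimensional one stable under that letter.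
  have hF : ∀ k : ℕ, ∃ F : Submodule ℂ V, FiniteDimensional ℂ F ∧ v ∈ F ∧
      ∀ l : List (Fin N), l.Pairwise (· ≤ ·) → (∀ i ∈ l, N ≤ i.val + k) →
        (l.map x).prod v ∈ F := by
    intro k
    induction k with
    | zero =>
      refine ⟨ℂ ∙ v, inferInstance, Submodule.mem_span_singleton_self v, fun l _ hl => ?_⟩
      cases l with
      | nil => simp [Submodule.mem_span_singleton_self]
      | cons i l => exact absurd (hl i (by simp)) (by omega)
    | succ k ih =>
      obtain ⟨F, hF, hv, hl⟩ := ih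
      by_cases hk : k + 1 ≤ N
      · obtain ⟨U, hU, hFU, hst⟩ := exists_finite_stable (hfin ⟨N - (k + 1), by omega⟩) F
        refine ⟨U, hU, hFU hv, fun l => ?_⟩
        induction l with
        | nil => intro _ _; simpa using hFU hv
        | cons i l ihl =>
          intro hs hi
          by_cases h0 : i = ⟨N - (k + 1), by omega⟩
          · subst h0
            simp only [List.map_cons, List.prod_cons, Module.End.mul_apply]
            exact hst _ (ihl (List.pairwise_cons.1 hs).2 fun a ha => hi a (by simp [ha]))
          · refine hFU (hl _ hs fun a ha => ?_)
            have h1 : N ≤ i.val + k := by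
              have := hi i (by simp)
              have h2 : i.val ≠ N - (k + 1) := fun h => h0 (Fin.ext h)
              omega
            rcases List.mem_cons.1 ha with rfl | ha
            · exact h1
            · have := (List.pairwise_cons.1 hs).1 a ha
              have : i.val ≤ a.val := this
              omega
      · exact ⟨F, hF, hv, fun l hs _ => hl l hs fun i _ => by have := i.2; omega⟩
  obtain ⟨F, hF, -, hl⟩ := hF N
  -- Induction on length: sorting a word changes it only by shorter words, and the sorted word is
  -- covered by the case k = N above.
  have hw : ∀ d : ℕ, ∀ T ∈ words x d, T v ∈ F := by
    intro d
    induction d with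
    | zero =>
      intro T hT
      have : words x 0 ≤ ⊥ := Submodule.span_le.2 (by rintro _ ⟨l, hl, -⟩; simp at hl)
      have h0 : T = 0 := (Submodule.mem_bot ℂ).1 (this hT)
      rw [h0]; exact F.zero_mem
    | succ d ih =>
      have : words x (d + 1) ≤ F.comap (LinearMap.applyₗ v) := Submodule.span_le.2 (by
        rintro _ ⟨l, hd, rfl⟩
        have h1 := perm_sub_mem_words x hx (List.mergeSort_perm l (· ≤ ·))
        rw [List.length_mergeSort] at h1
        have h2 := ih _ (Submodule.span_mono (by
          rintro _ ⟨l', hl', rfl⟩; exact ⟨l', by omega, rfl⟩) h1)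
        have h3 := hl (l.mergeSort (· ≤ ·)) (by
          simpa using List.pairwise_mergeSort' (r := (· ≤ ·)) l) (fun i _ => by omega)
        have h4 : (l.map x).prod v = ((l.mergeSort (· ≤ ·)).map x).prod v -
          (((l.mergeSort (· ≤ ·)).map x).prod - (l.map x).prod) v := by simp
        change (l.map x).prod v ∈ F
        rw [h4]
        exact F.sub_mem h3 h2)
      exact fun T hT => this hT
  let U : Submodule ℂ V := Submodule.span ℂ {u | ∃ l : List (Fin N), u = (l.map x).prod v}
  have hUF : U ≤ F := Submodule.span_le.2 (by
    rintro _ ⟨l, rfl⟩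
    exact hw (l.length + 1) _ (Submodule.subset_span ⟨l, by omega, rfl⟩))
  refine ⟨U, Submodule.finiteDimensional_of_le hUF, Submodule.subset_span ⟨[], by simp⟩,
    fun i u hu => ?_⟩
  have : U ≤ U.comap (x i) := Submodule.span_le.2 (by
    rintro _ ⟨l, rfl⟩
    exact Submodule.subset_span ⟨i :: l, by simp⟩)
  exact this hu

end Words

/-! ### Simultaneous eigenspaces. -/

section Weights

variable {T : Type*} [AddCommGroup T] [Module ℂ T]

/-- The simultaneous eigenspace of a linear family of operators. -/
def wtSpace (a : T →ₗ[ℂ] Module.End ℂ V) (μ : Module.Dual ℂ T) : Submodule ℂ V where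
  carrier := {v | ∀ h, a h v = μ h • v}
  add_mem' ha hb h := by rw [map_add, ha h, hb h, smul_add]
  zero_mem' h := by simp
  smul_mem' c v hv h := by rw [map_smul, hv h, smul_comm]

variable {a : T →ₗ[ℂ] Module.End ℂ V}

theorem mem_wtSpace {μ : Module.Dual ℂ T} {v : V} :
    v ∈ wtSpace a μ ↔ ∀ h, a h v = μ h • v := Iff.rfl

/-- A stable subspace contains the weight components of its elements. -/
theorem mem_of_sum_mem_of_wtSpace {N : Submodule ℂ V} (hN : ∀ h, ∀ v ∈ N, a h v ∈ N)
    (s : Finset (Module.Dual ℂ T)) : ∀ v : Module.Dual ℂ T → V, (∀ μ ∈ s, v μ ∈ wtSpace a μ) →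
    ∑ μ ∈ s, v μ ∈ N → ∀ μ ∈ s, v μ ∈ N := by
  classical
  induction s using Finset.induction_on with
  | empty => simp
  | insert ν s hν ih =>
    intro v hv hsum
    have h1 : ∀ μ ∈ s, v μ ∈ N := by
      intro μ hμ
      have hne : μ ≠ ν := fun h => hν (h ▸ hμ)
      obtain ⟨h, hh⟩ : ∃ h, μ h ≠ ν h := by
        by_contra! hc
        exact hne (LinearMap.ext hc)
      -- Applying a h - ν h removes the ν-component and multiplies the μ-component by the nonzero
      -- scalar μ h - ν h.
      have h2 := N.sub_mem (hN h _ hsum) (N.smul_mem (ν h) hsum)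
      rw [Finset.sum_insert hν, map_add, map_sum, hv ν (Finset.mem_insert_self _ _) h, smul_add,
        add_sub_add_left_eq_sub, Finset.smul_sum, ← Finset.sum_sub_distrib] at h2
      have h3 := ih (fun κ => (κ h - ν h) • v κ)
        (fun κ hκ => Submodule.smul_mem _ _ (hv κ (Finset.mem_insert_of_mem hκ)))
        (by
          convert h2 using 1
          refine Finset.sum_congr rfl fun κ hκ => ?_
          rw [hv κ (Finset.mem_insert_of_mem hκ) h, sub_smul]) μ hμ
      exact (N.smul_mem_iff (sub_ne_zero.2 hh)).1 h3
    intro μ hμ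
    rcases Finset.mem_insert.1 hμ with rfl | hμ
    · rw [Finset.sum_insert hν] at hsum
      simpa using N.sub_mem hsum (N.sum_mem h1)
    · exact h1 μ hμ

theorem iSupIndep_wtSpace : iSupIndep (wtSpace a) := by
  classical
  rw [iSupIndep_iff_finsetSum_eq_zero_imp_eq_zero]
  intro s v hv hsum μ hμ
  exact (Submodule.mem_bot ℂ).1 (mem_of_sum_mem_of_wtSpace (N := ⊥) (by simp) s v hv
    (by simpa using hsum) μ hμ)

theorem exists_sum_of_mem_iSup_wtSpace {P : Set (Module.Dual ℂ T)} {v : V}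
    (hv : v ∈ ⨆ μ ∈ P, wtSpace a μ) : ∃ (s : Finset (Module.Dual ℂ T)) (f : Module.Dual ℂ T → V),
      (∀ μ ∈ s, μ ∈ P ∧ f μ ∈ wtSpace a μ) ∧ ∑ μ ∈ s, f μ = v := by
  classical
  obtain ⟨f, hf, hs⟩ := (Submodule.mem_iSup_iff_exists_finsupp _ _).1 hv
  refine ⟨f.support, f, fun μ hμ => ?_, hs⟩
  have h1 := hf μ
  by_cases hP : μ ∈ P
  · simp only [hP, iSup_pos] at h1
    exact ⟨hP, h1⟩
  · simp only [hP, iSup_false, Submodule.mem_bot] at h1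
    exact absurd h1 (Finsupp.mem_support_iff.1 hμ)

theorem le_iSup_inf_wtSpace {N : Submodule ℂ V} (hN : ∀ h, ∀ v ∈ N, a h v ∈ N)
    {P : Set (Module.Dual ℂ T)} (hP : N ≤ ⨆ μ ∈ P, wtSpace a μ) :
    N ≤ ⨆ μ ∈ P, N ⊓ wtSpace a μ := by
  intro n hn
  obtain ⟨s, f, hf, rfl⟩ := exists_sum_of_mem_iSup_wtSpace (hP hn)
  have h1 := mem_of_sum_mem_of_wtSpace hN s f (fun μ hμ => (hf μ hμ).2) hn
  exact Submodule.sum_mem _ fun μ hμ =>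
    (le_iSup₂ (f := fun μ (_ : μ ∈ P) => N ⊓ wtSpace a μ) μ (hf μ hμ).1) ⟨h1 μ hμ, (hf μ hμ).2⟩

/-- A weight vector in a sum of weight spaces belongs to one of them. -/
theorem mem_of_mem_iSup_wtSpace {P : Set (Module.Dual ℂ T)} {v : V} {ν : Module.Dual ℂ T}
    (hν : v ∈ wtSpace a ν) (hv0 : v ≠ 0) (hv : v ∈ ⨆ μ ∈ P, wtSpace a μ) : ν ∈ P := by
  by_contra hP
  refine hv0 ((Submodule.mem_bot ℂ).1 (iSupIndep_wtSpace.disjoint_biSup (x := ν) hP |>.le_bot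
    ⟨hν, hv⟩))

end Weights

end Operators

end TwistedWeyl

namespace TwistedWeyl

/-! ### Direct sums of irreducible finite-dimensional modules. -/

section Semisimple

variable {V : Type*} [AddCommGroup V] [Module ℂ V]

/-- The subspace of the vectors that lie in a finite-dimensional subspace that is stable under
`t`. -/
def finitePart (t : Set (Module.End ℂ V)) : Submodule ℂ V where
  carrier := {v | ∃ U : Submodule ℂ V, FiniteDimensional ℂ U ∧ v ∈ U ∧ ∀ T ∈ t, ∀ u ∈ U, T u ∈ U}
  add_mem' := by
    rintro a b ⟨U, hU, ha, h⟩ ⟨U', hU', hb, h'⟩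
    refine ⟨U ⊔ U', inferInstance, Submodule.add_mem_sup ha hb, fun T hT u hu => ?_⟩
    obtain ⟨x, hx, y, hy, rfl⟩ := Submodule.mem_sup.1 hu
    rw [map_add]
    exact Submodule.add_mem_sup (h T hT x hx) (h' T hT y hy)
  zero_mem' := ⟨⊥, inferInstance, Submodule.zero_mem _, by simp⟩
  smul_mem' := by
    rintro c a ⟨U, hU, ha, h⟩
    exact ⟨U, hU, U.smul_mem c ha, h⟩

theorem finitePart_eq_top_of_semisimple {t : Set (Module.End ℂ V)} (h : IsFinitelySemisimple t) :
    finitePart t = ⊤ := by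
  obtain ⟨S, -, hS, hN⟩ := h
  rw [← top_le_iff, ← hS]
  exact sSup_le fun N hNS v hv => ⟨N, (hN N hNS).1, hv, (hN N hNS).2.2.1⟩

/-- A subspace that is stable under `t`, as a module over the algebra generated by `t`. -/
def adjoinSubmodule (t : Set (Module.End ℂ V)) (N : Submodule ℂ V)
    (hN : ∀ T ∈ t, ∀ v ∈ N, T v ∈ N) : Submodule (Algebra.adjoin ℂ t) V where
  carrier := N
  add_mem' := N.add_mem
  zero_mem' := N.zero_mem
  smul_mem' := by
    rintro ⟨r, hr⟩ v hv
    change r v ∈ N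
    revert v
    induction hr using Algebra.adjoin_induction with
    | mem T hT => exact fun hv => hN T hT _ hv
    | algebraMap c => exact fun hv => N.smul_mem c hv
    | add x y _ _ hx hy => exact fun hv => N.add_mem (hx hv) (hy hv)
    | mul x y _ _ hx hy => exact fun hv => hx (hy hv)

theorem stable_of_adjoin {t : Set (Module.End ℂ V)} (N : Submodule (Algebra.adjoin ℂ t) V) :
    ∀ T ∈ t, ∀ v ∈ N, T v ∈ N := fun T hT _ hv =>
  N.smul_mem (⟨T, Algebra.subset_adjoin hT⟩ : Algebra.adjoin ℂ t) hv

/-- The irreducible finite-dimensional subspaces for a set of operators. -/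
def IsSimpleFor (t : Set (Module.End ℂ V)) (N : Submodule ℂ V) : Prop :=
  FiniteDimensional ℂ N ∧ N ≠ ⊥ ∧ (∀ T ∈ t, ∀ v ∈ N, T v ∈ N) ∧
    ∀ N' ≤ N, (∀ T ∈ t, ∀ v ∈ N', T v ∈ N') → N' = ⊥ ∨ N' = N

/-- Stable subspaces are submodules over the algebra generated by the operators, so irreducible
subspaces become atoms of a submodule lattice. This makes the lattice-theoretic decomposition into
independent atoms available. -/
theorem isSimpleFor_iff {t : Set (Module.End ℂ V)} (N : Submodule (Algebra.adjoin ℂ t) V) :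
    IsSimpleFor t (N.restrictScalars ℂ) ↔ FiniteDimensional ℂ N ∧ IsAtom N := by
  have hinj := Submodule.restrictScalars_injective ℂ (Algebra.adjoin ℂ t) V
  constructor
  · rintro ⟨h1, h2, -, h3⟩
    refine ⟨h1, fun h => h2 (by rw [h]; rfl), fun M hM => ?_⟩
    rcases h3 (M.restrictScalars ℂ) hM.le (stable_of_adjoin M) with h | h
    · exact hinj h
    · exact absurd (hinj h) hM.ne
  · rintro ⟨h1, h2, h3⟩
    refine ⟨h1, fun h => h2 (hinj h), stable_of_adjoin N, fun N' hN' hst => ?_⟩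
    rcases (show adjoinSubmodule t N' hst ≤ N from hN').eq_or_lt with h | h
    · exact Or.inr (congrArg (Submodule.restrictScalars ℂ) h)
    · exact Or.inl (congrArg (Submodule.restrictScalars ℂ) (h3 _ h))

/-- A sum of irreducible finite-dimensional modules is a direct sum of such modules. -/
theorem isFinitelySemisimple_of_sSup {t : Set (Module.End ℂ V)}
    (h : sSup {N | IsSimpleFor t N} = ⊤) : IsFinitelySemisimple t := by
  let R := Algebra.adjoin ℂ t
  let X : Set (Submodule R V) := {N | FiniteDimensional ℂ N ∧ IsAtom N}
  have hX : sSup X = ⊤ := by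
    refine eq_top_iff.2 fun v _ => ?_
    have h1 : sSup {N | IsSimpleFor t N} ≤ (sSup X).restrictScalars ℂ := by
      refine sSup_le fun N hN => ?_
      have h2 : IsSimpleFor t ((adjoinSubmodule t N hN.2.2.1).restrictScalars ℂ) := hN
      exact le_sSup (show adjoinSubmodule t N hN.2.2.1 ∈ X from (isSimpleFor_iff _).1 h2)
    exact h1 (h ▸ Submodule.mem_top)
  have hfin : finitePart t = ⊤ := by
    rw [← top_le_iff, ← h]
    exact sSup_le fun N hN v hv => ⟨N, hN.1, hv, hN.2.2.1⟩
  have hX' : sSup {N : Submodule R V | IsAtom N} = ⊤ :=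
    top_le_iff.1 (hX ▸ sSup_le_sSup fun N hN => hN.2)
  obtain ⟨s, hs, hsc, hat⟩ := exists_sSupIndep_of_sSup_atoms_eq_top hX'
  have hinj := Submodule.restrictScalars_injective ℂ R V
  refine ⟨Submodule.restrictScalars ℂ '' s, ?_, ?_, ?_⟩
  · rintro _ ⟨a, ha, rfl⟩
    have h1 := (hs ha).le_bot
    rw [← Set.image_singleton, ← Set.image_sdiff hinj, ← Submodule.restrictScalars_sSup,
      disjoint_iff_inf_le]
    exact h1
  · rw [← Submodule.restrictScalars_sSup, hsc]
    rfl
  · rintro _ ⟨a, ha, rfl⟩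
    refine (isSimpleFor_iff a).2 ⟨?_, hat ha⟩
    -- The chosen atoms need not come from the given family, so their finite dimension has to be
    -- shown again: an atom that meets a finite-dimensional stable subspace nontrivially is
    -- contained in it.
    obtain ⟨v, hv, hv0⟩ := (Submodule.ne_bot_iff a).1 (hat ha).1
    obtain ⟨U, hU, hvU, hst⟩ := (hfin ▸ Submodule.mem_top : v ∈ finitePart t)
    have h2 : a ≤ adjoinSubmodule t U hst := by
      by_contra hle
      have h3 := (hat ha).2 (a ⊓ adjoinSubmodule t U hst) (inf_lt_left.2 hle)
      have h4 : v ∈ a ⊓ adjoinSubmodule t U hst := ⟨hv, hvU⟩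
      rw [h3] at h4
      exact hv0 ((Submodule.mem_bot R).1 h4)
    have h5 : a.restrictScalars ℂ ≤ U := h2
    exact Submodule.finiteDimensional_of_le h5

end Semisimple

end TwistedWeyl

namespace TwistedWeyl

/-! ### Split reductive Lie algebras: roots, coroots and the invariant form. -/

section Reductive

/-- A finite-dimensional reductive Lie algebra `K` with a splitting Cartan subalgebra `j : T → K`, a
basis of weight vectors, a system of positive weights, an invariant form that is positive definite
on the coroots, and an `𝔰𝔩₂`-triple for each nonzero weight. -/
structure SplitReductive (K T ι J : Type*) [LieRing K] [LieAlgebra ℂ K] [AddCommGroup T]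
    [Module ℂ T] [Fintype ι] [Fintype J] where
  j : T →ₗ[ℂ] K
  j_injective : Function.Injective j
  lie_j : ∀ h h', ⁅j h, j h'⁆ = 0
  b : Module.Basis ι ℂ K
  wt : ι → Module.Dual ℂ T
  lie_b : ∀ h i, ⁅j h, b i⁆ = wt i h • b i
  mem_range_j : ∀ i, wt i = 0 → b i ∈ LinearMap.range j
  Qp : AddSubmonoid (Module.Dual ℂ T)
  ht : Module.Dual ℂ T →ₗ[ℂ] ℂ
  ht_Qp : ∀ q ∈ Qp, ∃ n : ℕ, ht q = n ∧ (n = 0 → q = 0)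
  wt_mem : ∀ i, wt i ∈ Qp ∨ -wt i ∈ Qp
  κ : LinearMap.BilinForm ℂ K
  κ_nondegenerate : κ.Nondegenerate
  κ_symm : ∀ x y, κ x y = κ y x
  κ_lie : ∀ x y z, κ ⁅x, y⁆ z = κ x ⁅y, z⁆
  -- The functionals η are meant to be the weights of a faithful module whose trace form is κ. Their
  -- integrality on the coroots makes κ positive there.
  η : J → Module.Dual ℂ T
  κ_j : ∀ h h', κ (j h) (j h') = ∑ k, η k h * η k h'
  η_sep : ∀ h, (∀ k, η k h = 0) → h = 0
  x : ι → K
  y : ι → K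
  cr : ι → T
  lie_x : ∀ i, wt i ≠ 0 → ∀ h, ⁅j h, x i⁆ = wt i h • x i
  lie_y : ∀ i, wt i ≠ 0 → ∀ h, ⁅j h, y i⁆ = -(wt i h • y i)
  lie_x_y : ∀ i, wt i ≠ 0 → ⁅x i, y i⁆ = j (cr i)
  wt_cr : ∀ i, wt i ≠ 0 → wt i (cr i) = 2
  η_cr : ∀ i, wt i ≠ 0 → ∀ k, ∃ n : ℤ, η k (cr i) = n

/-- Every integer w is the sum over m > 0 of m([w = m] - [w = -m]). After exchanging the sums, each
m contributes m times a nonnegative difference of cardinalities. -/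
theorem sum_nonneg_of_card_le {α : Type*} (s : Finset α) (w : α → ℤ)
    (h : ∀ m : ℤ, 0 < m → (s.filter fun k => w k = -m).card ≤ (s.filter fun k => w k = m).card) :
    0 ≤ ∑ k ∈ s, w k := by
  classical
  obtain ⟨M, hM⟩ : ∃ M : ℤ, ∀ k ∈ s, |w k| ≤ M := by
    refine ⟨∑ k ∈ s, |w k|, fun k hk => ?_⟩
    exact Finset.single_le_sum (f := fun k => |w k|) (fun _ _ => abs_nonneg _) hk
  have h1 : ∀ k ∈ s, w k = ∑ m ∈ Finset.Icc 1 M,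
      ((if w k = m then m else 0) - (if w k = -m then m else 0)) := by
    intro k hk
    have hk' := abs_le.1 (hM k hk)
    rw [Finset.sum_sub_distrib]
    rcases lt_trichotomy (w k) 0 with hw | hw | hw
    · rw [Finset.sum_eq_zero, Finset.sum_eq_single_of_mem (-w k)]
      · simp
      · simp only [Finset.mem_Icc]; omega
      · intro m _ hm; rw [if_neg]; omega
      · intro m hm; simp only [Finset.mem_Icc] at hm; rw [if_neg]; omega
    · rw [Finset.sum_eq_zero, Finset.sum_eq_zero, hw]
      · simp
      · intro m hm; simp only [Finset.mem_Icc] at hm; rw [if_neg]; omega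
      · intro m hm; simp only [Finset.mem_Icc] at hm; rw [if_neg]; omega
    · rw [Finset.sum_eq_single_of_mem (w k), Finset.sum_eq_zero]
      · simp
      · intro m hm; simp only [Finset.mem_Icc] at hm; rw [if_neg]; omega
      · simp only [Finset.mem_Icc]; omega
      · intro m _ hm; rw [if_neg]; omega
  rw [Finset.sum_congr rfl h1, Finset.sum_comm]
  refine Finset.sum_nonneg fun m hm => ?_
  simp only [Finset.mem_Icc] at hm
  rw [Finset.sum_sub_distrib, ← Finset.sum_filter, ← Finset.sum_filter, Finset.sum_const,
    Finset.sum_const, sub_nonneg]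
  exact smul_le_smul_of_nonneg_right (h m (by omega)) (by omega)

/-- A representation of a Lie algebra. -/
structure LieRep (K V : Type*) [LieRing K] [LieAlgebra ℂ K] [AddCommGroup V] [Module ℂ V] where
  toLin : K →ₗ[ℂ] Module.End ℂ V
  map_lie : ∀ z z', toLin ⁅z, z'⁆ = toLin z * toLin z' - toLin z' * toLin z

namespace LieRep

variable {K V : Type*} [LieRing K] [LieAlgebra ℂ K] [AddCommGroup V] [Module ℂ V]

instance : CoeFun (LieRep K V) fun _ => K → Module.End ℂ V := ⟨fun φ => φ.toLin⟩

theorem lie_apply (φ : LieRep K V) (z z' : K) (v : V) :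
    φ ⁅z, z'⁆ v = φ z (φ z' v) - φ z' (φ z v) := by
  rw [φ.map_lie]
  rfl

/-- The adjoint representation. -/
def ad (K : Type*) [LieRing K] [LieAlgebra ℂ K] : LieRep K K where
  toLin := LinearMap.mk₂ ℂ (fun z z' => ⁅z, z'⁆) add_lie (fun c z z' => smul_lie c z z') lie_add
    (fun c z z' => lie_smul c z z')
  map_lie z z' := LinearMap.ext fun x => lie_lie z z' x

theorem ad_apply (z z' : K) : ad K z z' = ⁅z, z'⁆ := rfl

end LieRep

namespace SplitReductive

variable {K T ι J : Type*} [LieRing K] [LieAlgebra ℂ K] [AddCommGroup T] [Module ℂ T] [Fintype ι]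
  [Fintype J] (D : SplitReductive K T ι J)
variable {V : Type*} [AddCommGroup V] [Module ℂ V] (φ : LieRep K V)

/-- The action of the Cartan subalgebra. -/
def cartanAct : T →ₗ[ℂ] Module.End ℂ V := φ.toLin ∘ₗ D.j

/-- The weight spaces of a `K`-module. -/
abbrev wts (μ : Module.Dual ℂ T) : Submodule ℂ V := wtSpace (D.cartanAct φ) μ

theorem mem_wts {μ : Module.Dual ℂ T} {v : V} : v ∈ D.wts φ μ ↔ ∀ h, φ (D.j h) v = μ h • v :=
  Iff.rfl

/-- The weight spaces of the adjoint module. -/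
abbrev rts (ν : Module.Dual ℂ T) : Submodule ℂ K := D.wts (LieRep.ad K) ν

theorem mem_rts {ν : Module.Dual ℂ T} {z : K} : z ∈ D.rts ν ↔ ∀ h, ⁅D.j h, z⁆ = ν h • z := Iff.rfl

variable {φ} in
theorem act_mem_wts {μ ν : Module.Dual ℂ T} {z : K} (hz : z ∈ D.rts ν) {v : V}
    (hv : v ∈ D.wts φ μ) : φ z v ∈ D.wts φ (μ + ν) := by
  intro h
  have h1 := φ.lie_apply (D.j h) z v
  rw [D.mem_rts.1 hz h, (D.mem_wts φ).1 hv h, map_smul, map_smul, LinearMap.smul_apply,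
    eq_sub_iff_add_eq] at h1
  change φ (D.j h) (φ z v) = _
  rw [← h1, LinearMap.add_apply, add_smul, add_comm]

theorem isSl2 {i : ι} (hi : D.wt i ≠ 0) :
    IsSl2 (φ (D.x i)) (φ (D.y i)) (φ (D.j (D.cr i))) where
  e_f := by rw [← D.lie_x_y i hi, φ.map_lie]
  h_e := by rw [← φ.map_lie, D.lie_x i hi, D.wt_cr i hi, map_smul]
  h_f := by rw [← φ.map_lie, D.lie_y i hi, D.wt_cr i hi, map_neg, map_smul]

theorem b_mem (i : ι) : D.b i ∈ D.rts (D.wt i) := fun h => D.lie_b h i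

theorem x_mem {i : ι} (hi : D.wt i ≠ 0) : D.x i ∈ D.rts (D.wt i) := fun h => D.lie_x i hi h

theorem y_mem {i : ι} (hi : D.wt i ≠ 0) : D.y i ∈ D.rts (-D.wt i) := fun h => by
  rw [LinearMap.neg_apply, neg_smul]; exact D.lie_y i hi h

theorem repr_eq_zero {ν : Module.Dual ℂ T} {z : K} (hz : z ∈ D.rts ν) {i : ι} (hi : D.wt i ≠ ν) :
    D.b.repr z i = 0 := by
  obtain ⟨h, hh⟩ : ∃ h, D.wt i h ≠ ν h := by
    by_contra! hc; exact hi (LinearMap.ext hc)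
  have h1 : ∀ z : K, D.b.repr ⁅D.j h, z⁆ i = D.wt i h * D.b.repr z i := by
    intro z
    conv_lhs => rw [← D.b.sum_repr z]
    simp only [lie_sum, lie_smul, D.lie_b, map_sum, map_smul, Module.Basis.repr_self,
      Finsupp.finsetSum_apply, Finsupp.smul_apply, smul_eq_mul]
    rw [Finset.sum_eq_single i]
    · simp [mul_comm]
    · intro k _ hk; simp [hk]
    · simp
  have h2 := h1 z
  rw [D.mem_rts.1 hz h, map_smul, Finsupp.smul_apply, smul_eq_mul] at h2
  have h3 : (D.wt i h - ν h) * D.b.repr z i = 0 := by rw [sub_mul, h2]; ring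
  exact (mul_eq_zero.1 h3).resolve_left (sub_ne_zero.2 hh)

theorem mem_span_b {ν : Module.Dual ℂ T} {z : K} (hz : z ∈ D.rts ν) :
    z ∈ Submodule.span ℂ (D.b '' {i | D.wt i = ν}) := by
  rw [← D.b.sum_repr z]
  refine Submodule.sum_mem _ fun i _ => ?_
  by_cases hi : D.wt i = ν
  · exact Submodule.smul_mem _ _ (Submodule.subset_span ⟨i, hi, rfl⟩)
  · rw [D.repr_eq_zero hz hi, zero_smul]; exact Submodule.zero_mem _

theorem exists_wt_eq {ν : Module.Dual ℂ T} {z : K} (hz : z ∈ D.rts ν) (hz0 : z ≠ 0) :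
    ∃ i, D.wt i = ν := by
  by_contra! hc
  refine hz0 ?_
  rw [← D.b.sum_repr z]
  exact Finset.sum_eq_zero fun i _ => by rw [D.repr_eq_zero hz (hc i), zero_smul]

theorem mem_range_of_rts_zero {z : K} (hz : z ∈ D.rts 0) : ∃ h, D.j h = z := by
  have : Submodule.span ℂ (D.b '' {i | D.wt i = 0}) ≤ LinearMap.range D.j :=
    Submodule.span_le.2 (by rintro _ ⟨i, hi, rfl⟩; exact D.mem_range_j i hi)
  exact this (D.mem_span_b hz)

theorem cr_ne_zero {i : ι} (hi : D.wt i ≠ 0) : D.cr i ≠ 0 := fun h => by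
  have := D.wt_cr i hi
  rw [h, map_zero] at this
  norm_num at this

theorem y_ne_zero {i : ι} (hi : D.wt i ≠ 0) : D.y i ≠ 0 := fun h => by
  have := D.lie_x_y i hi
  rw [h, lie_zero] at this
  exact D.cr_ne_zero hi (D.j_injective (by rw [← this, map_zero]))

theorem exists_wt_eq_neg (i : ι) : ∃ k, D.wt k = -D.wt i := by
  by_cases hi : D.wt i = 0
  · exact ⟨i, by rw [hi, neg_zero]⟩
  · exact D.exists_wt_eq (D.y_mem hi) (D.y_ne_zero hi)

/-- Positive weights. -/
def Pos (i : ι) : Prop := D.wt i ≠ 0 ∧ D.wt i ∈ D.Qp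

theorem eq_zero_of_neg_mem {q : Module.Dual ℂ T} (h1 : q ∈ D.Qp) (h2 : -q ∈ D.Qp) : q = 0 := by
  obtain ⟨n, hn, h0⟩ := D.ht_Qp _ h1
  obtain ⟨m, hm, -⟩ := D.ht_Qp _ h2
  rw [map_neg, hn] at hm
  have h3 : ((n + m : ℕ) : ℂ) = 0 := by push_cast; rw [← hm]; ring
  have h4 : n + m = 0 := by exact_mod_cast h3
  exact h0 (by omega)

theorem ht_pos {q : Module.Dual ℂ T} (h1 : q ∈ D.Qp) (h0 : q ≠ 0) : ∃ n : ℕ, 0 < n ∧ D.ht q = n := by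
  obtain ⟨n, hn, h⟩ := D.ht_Qp _ h1
  exact ⟨n, Nat.pos_of_ne_zero fun hn0 => h0 (h hn0), hn⟩

/-- The monoid of the sums of positive weights. -/
def posSums : AddSubmonoid (Module.Dual ℂ T) := AddSubmonoid.closure {q | ∃ i, D.Pos i ∧ q = D.wt i}

theorem posSums_le : D.posSums ≤ D.Qp :=
  AddSubmonoid.closure_le.2 (by rintro _ ⟨i, hi, rfl⟩; exact hi.2)

theorem wt_mem_posSums {i : ι} (hi : D.Pos i) : D.wt i ∈ D.posSums :=
  AddSubmonoid.subset_closure ⟨i, hi, rfl⟩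

/-! #### The invariant form -/

/-- Invariance, applied to cr i = [x, y], gives the multiple κ(x, y). Evaluation at cr i itself
identifies 2κ(x, y) with a sum of squares of integers η_k(cr i), which do not all vanish because the
η_k separate points. -/
theorem exists_pos_mul {i : ι} (hi : D.wt i ≠ 0) :
    ∃ r : ℝ, 0 < r ∧ ∀ h, D.κ (D.j (D.cr i)) (D.j h) = r * D.wt i h := by
  have h1 : ∀ h, D.κ (D.j (D.cr i)) (D.j h) = D.κ (D.x i) (D.y i) * D.wt i h := by
    intro h
    rw [← D.lie_x_y i hi, D.κ_lie, ← lie_skew, D.lie_y i hi, neg_neg, map_smul, smul_eq_mul,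
      mul_comm]
  choose n hn using D.η_cr i hi
  have h2 := h1 (D.cr i)
  rw [D.κ_j, D.wt_cr i hi] at h2
  refine ⟨(∑ k, (n k : ℝ) ^ 2) / 2, ?_, fun h => ?_⟩
  · refine div_pos ?_ two_pos
    obtain ⟨k, hk⟩ : ∃ k, n k ≠ 0 := by
      by_contra! hc
      exact D.cr_ne_zero hi (D.η_sep _ fun k => by rw [hn, hc]; simp)
    exact Finset.sum_pos' (fun k _ => sq_nonneg _) ⟨k, Finset.mem_univ _, by positivity⟩
  · rw [h1]
    congr 1
    have h3 : (∑ k, (n k : ℂ) ^ 2) = D.κ (D.x i) (D.y i) * 2 := by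
      rw [← h2]; exact Finset.sum_congr rfl fun k _ => by rw [hn]; ring
    push_cast
    rw [h3]; ring

open scoped ComplexOrder

/-- Positive multiples of coroots represent the positive weights. -/
theorem exists_dual {β : Module.Dual ℂ T} (hβ : β ∈ D.posSums) :
    ∃ t : T, (∀ h, D.κ (D.j t) (D.j h) = β h) ∧
      (∀ ν : Module.Dual ℂ T, (∀ i, D.Pos i → 0 ≤ ν (D.cr i)) → 0 ≤ ν t) ∧
      ∀ k, ∃ r : ℝ, D.η k t = r := by
  induction hβ using AddSubmonoid.closure_induction with
  | mem q hq =>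
    obtain ⟨i, hi, rfl⟩ := hq
    obtain ⟨r, hr, h⟩ := D.exists_pos_mul hi.1
    have hrc : (r : ℂ) ≠ 0 := by exact_mod_cast hr.ne'
    refine ⟨(r⁻¹ : ℂ) • D.cr i, fun x => ?_, fun ν hν => ?_, fun k => ?_⟩
    · rw [map_smul, map_smul, LinearMap.smul_apply, h, smul_eq_mul, inv_mul_cancel_left₀ hrc]
    · rw [map_smul, smul_eq_mul]
      refine mul_nonneg ?_ (hν i hi)
      rw [← Complex.ofReal_inv]
      exact_mod_cast inv_nonneg.2 hr.le
    · obtain ⟨n, hn⟩ := D.η_cr i hi.1 k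
      exact ⟨r⁻¹ * n, by rw [map_smul, hn]; simp⟩
  | zero => exact ⟨0, by simp, by simp, fun k => ⟨0, by simp⟩⟩
  | add p q _ _ hp hq =>
    obtain ⟨t, h1, h2, h3⟩ := hp
    obtain ⟨t', h1', h2', h3'⟩ := hq
    refine ⟨t + t', fun h => by simp [h1, h1'], fun ν hν => ?_, fun k => ?_⟩
    · rw [map_add]; exact add_nonneg (h2 ν hν) (h2' ν hν)
    · obtain ⟨r, hr⟩ := h3 k
      obtain ⟨r', hr'⟩ := h3' k
      exact ⟨r + r', by simp [hr, hr']⟩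

/-- Positive definiteness on real vectors: β(t) = κ(t, t) is the sum of the squares of the real
numbers η_k(t), so t = 0 when it vanishes. -/
theorem eq_zero_of_dual {β : Module.Dual ℂ T} {t : T} (ht : ∀ h, D.κ (D.j t) (D.j h) = β h)
    (hr : ∀ k, ∃ r : ℝ, D.η k t = r) (h0 : β t = 0) : β = 0 := by
  choose r hr using hr
  have h1 := ht t
  rw [h0, D.κ_j] at h1
  have h2 : ∑ k, r k * r k = 0 := by
    have : ((∑ k, r k * r k : ℝ) : ℂ) = 0 := by
      push_cast; rw [← h1]; exact Finset.sum_congr rfl fun k _ => by rw [hr]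
    exact_mod_cast this
  have h3 : ∀ k, r k = 0 := fun k => by
    have := (Finset.sum_eq_zero_iff_of_nonneg fun k _ => mul_self_nonneg (r k)).1 h2 k
      (Finset.mem_univ k)
    exact mul_self_eq_zero.1 this
  have h4 : t = 0 := D.η_sep t fun k => by rw [hr, h3]; simp
  ext h
  rw [← ht, h4]; simp

/-! #### Nilpotency of root vectors -/

variable {φ}

theorem exists_pow_x {i : ι} (hi : D.wt i ≠ 0) (U : Submodule ℂ V) [FiniteDimensional ℂ U]
    (hU : ∀ z, ∀ v ∈ U, φ z v ∈ U) : ∃ p : ℕ, ∀ u ∈ U, (φ (D.x i) ^ p) u = 0 :=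
  exists_pow_eq_zero two_ne_zero (D.isSl2 φ hi).h_e U (hU _) (hU _)

theorem exists_pow_y {i : ι} (hi : D.wt i ≠ 0) (U : Submodule ℂ V) [FiniteDimensional ℂ U]
    (hU : ∀ z, ∀ v ∈ U, φ z v ∈ U) : ∃ p : ℕ, ∀ u ∈ U, (φ (D.y i) ^ p) u = 0 :=
  exists_pow_eq_zero (neg_ne_zero.2 two_ne_zero)
    ((D.isSl2 φ hi).h_f.trans (neg_smul _ _).symm) U (hU _) (hU _)

theorem exists_pow_ad {i : ι} (hi : D.wt i ≠ 0) (z : K) :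
    (∃ p : ℕ, ((LieRep.ad K (D.x i)) ^ p) z = 0) ∧
      ∃ p : ℕ, ((LieRep.ad K (D.y i)) ^ p) z = 0 := by
  have : FiniteDimensional ℂ K := Module.Finite.of_basis D.b
  obtain ⟨p, hp⟩ := D.exists_pow_x (φ := LieRep.ad K) hi ⊤ (by simp)
  obtain ⟨q, hq⟩ := D.exists_pow_y (φ := LieRep.ad K) hi ⊤ (by simp)
  exact ⟨⟨p, hp z trivial⟩, ⟨q, hq z trivial⟩⟩

theorem exists_int_wt {i : ι} (hi : D.wt i ≠ 0) (k : ι) : ∃ n : ℤ, D.wt k (D.cr i) = n := by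
  obtain ⟨⟨p, hp⟩, ⟨q, hq⟩⟩ := D.exists_pow_ad hi (D.b k)
  exact (D.isSl2 (LieRep.ad K) hi).exists_int (D.b.ne_zero k) (D.lie_b _ k) hp hq

/-- Twice the half sum of the positive weights is dominant. -/
theorem sum_pos_nonneg {i : ι} (hi : D.Pos i) [DecidablePred D.Pos] :
    0 ≤ ∑ k with D.Pos k, D.wt k (D.cr i) := by
  classical
  have : FiniteDimensional ℂ K := Module.Finite.of_basis D.b
  choose w hw using D.exists_int_wt hi.1
  simp only [hw]
  rw [← Int.cast_sum]
  refine Int.cast_nonneg (sum_nonneg_of_card_le _ _ fun m hm => ?_)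
  rw [Finset.filter_filter, Finset.filter_filter]
  have H := D.isSl2 (LieRep.ad K) hi.1
  -- N m is spanned by the positive basis vectors whose weight takes the value m at cr i. By
  -- 𝔰𝔩₂-theory the m-th power of ad x_i maps N (-m) injectively into N m: adding m times the
  -- positive weight `D.wt i` keeps a weight positive and shifts its value by 2m. This bounds the
  -- number of values -m by the number of values m, which is what `sum_nonneg_of_card_le` needs.
  let N : ℤ → Submodule ℂ K := fun m => Submodule.span ℂ (D.b '' {k | D.Pos k ∧ w k = m})
  have hN : ∀ m, Module.finrank ℂ (N m) = (Finset.univ.filter fun k => D.Pos k ∧ w k = m).card := by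
    intro m
    have h1 := finrank_span_eq_card
      (D.b.linearIndependent.comp (Subtype.val : {k // D.Pos k ∧ w k = m} → ι)
        Subtype.val_injective)
    rw [Fintype.card_subtype, Set.range_comp, Subtype.range_coe_subtype] at h1
    exact h1
  rw [← hN, ← hN]
  lift m to ℕ using hm.le
  have hNw : ∀ u ∈ N (-m), LieRep.ad K (D.j (D.cr i)) u = -(m : ℂ) • u := by
    intro u hu
    have : N (-m) ≤ Module.End.eigenspace (LieRep.ad K (D.j (D.cr i))) (-(m : ℂ)) :=
      Submodule.span_le.2 (by
        rintro _ ⟨k, hk, rfl⟩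
        refine Module.End.mem_eigenspace_iff.2 ?_
        rw [LieRep.ad_apply, D.lie_b, hw, hk.2]
        push_cast; rfl)
    exact Module.End.mem_eigenspace_iff.1 (this hu)
  have hmap : ∀ u ∈ N (-m), (LieRep.ad K (D.x i) ^ m) u ∈ N m := by
    intro u hu
    have : N (-m) ≤ (N m).comap (LieRep.ad K (D.x i) ^ m) := Submodule.span_le.2 (by
      rintro _ ⟨k, hk, rfl⟩
      have h1 : ∀ n : ℕ, (LieRep.ad K (D.x i) ^ n) (D.b k) ∈
          D.rts (D.wt k + n • D.wt i) := by
        intro n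
        induction n with
        | zero => simpa using D.b_mem k
        | succ n ih =>
          rw [pow_succ', Module.End.mul_apply, succ_nsmul, ← add_assoc]
          exact D.act_mem_wts (φ := LieRep.ad K) (D.x_mem hi.1) ih
      refine Submodule.span_mono (Set.image_mono ?_) (D.mem_span_b (h1 m))
      intro l hl
      have hl : D.wt l = D.wt k + m • D.wt i := hl
      have hQ : m • D.wt i ∈ D.Qp := D.Qp.nsmul_mem hi.2 m
      refine ⟨⟨fun h0 => hk.1.1 (D.eq_zero_of_neg_mem hk.1.2 ?_), ?_⟩, ?_⟩
      · rw [h0] at hl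
        rwa [neg_eq_of_add_eq_zero_right hl.symm]
      · rw [hl]; exact D.Qp.add_mem hk.1.2 hQ
      · have h2 := hw l
        rw [hl, LinearMap.add_apply, LinearMap.smul_apply, hw, hk.2, D.wt_cr i hi.1] at h2
        have h3 : ((m : ℤ) : ℂ) = (w l : ℂ) := by
          rw [← h2]; push_cast; rw [nsmul_eq_mul]; ring
        exact (Int.cast_injective h3).symm)
    exact this hu
  refine LinearMap.finrank_le_finrank_of_injective
    (f := (LieRep.ad K (D.x i) ^ m).restrict hmap) ?_
  rw [injective_iff_map_eq_zero]
  intro u hu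
  obtain ⟨q, hq⟩ := (D.exists_pow_ad hi.1 (u : K)).2
  exact Subtype.ext (H.eq_zero_of_e_pow (hNw u u.2) (congrArg Subtype.val hu) hq)

end SplitReductive

end Reductive

end TwistedWeyl

noncomputable section

namespace TwistedWeyl

namespace SplitReductive

variable {K T ι J : Type*} [LieRing K] [LieAlgebra ℂ K] [AddCommGroup T] [Module ℂ T] [Fintype ι]
  [Fintype J] (D : SplitReductive K T ι J)

/-! #### The Casimir operator -/

/-- The basis that is dual to the basis `D.b` for the invariant form. -/
def b' : Module.Basis ι ℂ K := by
  classical exact D.κ.dualBasis D.κ_nondegenerate D.b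

theorem κ_b'_b [DecidableEq ι] (i k : ι) : D.κ (D.b' i) (D.b k) = if k = i then 1 else 0 := by
  rw [b']
  convert LinearMap.BilinForm.apply_dualBasis_left D.κ_nondegenerate D.b i k

theorem repr_b' (z : K) (i : ι) : D.b'.repr z i = D.κ z (D.b i) := by
  classical
  exact LinearMap.BilinForm.dualBasis_repr_apply D.κ_nondegenerate D.b z i

theorem sum_κ_b' (z : K) : ∑ i, D.κ z (D.b i) • D.b' i = z := by
  conv_rhs => rw [← D.b'.sum_repr z]
  exact Finset.sum_congr rfl fun i _ => by rw [D.repr_b']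

theorem eq_of_κ {z z' : K} (h : ∀ i, D.κ z (D.b i) = D.κ z' (D.b i)) : z = z' := by
  rw [← D.sum_κ_b' z, ← D.sum_κ_b' z']
  exact Finset.sum_congr rfl fun i _ => by rw [h]

theorem sum_κ_b (z : K) : ∑ i, D.κ z (D.b' i) • D.b i = z := by
  classical
  conv_rhs => rw [← D.b.sum_repr z]
  refine Finset.sum_congr rfl fun i _ => ?_
  congr 1
  conv_lhs => rw [← D.b.sum_repr z]
  rw [map_sum, LinearMap.sum_apply, Finset.sum_eq_single i]
  · rw [map_smul, LinearMap.smul_apply, D.κ_symm, D.κ_b'_b]; simp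
  · intro k _ hk; rw [map_smul, LinearMap.smul_apply, D.κ_symm, D.κ_b'_b, if_neg hk, smul_zero]
  · simp

theorem κ_lie_left (x y z : K) : D.κ ⁅x, y⁆ z = -D.κ y ⁅x, z⁆ := by
  rw [← lie_skew, map_neg, LinearMap.neg_apply, D.κ_lie]

theorem b'_mem (i : ι) : D.b' i ∈ D.rts (-D.wt i) := D.mem_rts.2 fun h => by
  classical
  refine D.eq_of_κ fun k => ?_
  rw [D.κ_lie_left, D.lie_b, map_smul, map_smul, LinearMap.smul_apply, D.κ_b'_b]
  split_ifs with hk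
  · simp [hk]
  · simp

/-- The element of the Cartan subalgebra that corresponds to an element of `K`. -/
def pre (z : K) : T := by
  classical exact if h : ∃ t, D.j t = z then h.choose else 0

theorem j_pre {z : K} (hz : z ∈ D.rts 0) : D.j (D.pre z) = z := by
  have h := D.mem_range_of_rts_zero hz
  rw [pre, dif_pos h]
  exact h.choose_spec

theorem lie_mem_rts {z z' : K} {ν ν' : Module.Dual ℂ T} (hz : z ∈ D.rts ν) (hz' : z' ∈ D.rts ν') :
    ⁅z, z'⁆ ∈ D.rts (ν + ν') := by
  rw [add_comm]
  exact D.act_mem_wts (φ := LieRep.ad K) hz hz'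

theorem j_pre_lie (i : ι) : D.j (D.pre ⁅D.b i, D.b' i⁆) = ⁅D.b i, D.b' i⁆ :=
  D.j_pre (by simpa using D.lie_mem_rts (D.b_mem i) (D.b'_mem i))

variable {V : Type*} [AddCommGroup V] [Module ℂ V] (φ : LieRep K V)

/-- The Casimir operator of a representation. -/
def casimir : Module.End ℂ V := ∑ i, φ (D.b i) * φ (D.b' i)

/-- By invariance, the matrices of ad z in a basis and in its dual basis are negative transposes of
each other, so the two sums in the commutator of z with the Casimir operator cancel. -/
theorem casimir_comm (z : K) : φ z * D.casimir φ = D.casimir φ * φ z := by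
  have h1 : ∑ i, φ ⁅z, D.b i⁆ * φ (D.b' i) + ∑ i, φ (D.b i) * φ ⁅z, D.b' i⁆ = 0 := by
    have e1 : ∀ i, φ ⁅z, D.b i⁆ * φ (D.b' i) =
        ∑ k, D.κ ⁅z, D.b i⁆ (D.b' k) • (φ (D.b k) * φ (D.b' i)) := by
      intro i
      conv_lhs => rw [← D.sum_κ_b ⁅z, D.b i⁆]
      simp only [map_sum, map_smul, Finset.sum_mul, smul_mul_assoc]
    have e2 : ∀ k, φ (D.b k) * φ ⁅z, D.b' k⁆ =
        ∑ i, -(D.κ ⁅z, D.b i⁆ (D.b' k) • (φ (D.b k) * φ (D.b' i))) := by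
      intro k
      conv_lhs => rw [← D.sum_κ_b' ⁅z, D.b' k⁆]
      simp only [map_sum, map_smul, Finset.mul_sum, mul_smul_comm]
      refine Finset.sum_congr rfl fun i _ => ?_
      rw [D.κ_lie_left, D.κ_symm, neg_smul]
    simp only [e1, e2, Finset.sum_neg_distrib]
    rw [Finset.sum_comm]
    exact add_neg_cancel _
  rw [← sub_eq_zero, ← h1, casimir, Finset.mul_sum, Finset.sum_mul, ← Finset.sum_sub_distrib,
    ← Finset.sum_add_distrib]
  refine Finset.sum_congr rfl fun i _ => ?_
  rw [φ.map_lie, φ.map_lie]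
  noncomm_ring

/-- `v` is primitive modulo `N`. -/
def PrimMod (N : Submodule ℂ V) (v : V) : Prop := ∀ i, D.Pos i → φ (D.b i) v ∈ N

variable {φ}

theorem PrimMod.act_mem {N : Submodule ℂ V} {v : V} (h : D.PrimMod φ N v) {ν : Module.Dual ℂ T}
    (hν : ν ∈ D.Qp) (h0 : ν ≠ 0) {z : K} (hz : z ∈ D.rts ν) : φ z v ∈ N := by
  have : Submodule.span ℂ (D.b '' {i | D.wt i = ν}) ≤
      N.comap ((LinearMap.applyₗ v : Module.End ℂ V →ₗ[ℂ] V) ∘ₗ φ.toLin) :=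
    Submodule.span_le.2 (by
      rintro _ ⟨i, hi, rfl⟩
      have hi : D.wt i = ν := hi
      exact h i ⟨by rwa [hi], by rwa [hi]⟩)
  exact this (D.mem_span_b hz)

open Classical in
/-- The eigenvalue of the Casimir operator on primitive vectors of weight `μ`. -/
def casimirValue (μ : Module.Dual ℂ T) : ℂ :=
  ∑ i, if D.wt i = 0 then μ (D.pre (D.b i)) * μ (D.pre (D.b' i)) else
    if D.Pos i then μ (D.pre ⁅D.b i, D.b' i⁆) else 0

theorem b_mem_zero {i : ι} (hi : D.wt i = 0) : D.b i ∈ D.rts 0 := by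
  have := D.b_mem i
  rwa [hi] at this

theorem b'_mem_zero {i : ι} (hi : D.wt i = 0) : D.b' i ∈ D.rts 0 := by
  have := D.b'_mem i
  rwa [hi, neg_zero] at this

/-- For a positive index, b_i b'_i = [b_i, b'_i] + b'_i b_i, and the last term sends v into N. For a
negative index, b'_i has positive weight and already sends v into N. What remains is the action of
the Cartan subalgebra on a weight vector. -/
theorem casimir_sub_mem {N : Submodule ℂ V} (hN : ∀ z, ∀ v ∈ N, φ z v ∈ N)
    {μ : Module.Dual ℂ T} {v : V} (hv : v ∈ D.wts φ μ) (hp : D.PrimMod φ N v) :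
    D.casimir φ v - D.casimirValue μ • v ∈ N := by
  have hj : ∀ {z : K}, z ∈ D.rts 0 → φ z v = μ (D.pre z) • v := fun {z} hz => by
    conv_lhs => rw [← D.j_pre hz]
    exact hv _
  rw [casimir, casimirValue, LinearMap.sum_apply, Finset.sum_smul, ← Finset.sum_sub_distrib]
  refine N.sum_mem fun i _ => ?_
  rw [Module.End.mul_apply]
  split_ifs with h0 h1
  · rw [hj (D.b'_mem_zero h0), map_smul, hj (D.b_mem_zero h0), smul_smul, mul_comm, sub_self]
    exact N.zero_mem
  · have h2 := hv (D.pre ⁅D.b i, D.b' i⁆)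
    change φ (D.j _) v = _ at h2
    rw [D.j_pre_lie, φ.lie_apply] at h2
    rw [← h2, sub_sub_cancel]
    exact hN _ _ (hp i h1)
  · rw [zero_smul, sub_zero]
    refine hN _ _ (hp.act_mem D ?_ (neg_ne_zero.2 h0) (D.b'_mem i))
    exact (D.wt_mem i).resolve_left fun h => h1 ⟨h0, h⟩

/-- The Casimir value is (μ, μ + 2ρ), where 2ρ is the sum of the positive weights, counted with
multiplicity. Its increment is therefore (β, 2μ + β + 2ρ), computed here with the element t that
represents β. -/
theorem casimirValue_add {β : Module.Dual ℂ T} {t : T} (ht : ∀ h, D.κ (D.j t) (D.j h) = β h)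
    (μ : Module.Dual ℂ T) [DecidablePred D.Pos] :
    D.casimirValue (μ + β) - D.casimirValue μ = μ t + (μ + β) t + ∑ k with D.Pos k, D.wt k t := by
  classical
  have ht0 : D.j t ∈ D.rts 0 := fun h => by
    rw [LinearMap.zero_apply, zero_smul]; exact D.lie_j h t
  have hz : ∀ z ∈ D.rts 0, D.κ (D.j t) z = β (D.pre z) := fun z hz => by
    rw [← ht, D.j_pre hz]
  have hκ : ∀ i, D.wt i ≠ 0 → D.κ (D.j t) (D.b i) = 0 ∧ D.κ (D.j t) (D.b' i) = 0 := by
    intro i hi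
    have aux : ∀ z ν, ν ≠ 0 → z ∈ D.rts ν → D.κ (D.j t) z = 0 := by
      intro z ν hν hz
      obtain ⟨h, hh⟩ : ∃ h, ν h ≠ 0 := by
        by_contra! hc; exact hν (LinearMap.ext hc)
      have h1 : D.κ (D.j t) ⁅D.j h, z⁆ = 0 := by
        rw [← D.κ_lie, D.lie_j, map_zero, LinearMap.zero_apply]
      rw [D.mem_rts.1 hz h, map_smul, smul_eq_mul] at h1
      exact (mul_eq_zero.1 h1).resolve_left hh
    exact ⟨aux _ _ hi (D.b_mem i), aux _ _ (neg_ne_zero.2 hi) (D.b'_mem i)⟩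
  have e1 : ∀ ν : Module.Dual ℂ T,
      ∑ i, (if D.wt i = 0 then β (D.pre (D.b i)) * ν (D.pre (D.b' i)) else 0) = ν t := by
    intro ν
    have : t = ∑ i, if D.wt i = 0 then β (D.pre (D.b i)) • D.pre (D.b' i) else 0 := by
      refine D.j_injective ?_
      rw [map_sum]
      conv_lhs => rw [← D.sum_κ_b' (D.j t)]
      refine Finset.sum_congr rfl fun i _ => ?_
      split_ifs with hi
      · rw [map_smul, D.j_pre (D.b'_mem_zero hi), hz _ (D.b_mem_zero hi)]
      · rw [(hκ i hi).1, zero_smul, map_zero]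
    conv_rhs => rw [this]
    rw [map_sum]
    refine Finset.sum_congr rfl fun i _ => ?_
    split_ifs <;> simp
  have e2 : ∀ ν : Module.Dual ℂ T,
      ∑ i, (if D.wt i = 0 then ν (D.pre (D.b i)) * β (D.pre (D.b' i)) else 0) = ν t := by
    intro ν
    have : t = ∑ i, if D.wt i = 0 then β (D.pre (D.b' i)) • D.pre (D.b i) else 0 := by
      refine D.j_injective ?_
      rw [map_sum]
      conv_lhs => rw [← D.sum_κ_b (D.j t)]
      refine Finset.sum_congr rfl fun i _ => ?_
      split_ifs with hi
      · rw [map_smul, D.j_pre (D.b_mem_zero hi), hz _ (D.b'_mem_zero hi)]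
      · rw [(hκ i hi).2, zero_smul, map_zero]
    conv_rhs => rw [this]
    rw [map_sum]
    refine Finset.sum_congr rfl fun i _ => ?_
    split_ifs
    · rw [map_smul, smul_eq_mul, mul_comm]
    · simp
  have e3 : ∀ i, β (D.pre ⁅D.b i, D.b' i⁆) = D.wt i t := by
    intro i
    rw [← ht, D.j_pre_lie, ← D.κ_lie, D.lie_b, map_smul, LinearMap.smul_apply, D.κ_symm,
      D.κ_b'_b, if_pos rfl, smul_eq_mul, mul_one]
  rw [← e2 μ, ← e1 (μ + β), Finset.sum_filter, casimirValue, casimirValue,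
    ← Finset.sum_sub_distrib, ← Finset.sum_add_distrib, ← Finset.sum_add_distrib]
  refine Finset.sum_congr rfl fun i _ => ?_
  by_cases h0 : D.wt i = 0
  · have hP : ¬D.Pos i := fun h => h.1 h0
    simp only [h0, hP, if_true, if_false, LinearMap.add_apply]
    ring
  · by_cases hP : D.Pos i
    · simp only [h0, hP, if_true, if_false, LinearMap.add_apply, ← e3]
      ring
    · simp [h0, hP]

/-- Dominant integral weights. -/
def Dominant (μ : Module.Dual ℂ T) : Prop := ∀ i, D.Pos i → ∃ n : ℕ, μ (D.cr i) = n

open scoped ComplexOrder in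
-- The representative t of β is a nonnegative combination of positive coroots, so μ, μ + β and 2ρ
-- all take nonnegative values at t. If the increment vanishes, so do μ(t) and (μ + β)(t), hence
-- β(t), and definiteness gives β = 0.
theorem casimirValue_ne {μ β : Module.Dual ℂ T} (hβ : β ∈ D.posSums) (h0 : β ≠ 0)
    (hμ : D.Dominant μ) (hμβ : D.Dominant (μ + β)) :
    D.casimirValue (μ + β) ≠ D.casimirValue μ := by
  classical
  intro h
  obtain ⟨t, ht, hpos, hr⟩ := D.exists_dual hβ
  have h1 := D.casimirValue_add ht μ
  rw [h, sub_self] at h1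
  have dom : ∀ ν, D.Dominant ν → 0 ≤ ν t := fun ν hν => hpos ν fun i hi => by
    obtain ⟨n, hn⟩ := hν i hi
    rw [hn]
    exact Nat.cast_nonneg n
  have h2 := dom μ hμ
  have h3 := dom _ hμβ
  have h4 : 0 ≤ ∑ k with D.Pos k, D.wt k t := by
    have := hpos (∑ k with D.Pos k, D.wt k) fun i hi => by
      rw [LinearMap.sum_apply]; exact D.sum_pos_nonneg hi
    rwa [LinearMap.sum_apply] at this
  have h5 := (add_eq_zero_iff_of_nonneg (add_nonneg h2 h3) h4).1 h1.symm
  have h6 := (add_eq_zero_iff_of_nonneg h2 h3).1 h5.1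
  refine h0 (D.eq_zero_of_dual ht hr ?_)
  have := h6.2
  rwa [LinearMap.add_apply, h6.1, zero_add] at this

theorem eq_of_casimirValue_eq {ν μ : Module.Dual ℂ T} (h : μ - ν ∈ D.posSums)
    (hν : D.Dominant ν) (hμ : D.Dominant μ) (hc : D.casimirValue ν = D.casimirValue μ) :
    ν = μ := by
  by_contra hne
  have h1 : ν + (μ - ν) = μ := by abel
  refine D.casimirValue_ne h (sub_ne_zero.2 (Ne.symm hne)) hν ?_ ?_ <;> rw [h1]
  · exact hμ
  · exact hc.symm

/-! #### Complete reducibility -/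

/-- Local finiteness makes every negative root vector y_i nilpotent on v, and x_i v lies in N. So
𝔰𝔩₂-theory modulo N applies to each positive root. -/
theorem dominant_of_primMod (hfin : finitePart (Set.range φ.toLin) = ⊤)
    {N : Submodule ℂ V} (hN : ∀ z, ∀ v ∈ N, φ z v ∈ N)
    {μ : Module.Dual ℂ T} {v : V} (hv : v ∈ D.wts φ μ) (hvN : v ∉ N) (hp : D.PrimMod φ N v) :
    D.Dominant μ := by
  intro i hi
  obtain ⟨U, hU, hvU, hst⟩ := (hfin ▸ Submodule.mem_top : v ∈ finitePart (Set.range φ.toLin))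
  obtain ⟨q, hq⟩ := D.exists_pow_y (φ := φ) hi.1 U fun z => hst _ ⟨z, rfl⟩
  exact (D.isSl2 φ hi.1).exists_nat (hN _) (hN _) (hN _) hvN (hv _)
    (hp.act_mem D hi.2 hi.1 (D.x_mem hi.1)) (q := q) (by rw [hq v hvU]; exact N.zero_mem)

theorem finite_weights (U : Submodule ℂ V) [FiniteDimensional ℂ U] :
    {ν | ∃ q ∈ U, q ∈ D.wts φ ν ∧ q ≠ 0}.Finite := by
  choose f hf using fun ν : {ν | ∃ q ∈ U, q ∈ D.wts φ ν ∧ q ≠ 0} => ν.2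
  have h1 : LinearIndependent ℂ f :=
    (iSupIndep_wtSpace.comp Subtype.val_injective).linearIndependent _
      (fun ν => (hf ν).2.1) fun ν => (hf ν).2.2
  have h2 : LinearIndependent ℂ fun ν => (⟨f ν, (hf ν).1⟩ : U) :=
    LinearIndependent.of_comp U.subtype h1
  exact Set.finite_coe_iff.1 h2.finite

/-- Among the finitely many weights above μ that occur in U outside N, one of maximal height works:
a positive root vector would raise the height. Real parts are compared because heights are known to
be natural numbers only on `D.Qp`. -/
theorem exists_primMod {U N : Submodule ℂ V} [FiniteDimensional ℂ U]
    (hU : ∀ z, ∀ v ∈ U, φ z v ∈ U) {μ : Module.Dual ℂ T} {v : V} (hv : v ∈ D.wts φ μ)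
    (hvU : v ∈ U) (hvN : v ∉ N) : ∃ ν, ∃ q ∈ U, ν - μ ∈ D.posSums ∧ q ∈ D.wts φ ν ∧ q ∉ N ∧
      D.PrimMod φ N q := by
  obtain ⟨ν, ⟨hν, q, hqU, hq, hqN⟩, hmax⟩ := Set.exists_max_image
    {ν | ν - μ ∈ D.posSums ∧ ∃ q ∈ U, q ∈ D.wts φ ν ∧ q ∉ N} (fun ν => (D.ht ν).re)
    ((D.finite_weights (φ := φ) U).subset fun ν ⟨_, q, h1, h2, h3⟩ =>
      ⟨q, h1, h2, fun h => h3 (h ▸ N.zero_mem)⟩)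
    ⟨μ, by rw [sub_self]; exact zero_mem _, v, hvU, hv, hvN⟩
  refine ⟨ν, q, hqU, hν, hq, hqN, fun i hi => ?_⟩
  by_contra hc
  have h1 := hmax (ν + D.wt i) ⟨by
    rw [add_sub_right_comm]; exact add_mem hν (D.wt_mem_posSums hi), _, hU _ _ hqU,
    D.act_mem_wts (D.b_mem i) hq, hc⟩
  obtain ⟨n, hn, hht⟩ := D.ht_pos hi.2 hi.1
  rw [map_add, hht, Complex.add_re, Complex.natCast_re] at h1
  have : (0 : ℝ) < n := by exact_mod_cast hn
  linarith

/-- The Cartan subalgebra and the positive root vectors preserve the line through p. By the weak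
Poincaré–Birkhoff–Witt argument, the module generated by p is then obtained from this line by
negative root vectors alone, and these strictly lower weights. -/
theorem closureUnder_le_of_prim {lam : Module.Dual ℂ T} {p : V}
    (hp : p ∈ D.wts φ lam) (hprim : D.PrimMod φ ⊥ p) :
    closureUnder (Set.range φ.toLin) {p} ≤
      ℂ ∙ p ⊔ ⨆ ν ∈ {ν | lam - ν ∈ D.posSums ∧ ν ≠ lam}, D.wts φ ν := by
  set Z := closureUnder (Set.range φ.toLin) {p} with hZ
  let X : Submodule ℂ V := ℂ ∙ p ⊔ ⨆ ν ∈ {ν | lam - ν ∈ D.posSums ∧ ν ≠ lam}, D.wts φ ν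
  have hwX : ∀ {ν v}, lam - ν ∈ D.posSums → ν ≠ lam → v ∈ D.wts φ ν → v ∈ X := by
    intro ν v h1 h2 hv
    exact Submodule.mem_sup_right ((le_iSup₂
      (f := fun ν (_ : ν ∈ {ν | lam - ν ∈ D.posSums ∧ ν ≠ lam}) => D.wts φ ν) ν ⟨h1, h2⟩) hv)
  have hneg : ∀ i, D.wt i ≠ 0 → ¬D.Pos i → -D.wt i ∈ D.posSums := by
    intro i h0 hi
    obtain ⟨k, hk⟩ := D.exists_wt_eq_neg i
    rw [← hk]
    refine D.wt_mem_posSums ⟨by rw [hk]; exact neg_ne_zero.2 h0, ?_⟩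
    rw [hk]
    exact (D.wt_mem i).resolve_left fun h => hi ⟨h0, h⟩
  change Z ≤ X
  let A : Set (Module.End ℂ V) := {S | ∃ i, (D.wt i = 0 ∨ D.Pos i) ∧ S = φ (D.b i)}
  let B : Set (Module.End ℂ V) := {S | ∃ i, D.wt i ≠ 0 ∧ ¬D.Pos i ∧ S = φ (D.b i)}
  have h1 : Z ≤ closureUnder B ((ℂ ∙ p : Submodule ℂ V) : Set V) := by
    refine closureUnder_le ?_ ?_
    · exact Set.singleton_subset_iff.2
        (subset_closureUnder _ _ (Submodule.mem_span_singleton_self p))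
    · rintro _ ⟨z, rfl⟩ v hv
      refine closureUnder_stable_of_span (L := LinearMap.range φ.toLin) (X := A) ?_ ?_ ?_
        ⟨z, rfl⟩ hv
      · rintro _ ⟨z, rfl⟩
        rw [← D.b.sum_repr z, map_sum]
        refine Submodule.sum_mem _ fun i _ => ?_
        rw [map_smul]
        refine Submodule.smul_mem _ _ (Submodule.subset_span ?_)
        by_cases hi : D.wt i = 0 ∨ D.Pos i
        · exact Or.inl ⟨i, hi, rfl⟩
        · exact Or.inr ⟨i, fun h => hi (Or.inl h), fun h => hi (Or.inr h), rfl⟩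
      · rintro _ ⟨i, -, rfl⟩ _ ⟨k, -, -, rfl⟩
        exact ⟨1, ⁅D.b i, D.b k⁆, by rw [one_smul, φ.map_lie]⟩
      · rintro _ ⟨i, hi, rfl⟩ v hv
        obtain ⟨c, rfl⟩ := Submodule.mem_span_singleton.1 hv
        rw [map_smul]
        refine Submodule.smul_mem _ _ ?_
        rcases hi with hi | hi
        · obtain ⟨t, ht⟩ := D.mem_range_j i hi
          rw [← ht, (D.mem_wts φ).1 hp t]
          exact Submodule.smul_mem _ _ (Submodule.mem_span_singleton_self p)
        · rw [(Submodule.mem_bot ℂ).1 (hprim i hi)]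
          exact Submodule.zero_mem _
  refine h1.trans (closureUnder_le (SetLike.coe_subset_coe.2 (le_sup_left : (ℂ ∙ p) ≤ X)) ?_)
  rintro _ ⟨i, h0, hi, rfl⟩ v hv
  have key : ∀ ν, lam - ν ∈ D.posSums → ∀ v ∈ D.wts φ ν, φ (D.b i) v ∈ X := by
    intro ν hν v hv
    have h2 : lam - (ν + D.wt i) = lam - ν + -D.wt i := by abel
    refine hwX (h2 ▸ add_mem hν (hneg i h0 hi)) (fun h => h0 ?_) (D.act_mem_wts (D.b_mem i) hv)
    refine D.eq_zero_of_neg_mem ?_ (D.posSums_le (hneg i h0 hi))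
    have h3 : D.wt i = lam - ν := by rw [← h]; abel
    rw [h3]
    exact D.posSums_le hν
  have hX : X ≤ X.comap (φ (D.b i)) := by
    refine sup_le ?_ (iSup₂_le fun ν hν v hv => key ν hν.1 v hv)
    rw [Submodule.span_singleton_le_iff_mem]
    exact key lam (by rw [sub_self]; exact zero_mem _) p hp
  exact hX hv

/-- The Casimir operator acts on the generated module Z by one scalar. A nonzero submodule contains
a primitive vector, whose weight lies below lam, is dominant and has the same Casimir value; so that
weight is lam. The lam-weight space of Z is the line through p, so the submodule contains p. -/
theorem isSimpleFor_of_prim (hfin : finitePart (Set.range φ.toLin) = ⊤)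
    (hwt : ⨆ μ, D.wts φ μ = ⊤) {lam : Module.Dual ℂ T} {p : V}
    (hp : p ∈ D.wts φ lam) (hp0 : p ≠ 0) (hprim : D.PrimMod φ ⊥ p) :
    IsSimpleFor (Set.range φ.toLin) (closureUnder (Set.range φ.toLin) {p}) := by
  set Z := closureUnder (Set.range φ.toLin) {p} with hZ
  obtain ⟨U, hU, hpU, hst⟩ := (hfin ▸ Submodule.mem_top : p ∈ finitePart (Set.range φ.toLin))
  have hpZ : p ∈ Z := subset_closureUnder _ _ rfl
  have hZU : Z ≤ U := closureUnder_le (by simpa using hpU) hst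
  have hZst : ∀ z, ∀ v ∈ Z, φ z v ∈ Z := fun z v hv => closureUnder_stable (Set.mem_range_self z) hv
  have hZfin : FiniteDimensional ℂ Z := Submodule.finiteDimensional_of_le hZU
  have hZX := D.closureUnder_le_of_prim hp hprim
  have hbot : ∀ z, ∀ v ∈ (⊥ : Submodule ℂ V), φ z v ∈ (⊥ : Submodule ℂ V) := by simp
  have hp0' : p ∉ (⊥ : Submodule ℂ V) := hp0
  refine ⟨hZfin, fun h => hp0 ?_, ?_, fun N hN hNst => ?_⟩
  · rw [h] at hpZ; exact (Submodule.mem_bot ℂ).1 hpZ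
  · rintro _ ⟨z, rfl⟩ v hv; exact hZst z v hv
  by_cases hN0 : N = ⊥
  · exact Or.inl hN0
  refine Or.inr (le_antisymm hN ?_)
  suffices hpN : p ∈ N from closureUnder_le (by simpa using hpN) hNst
  have hNst' : ∀ z, ∀ v ∈ N, φ z v ∈ N := fun z => hNst _ ⟨z, rfl⟩
  have hNfin : FiniteDimensional ℂ N := Submodule.finiteDimensional_of_le (hN.trans hZU)
  obtain ⟨μ, v, hvN, hv, hv0⟩ : ∃ μ, ∃ v ∈ N, v ∈ D.wts φ μ ∧ v ≠ 0 := by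
    by_contra! hc
    refine hN0 (eq_bot_iff.2 ?_)
    have h1 := le_iSup_inf_wtSpace (a := D.cartanAct φ) (N := N) (P := Set.univ)
      (fun h v hv => hNst' _ v hv) (by simp only [Set.mem_univ, iSup_pos, hwt]; exact le_top)
    exact h1.trans (iSup₂_le fun μ _ v hv => (Submodule.mem_bot ℂ).2 (hc μ v hv.1 hv.2))
  obtain ⟨ν, q, hqN, -, hq, hq0, hqp⟩ := D.exists_primMod (N := ⊥) hNst' hv hvN (by simpa using hv0)
  have hq0' : q ≠ 0 := by simpa using hq0
  have hΩp := D.casimir_sub_mem (N := ⊥) hbot hp hprim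
  have hΩq := D.casimir_sub_mem (N := ⊥) hbot hq hqp
  rw [Submodule.mem_bot, sub_eq_zero] at hΩp hΩq
  have hΩZ : Z ≤ Module.End.eigenspace (D.casimir φ) (D.casimirValue lam) := by
    refine closureUnder_le (by simpa using Module.End.mem_eigenspace_iff.2 hΩp) ?_
    rintro _ ⟨z, rfl⟩ v hv
    rw [Module.End.mem_eigenspace_iff] at hv ⊢
    have := DFunLike.congr_fun (D.casimir_comm φ z) v
    rw [Module.End.mul_apply, Module.End.mul_apply, hv, map_smul] at this
    exact this.symm
  have hc : D.casimirValue lam = D.casimirValue ν := by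
    have h1 := Module.End.mem_eigenspace_iff.1 (hΩZ (hN hqN))
    rw [hΩq] at h1
    exact (smul_left_injective ℂ hq0' h1).symm
  obtain ⟨y, hy, r, hr, hyr⟩ := Submodule.mem_sup.1 (hZX (hN hqN))
  obtain ⟨a, rfl⟩ := Submodule.mem_span_singleton.1 hy
  by_cases hν : ν = lam
  · subst hν
    have hr0 : r = 0 := by
      by_contra hr0
      have hrν : r ∈ D.wts φ ν := by
        have : r = q - a • p := by rw [← hyr]; abel
        rw [this]; exact Submodule.sub_mem _ hq (Submodule.smul_mem _ _ hp)
      exact (mem_of_mem_iSup_wtSpace hrν hr0 hr).2 rfl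
    rw [hr0, add_zero] at hyr
    have ha : a ≠ 0 := fun h => hq0' (by rw [← hyr, h, zero_smul])
    rw [← hyr] at hqN
    exact (N.smul_mem_iff ha).1 hqN
  · exfalso
    have h1 : lam - ν ∈ D.posSums := by
      have h2 : ℂ ∙ p ⊔ (⨆ ν ∈ {ν | lam - ν ∈ D.posSums ∧ ν ≠ lam}, D.wts φ ν) ≤
          ⨆ ν ∈ {ν | lam - ν ∈ D.posSums}, D.wts φ ν := by
        refine sup_le ?_ (biSup_mono fun ν hν => hν.1)
        rw [Submodule.span_singleton_le_iff_mem]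
        refine le_biSup (D.wts φ) (?_ : lam ∈ {ν | lam - ν ∈ D.posSums}) hp
        change lam - lam ∈ D.posSums
        rw [sub_self]
        exact zero_mem _
      have h3 := h2 (hZX (hN hqN))
      exact mem_of_mem_iSup_wtSpace (P := {ν | lam - ν ∈ D.posSums}) hq hq0' h3
    exact hν (D.eq_of_casimirValue_eq h1
      (D.dominant_of_primMod hfin (N := ⊥) hbot hq hq0 hqp)
      (D.dominant_of_primMod hfin (N := ⊥) hbot hp hp0' hprim) hc.symm)

/-- Locally finite weight modules are completely reducible. -/
theorem isFinitelySemisimple (hfin : finitePart (Set.range φ.toLin) = ⊤)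
    (hwt : ⨆ μ, D.wts φ μ = ⊤) :
    IsFinitelySemisimple (Set.range φ.toLin) := by
  refine isFinitelySemisimple_of_sSup ?_
  set N := sSup {N | IsSimpleFor (Set.range φ.toLin) N} with hNdef
  have hN : ∀ z, ∀ v ∈ N, φ z v ∈ N := by
    intro z v hv
    have : N ≤ N.comap (φ z) := sSup_le fun M hM v hv =>
      (le_sSup hM : M ≤ N) (hM.2.2.1 _ ⟨z, rfl⟩ v hv)
    exact this hv
  -- N is the sum of all irreducible finite-dimensional submodules. The contradiction comes from a
  -- weight vector outside it.
  by_contra hne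
  obtain ⟨μ, u, hu, huN⟩ : ∃ μ, ∃ u ∈ D.wts φ μ, u ∉ N := by
    by_contra! hc
    exact hne (top_le_iff.1 (hwt ▸ iSup_le hc))
  set Ω := D.casimir φ with hΩ
  have hΩφ : ∀ z v, Ω (φ z v) = φ z (Ω v) := fun z v =>
    (DFunLike.congr_fun (D.casimir_comm φ z) v).symm
  obtain ⟨U, hU, huU, hUst⟩ := (hfin ▸ Submodule.mem_top : u ∈ finitePart (Set.range φ.toLin))
  have hUst' : ∀ z, ∀ v ∈ U, φ z v ∈ U := fun z => hUst _ ⟨z, rfl⟩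
  have hΩst : ∀ {M : Submodule ℂ V}, (∀ z, ∀ v ∈ M, φ z v ∈ M) → ∀ v ∈ M, Ω v ∈ M := by
    intro M hM v hv
    rw [hΩ, casimir, LinearMap.sum_apply]
    exact M.sum_mem fun i _ => hM _ _ (hM _ _ hv)
  -- The Casimir operator preserves the finite-dimensional space of vectors of weight μ in U, which
  -- is therefore the sum of its generalized eigenspaces. Since u is not in N, one of them is not
  -- contained in N.
  obtain ⟨c, v, hvU, hv, hvc, hvN⟩ :
      ∃ c, ∃ v ∈ U, v ∈ D.wts φ μ ∧ v ∈ Ω.maxGenEigenspace c ∧ v ∉ N := by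
    by_contra! hcon
    let M : Submodule ℂ V := U ⊓ D.wts φ μ
    have hM : ∀ v ∈ M, Ω v ∈ M := fun v hv => ⟨hΩst hUst' v hv.1, fun h => by
      change φ (D.j h) (Ω v) = _
      rw [← hΩφ, (D.mem_wts φ).1 hv.2 h, map_smul]⟩
    have hMfin : FiniteDimensional ℂ M := Submodule.finiteDimensional_of_le inf_le_left
    have h1 := Module.End.iSup_maxGenEigenspace_eq_top (LinearMap.restrict Ω hM)
    have h2 : (⊤ : Submodule ℂ M) ≤ N.comap M.subtype := by
      rw [← h1]
      refine iSup_le fun c w hw => ?_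
      have hw' : (w : V) ∈ M ⊓ Ω.genEigenspace c ⊤ := by
        rw [Submodule.inf_genEigenspace Ω M hM]
        exact ⟨w, hw, rfl⟩
      exact hcon c w hw'.1.1 hw'.1.2 hw'.2
    exact huN (h2 (Submodule.mem_top : (⟨u, huU, hu⟩ : M) ∈ ⊤))
  let U' : Submodule ℂ V := U ⊓ Ω.maxGenEigenspace c
  have hU'fin : FiniteDimensional ℂ U' := Submodule.finiteDimensional_of_le inf_le_left
  have hU' : ∀ z, ∀ v ∈ U', φ z v ∈ U' := fun z v hv => ⟨hUst' z v hv.1, by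
    exact Module.End.mapsTo_maxGenEigenspace_of_comm (f := Ω) (g := φ z)
      (D.casimir_comm φ z).symm c hv.2⟩
  -- If v is an eigenvector modulo M and is not in M, its eigenvalue there must be the generalized
  -- eigenvalue c. This is used for M = N and for M = 0, to compare a vector primitive modulo N with
  -- a truly primitive one.
  have hgen : ∀ {M : Submodule ℂ V}, (∀ v ∈ M, Ω v ∈ M) → ∀ {d : ℂ} {v : V}, v ∉ M →
      v ∈ Ω.maxGenEigenspace c → Ω v - d • v ∈ M → d = c := by
    intro M hM d v hv hvc hd
    obtain ⟨k, hk⟩ := (Module.End.mem_maxGenEigenspace Ω c v).1 hvc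
    by_contra hdc
    have h1 : ∀ k : ℕ, ((Ω - c • 1) ^ k) v - (d - c) ^ k • v ∈ M := by
      intro k
      induction k with
      | zero => simp
      | succ k ih =>
        have h2 : ((Ω - c • 1) ^ (k + 1)) v - (d - c) ^ (k + 1) • v =
            (Ω (((Ω - c • 1) ^ k) v - (d - c) ^ k • v) -
              c • (((Ω - c • 1) ^ k) v - (d - c) ^ k • v)) + (d - c) ^ k • (Ω v - d • v) := by
          rw [pow_succ', pow_succ', Module.End.mul_apply]
          simp only [LinearMap.sub_apply, LinearMap.smul_apply, Module.End.one_apply, map_sub,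
            map_smul]
          module
        rw [h2]
        exact M.add_mem (M.sub_mem (hM _ ih) (M.smul_mem _ ih)) (M.smul_mem _ hd)
    have h2 := h1 k
    rw [hk, zero_sub, M.neg_mem_iff, M.smul_mem_iff (pow_ne_zero k (sub_ne_zero.2 hdc))] at h2
    exact hv h2
  obtain ⟨ν, q, hqU, -, hq, hqN, hqp⟩ := D.exists_primMod (N := N) hU' hv ⟨hvU, hvc⟩ hvN
  have hcν : D.casimirValue ν = c := hgen (hΩst hN) hqN hqU.2 (D.casimir_sub_mem hN hq hqp)
  -- A truly primitive q would generate an irreducible module and so lie in N. Otherwise some b_i q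
  -- is nonzero, and above it there is a truly primitive vector with the same Casimir eigenvalue but
  -- a strictly higher weight. Both weights are dominant, which contradicts `eq_of_casimirValue_eq`.
  by_cases hprim : D.PrimMod φ ⊥ q
  · have h1 := D.isSimpleFor_of_prim hfin hwt hq (fun h => hqN (h ▸ N.zero_mem)) hprim
    exact hqN ((le_sSup h1 : _ ≤ N) (subset_closureUnder _ _ rfl))
  · simp only [PrimMod, not_forall] at hprim
    obtain ⟨i, hi, hiq⟩ := hprim
    obtain ⟨ν', q', hq'U, hν', hq', hq'0, hq'p⟩ := D.exists_primMod (N := ⊥) hU'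
      (D.act_mem_wts (D.b_mem i) hq) (hU' _ _ hqU) hiq
    have hcν' : D.casimirValue ν' = c := hgen (M := ⊥) (by simp) hq'0 hq'U.2
      (D.casimir_sub_mem (by simp) hq' hq'p)
    have h1 : ν' - ν = ν' - (ν + D.wt i) + D.wt i := by abel
    have h2 : ν' - ν ∈ D.posSums := h1 ▸ add_mem hν' (D.wt_mem_posSums hi)
    have h3 : ν' - ν ≠ 0 := by
      intro h0
      refine hi.1 (D.eq_zero_of_neg_mem hi.2 ?_)
      have : -D.wt i = ν' - (ν + D.wt i) := by rw [eq_sub_of_add_eq (h1.symm.trans h0)]; abel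
      rw [this]
      exact D.posSums_le hν'
    exact h3 (sub_eq_zero.2 (D.eq_of_casimirValue_eq h2
      (D.dominant_of_primMod hfin hN hq hqN hqp)
      (D.dominant_of_primMod hfin (N := ⊥) (by simp) hq' hq'0 hq'p) (hcν.trans hcν'.symm)).symm)

end SplitReductive

end TwistedWeyl
end

noncomputable section

namespace TwistedWeyl

/-! ### Basic identities in Lie superalgebras and the triangular decomposition. -/

section SuperBasics

variable {L : Type*} [AddCommGroup L] [Module ℂ L] [SuperSpace L]

theorem koszul_zero_left (i : ZMod 2) : koszul 0 i = 1 := by simp [koszul]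

theorem koszul_zero_right (i : ZMod 2) : koszul i 0 = 1 := by simp [koszul]

theorem koszul_mul_self (i j : ZMod 2) : koszul i j * koszul i j = 1 := by
  rw [koszul, ← mul_pow]; simp

/-- Two linear maps that agree on homogeneous elements are equal. -/
theorem ext_homogeneous {M : Type*} [AddCommGroup M] [Module ℂ M] {f f' : L →ₗ[ℂ] M}
    (h : ∀ i, ∀ x ∈ part L i, f x = f' x) : f = f' := by
  ext x
  obtain ⟨a, ha, b, hb, rfl⟩ := exists_add_eq x
  rw [map_add, map_add, h 0 a ha, h 1 b hb]

variable [LieSuperalgebra L]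

theorem br_br {i j : ZMod 2} {x y : L} (hx : x ∈ part L i) (hy : y ∈ part L j) (z : L) :
    br x (br y z) = br (br x y) z + koszul i j • br y (br x z) := by
  have := ext_homogeneous
    (f := LieSuperalgebra.bracket x ∘ₗ LieSuperalgebra.bracket y)
    (f' := LieSuperalgebra.bracket (br x y) +
      koszul i j • (LieSuperalgebra.bracket y ∘ₗ LieSuperalgebra.bracket x))
    fun k z hz => LieSuperalgebra.jacobi hx hy hz
  exact DFunLike.congr_fun this z

theorem br_skew_even {x : L} (hx : x ∈ part L 0) (y : L) : br x y = -br y x := by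
  have := ext_homogeneous (f := LieSuperalgebra.bracket x)
    (f' := -(LieSuperalgebra.bracket (L := L)).flip x) fun k y hy => by
      rw [LieSuperalgebra.skew hx hy, koszul_zero_left, one_smul]; rfl
  exact DFunLike.congr_fun this y

theorem br_br_even {x : L} (hx : x ∈ part L 0) (y z : L) :
    br x (br y z) = br (br x y) z + br y (br x z) := by
  obtain ⟨a, ha, b, hb, rfl⟩ := exists_add_eq y
  have h1 := br_br hx ha z
  have h2 := br_br hx hb z
  rw [koszul_zero_left, one_smul] at h1 h2
  simp only [br, map_add, LinearMap.add_apply] at *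
  rw [h1, h2]; abel

theorem parity_br (x y : L) : parity L (br x y) = br (parity L x) (parity L y) := by
  obtain ⟨a, ha, b, hb, rfl⟩ := exists_add_eq x
  obtain ⟨c, hc, d, hd, rfl⟩ := exists_add_eq y
  have h1 := parity_of_mem (LieSuperalgebra.bracket_mem ha hc)
  have h2 := parity_of_mem (LieSuperalgebra.bracket_mem ha hd)
  have h3 := parity_of_mem (LieSuperalgebra.bracket_mem hb hc)
  have h4 := parity_of_mem (LieSuperalgebra.bracket_mem hb hd)
  simp only [br, map_add, LinearMap.add_apply, parity_of_mem ha, parity_of_mem hb,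
    parity_of_mem hc, parity_of_mem hd, map_smul, LinearMap.smul_apply, h1, h2, h3, h4, sign_add]
  module

theorem add_self_zmod_two (i : ZMod 2) : i + i = 0 := by revert i; decide

/-! ### Subalgebras generated by a set -/

/-- The iterated brackets of elements of `S`. -/
inductive IterBr (S : Set L) : L → Prop
  | base {x : L} : x ∈ S → IterBr S x
  | br {x y : L} : IterBr S x → IterBr S y → IterBr S (br x y)

theorem subset_lieSpan (S : Set L) : S ⊆ lieSpan S := fun _ hx =>
  Submodule.mem_sInf.2 fun _ hN => hN.1 hx

theorem br_mem_lieSpan {S : Set L} {x y : L} (hx : x ∈ lieSpan S) (hy : y ∈ lieSpan S) :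
    br x y ∈ lieSpan S :=
  Submodule.mem_sInf.2 fun N hN =>
    hN.2 x (Submodule.mem_sInf.1 hx N hN) y (Submodule.mem_sInf.1 hy N hN)

theorem lieSpan_le_span (S : Set L) : lieSpan S ≤ Submodule.span ℂ {x | IterBr S x} := by
  refine sInf_le ⟨fun x hx => Submodule.subset_span (IterBr.base hx), fun x hx y hy => ?_⟩
  induction hx using Submodule.span_induction with
  | mem x hx =>
    induction hy using Submodule.span_induction with
    | mem y hy => exact Submodule.subset_span (hx.br hy)
    | zero => rw [br, map_zero]; exact Submodule.zero_mem _
    | add y z _ _ hy hz => rw [br, map_add]; exact Submodule.add_mem _ hy hz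
    | smul c y _ hy => rw [br, map_smul]; exact Submodule.smul_mem _ c hy
  | zero => rw [br, map_zero]; exact Submodule.zero_mem _
  | add y z _ _ hy hz => rw [br, map_add]; exact Submodule.add_mem _ hy hz
  | smul c y _ hy => rw [br, map_smul]; exact Submodule.smul_mem _ c hy

theorem IterBr.mem_lieSpan {S : Set L} {x : L} (hx : IterBr S x) : x ∈ lieSpan S := by
  induction hx with
  | base h => exact subset_lieSpan S h
  | br _ _ h1 h2 => exact br_mem_lieSpan h1 h2

theorem IterBr.homogeneous {S : Set L} (hS : ∀ s ∈ S, ∃ i, s ∈ part L i) {x : L}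
    (hx : IterBr S x) : ∃ i, x ∈ part L i := by
  induction hx with
  | base h => exact hS _ h
  | br _ _ h1 h2 =>
    obtain ⟨i, hi⟩ := h1
    obtain ⟨j, hj⟩ := h2
    exact ⟨_, LieSuperalgebra.bracket_mem hi hj⟩

/-- By the Jacobi identity, the stabilizer of a subspace contains the bracket of any two of its
homogeneous elements. Homogeneity of the generators makes all iterated brackets homogeneous. -/
theorem lieSpan_stable {S : Set L} (hS : ∀ s ∈ S, ∃ i, s ∈ part L i) {N : Submodule ℂ L}
    (hN : ∀ s ∈ S, ∀ v ∈ N, br s v ∈ N) {x : L} (hx : x ∈ lieSpan S) :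
    ∀ v ∈ N, br x v ∈ N := by
  intro v hv
  have h1 : ∀ x, IterBr S x → ∀ v ∈ N, br x v ∈ N := by
    intro x hx
    induction hx with
    | base h => exact hN _ h
    | br hx hy h1 h2 =>
      intro v hv
      obtain ⟨i, hi⟩ := hx.homogeneous hS
      obtain ⟨j, hj⟩ := hy.homogeneous hS
      rw [← sub_eq_of_eq_add (br_br hi hj v)]
      exact N.sub_mem (h1 _ (h2 _ hv)) (N.smul_mem _ (h2 _ (h1 _ hv)))
  have h2 : lieSpan S ≤ N.comap ((LieSuperalgebra.bracket (L := L)).flip v) :=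
    (lieSpan_le_span S).trans (Submodule.span_le.2 fun x hx => h1 x hx v hv)
  exact h2 hx

/-- The subalgebra generated by homogeneous elements is spanned by iterated left brackets. -/
theorem lieSpan_le {S : Set L} (hS : ∀ s ∈ S, ∃ i, s ∈ part L i) {N : Submodule ℂ L}
    (hSN : S ⊆ N) (hN : ∀ s ∈ S, ∀ v ∈ N, br s v ∈ N) : lieSpan S ≤ N := by
  let N' := N ⊓ lieSpan S
  have hN' : ∀ s ∈ S, ∀ v ∈ N', br s v ∈ N' := fun s hs v hv =>
    ⟨hN s hs v hv.1, br_mem_lieSpan (subset_lieSpan S hs) hv.2⟩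
  have : lieSpan S ≤ N' := sInf_le ⟨fun s hs => ⟨hSN hs, subset_lieSpan S hs⟩,
    fun x hx y hy => lieSpan_stable hS hN' hx.2 y hy⟩
  exact this.trans inf_le_left

/-- The subalgebra generated by eigenvectors of `h` is stable under `h`. -/
theorem br_mem_lieSpan_of_eigen {n : ℕ} {F : Fin n → L} {h : L} (hh : h ∈ part L 0)
    (hF : ∀ i, ∃ d, F i ∈ part L d) (hhF : ∀ j, ∃ c : ℂ, br h (F j) = c • F j) {y : L}
    (hy : y ∈ lieSpan (Set.range F)) : br h y ∈ lieSpan (Set.range F) := by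
  have hF' : ∀ s ∈ Set.range F, ∃ d, s ∈ part L d := by rintro _ ⟨j, rfl⟩; exact hF j
  have : lieSpan (Set.range F) ≤
      lieSpan (Set.range F) ⊓ (lieSpan (Set.range F)).comap (LieSuperalgebra.bracket h) := by
    refine lieSpan_le hF' ?_ ?_
    · rintro _ ⟨j, rfl⟩
      have h1 := subset_lieSpan (Set.range F) ⟨j, rfl⟩
      refine ⟨h1, ?_⟩
      obtain ⟨c, hc⟩ := hhF j
      change br h (F j) ∈ lieSpan (Set.range F)
      rw [hc]
      exact Submodule.smul_mem _ c h1
    · rintro _ ⟨j, rfl⟩ v hv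
      have h1 := subset_lieSpan (Set.range F) ⟨j, rfl⟩
      refine ⟨br_mem_lieSpan h1 hv.1, ?_⟩
      change br h (br (F j) v) ∈ lieSpan (Set.range F)
      rw [br_br_even hh]
      obtain ⟨c, hc⟩ := hhF j
      rw [hc]
      exact Submodule.add_mem _ (br_mem_lieSpan (Submodule.smul_mem _ c h1) hv.1)
        (br_mem_lieSpan h1 hv.2)
  exact (this hy).2

/-- Expand [E_i, [F_j, v]] by the Jacobi identity: [E_i, F_j] lies in H and acts diagonally on the
generators F. The roles of E and F are kept symmetric so that the statement serves both 𝔫⁻ and 𝔫⁺.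
-/
theorem br_mem_lieSpan_sup {n : ℕ} {E F : Fin n → L} {H : Submodule ℂ L} (hH : H ≤ part L 0)
    (hE : ∀ i, ∃ d, E i ∈ part L d) (hF : ∀ i, ∃ d, F i ∈ part L d)
    (hEF : ∀ i j, br (E i) (F j) ∈ H) (hHF : ∀ h ∈ H, ∀ j, ∃ c : ℂ, br h (F j) = c • F j)
    (i : Fin n) {y : L} (hy : y ∈ lieSpan (Set.range F)) :
    br (E i) y ∈ lieSpan (Set.range F) ⊔ H := by
  have hF' : ∀ s ∈ Set.range F, ∃ d, s ∈ part L d := by rintro _ ⟨j, rfl⟩; exact hF j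
  have hHs : ∀ h ∈ H, ∀ y ∈ lieSpan (Set.range F), br h y ∈ lieSpan (Set.range F) :=
    fun h hh y hy => br_mem_lieSpan_of_eigen (hH hh) hF (hHF h hh) hy
  have : lieSpan (Set.range F) ≤ lieSpan (Set.range F) ⊓
      (lieSpan (Set.range F) ⊔ H).comap (LieSuperalgebra.bracket (E i)) := by
    refine lieSpan_le hF' ?_ ?_
    · rintro _ ⟨j, rfl⟩
      exact ⟨subset_lieSpan (Set.range F) ⟨j, rfl⟩, Submodule.mem_sup_right (hEF i j)⟩
    · rintro _ ⟨j, rfl⟩ v hv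
      have h1 := subset_lieSpan (Set.range F) ⟨j, rfl⟩
      refine ⟨br_mem_lieSpan h1 hv.1, ?_⟩
      change br (E i) (br (F j) v) ∈ lieSpan (Set.range F) ⊔ H
      obtain ⟨d, hd⟩ := hE i
      obtain ⟨d', hd'⟩ := hF j
      rw [br_br hd hd']
      refine Submodule.mem_sup_left (Submodule.add_mem _ (hHs _ (hEF i j) _ hv.1)
        (Submodule.smul_mem _ _ ?_))
      obtain ⟨a, ha, h, hh, hah⟩ := Submodule.mem_sup.1 hv.2
      change br (F j) (LieSuperalgebra.bracket (E i) v) ∈ _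
      rw [← hah, br, map_add]
      refine Submodule.add_mem _ (br_mem_lieSpan h1 ha) ?_
      have h2 := br_skew_even (hH hh) (F j)
      obtain ⟨c, hc⟩ := hHF h hh j
      have h3 : br (F j) h = -(c • F j) := by rw [← hc, h2, neg_neg]
      change br (F j) h ∈ _
      rw [h3]
      exact Submodule.neg_mem _ (Submodule.smul_mem _ _ h1)
  exact (this hy).2

namespace ChevalleyGenerators

variable {n : ℕ} (C : ChevalleyGenerators L n)

theorem cartan_le : C.cartan ≤ part L 0 := Submodule.span_le.2 (by
  rintro _ ⟨i, rfl⟩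
  rw [← C.bracket_e_f i, ← add_self_zmod_two (C.deg i)]
  exact LieSuperalgebra.bracket_mem (C.e_mem i) (C.f_mem i))

theorem br_cartan_cartan {h h' : L} (hh : h ∈ C.cartan) (hh' : h' ∈ C.cartan) : br h h' = 0 := by
  have h1 : ∀ i, C.cartan ≤ LinearMap.ker (LieSuperalgebra.bracket (C.h i)) := fun i =>
    Submodule.span_le.2 (by rintro _ ⟨j, rfl⟩; exact C.bracket_h_h i j)
  have h2 : C.cartan ≤ LinearMap.ker ((LieSuperalgebra.bracket (L := L)).flip h') :=
    Submodule.span_le.2 (by rintro _ ⟨i, rfl⟩; exact h1 i hh')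
  exact h2 hh

theorem f_ne_zero (i : Fin n) : C.f i ≠ 0 := fun h =>
  C.h_ne_zero i (by rw [← C.bracket_e_f, h, br, map_zero])

/-- The Cartan matrix prescribes eigenvalues only on the h_k, which may be linearly dependent.
Reading off the coefficient of the nonzero vector f_i in [h, f_i] defines the functional on their
span without choices. -/
theorem exists_simple_root (i : Fin n) : ∃ α : Module.Dual ℂ C.cartan, ∀ h : C.cartan,
    br (h : L) (C.e i) = α h • C.e i ∧ br (h : L) (C.f i) = -(α h • C.f i) := by
  obtain ⟨p, hp⟩ : ∃ p : Module.Dual ℂ L, p (C.f i) = 1 :=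
    Module.Projective.exists_dual_eq_one ℂ (C.f_ne_zero i)
  refine ⟨-(p ∘ₗ (LieSuperalgebra.bracket (L := L)).flip (C.f i) ∘ₗ C.cartan.subtype),
    fun h => ?_⟩
  obtain ⟨c, hc1, hc2⟩ : ∃ c : ℂ, br (h : L) (C.e i) = c • C.e i ∧
      br (h : L) (C.f i) = -(c • C.f i) := by
    obtain ⟨h, hh⟩ := h
    simp only
    induction hh using Submodule.span_induction with
    | mem x hx => obtain ⟨k, rfl⟩ := hx; exact ⟨C.a k i, C.bracket_h_e k i, C.bracket_h_f k i⟩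
    | zero => exact ⟨0, by simp [br]⟩
    | add x y _ _ hx hy =>
      obtain ⟨c, h1, h2⟩ := hx
      obtain ⟨d, h3, h4⟩ := hy
      refine ⟨c + d, ?_, ?_⟩
      · rw [br, map_add, LinearMap.add_apply, ← br, ← br, h1, h3, add_smul]
      · rw [br, map_add, LinearMap.add_apply, ← br, ← br, h2, h4]; module
    | smul a x _ hx =>
      obtain ⟨c, h1, h2⟩ := hx
      refine ⟨a * c, ?_, ?_⟩
      · rw [br, map_smul, LinearMap.smul_apply, ← br, h1, mul_smul]
      · rw [br, map_smul, LinearMap.smul_apply, ← br, h2]; module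
  have : (-(p ∘ₗ (LieSuperalgebra.bracket (L := L)).flip (C.f i) ∘ₗ C.cartan.subtype)) h = c := by
    change -p (br (h : L) (C.f i)) = c
    rw [hc2, map_neg, map_smul, hp]; simp
  rw [this]
  exact ⟨hc1, hc2⟩

theorem br_cartan_nPos {h x : L} (hh : h ∈ C.cartan) (hx : x ∈ C.nPos) : br h x ∈ C.nPos :=
  br_mem_lieSpan_of_eigen (C.cartan_le hh) (fun i => ⟨_, C.e_mem i⟩) (fun j => by
    obtain ⟨α, hα⟩ := C.exists_simple_root j
    exact ⟨_, (hα ⟨h, hh⟩).1⟩) hx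

/-- The sum contains the Chevalley generators and is stable under bracketing with each of them, so
it contains the algebra they generate. Only the spanning half of the triangular decomposition is
needed. -/
theorem sup_eq_top : C.nNeg ⊔ C.cartan ⊔ C.nPos = ⊤ := by
  have hE : ∀ i, ∃ d, C.e i ∈ part L d := fun i => ⟨_, C.e_mem i⟩
  have hF : ∀ i, ∃ d, C.f i ∈ part L d := fun i => ⟨_, C.f_mem i⟩
  have hef : ∀ i j, br (C.e i) (C.f j) ∈ C.cartan := by
    intro i j
    by_cases hij : i = j
    · subst hij; rw [C.bracket_e_f]; exact Submodule.subset_span ⟨i, rfl⟩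
    · rw [C.bracket_e_f_of_ne i j hij]; exact Submodule.zero_mem _
  have hfe : ∀ i j, br (C.f i) (C.e j) ∈ C.cartan := by
    intro i j
    have := LieSuperalgebra.skew (C.f_mem i) (C.e_mem j)
    change LieSuperalgebra.bracket _ _ ∈ _
    rw [this]
    exact Submodule.neg_mem _ (Submodule.smul_mem _ _ (hef j i))
  have hhe : ∀ h ∈ C.cartan, ∀ j, ∃ c : ℂ, br h (C.e j) = c • C.e j := fun h hh j => by
    obtain ⟨α, hα⟩ := C.exists_simple_root j
    exact ⟨_, (hα ⟨h, hh⟩).1⟩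
  have hhf : ∀ h ∈ C.cartan, ∀ j, ∃ c : ℂ, br h (C.f j) = c • C.f j := fun h hh j => by
    obtain ⟨α, hα⟩ := C.exists_simple_root j
    exact ⟨-α ⟨h, hh⟩, by rw [neg_smul]; exact (hα ⟨h, hh⟩).2⟩
  have he : ∀ i, C.e i ∈ C.nPos := fun i => subset_lieSpan _ ⟨i, rfl⟩
  have hf : ∀ i, C.f i ∈ C.nNeg := fun i => subset_lieSpan _ ⟨i, rfl⟩
  have hS : ∀ s ∈ Set.range C.e ∪ Set.range C.f, ∃ d, s ∈ part L d := by
    rintro _ (⟨i, rfl⟩ | ⟨i, rfl⟩)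
    · exact hE i
    · exact hF i
  rw [← top_le_iff, ← C.generate]
  have hN1 : C.nNeg ≤ C.nNeg ⊔ C.cartan ⊔ C.nPos := le_sup_left.trans le_sup_left
  have hN2 : C.cartan ≤ C.nNeg ⊔ C.cartan ⊔ C.nPos := le_sup_right.trans le_sup_left
  have hN3 : C.nPos ≤ C.nNeg ⊔ C.cartan ⊔ C.nPos := le_sup_right
  have key : ∀ s, (∀ v ∈ C.nNeg, br s v ∈ C.nNeg ⊔ C.cartan ⊔ C.nPos) →
      (∀ v ∈ C.cartan, br s v ∈ C.nNeg ⊔ C.cartan ⊔ C.nPos) →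
      (∀ v ∈ C.nPos, br s v ∈ C.nNeg ⊔ C.cartan ⊔ C.nPos) →
      ∀ v ∈ C.nNeg ⊔ C.cartan ⊔ C.nPos, br s v ∈ C.nNeg ⊔ C.cartan ⊔ C.nPos := by
    intro s h1 h2 h3 v hv
    have : C.nNeg ⊔ C.cartan ⊔ C.nPos ≤
        (C.nNeg ⊔ C.cartan ⊔ C.nPos).comap (LieSuperalgebra.bracket s) :=
      sup_le (sup_le h1 h2) h3
    exact this hv
  have hskew : ∀ h ∈ C.cartan, ∀ (x : L) (c : ℂ), br h x = c • x → br x h = -(c • x) := by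
    intro h hh x c hc
    rw [← hc, br_skew_even (C.cartan_le hh) x, neg_neg]
  refine lieSpan_le hS ?_ ?_
  · rintro _ (⟨i, rfl⟩ | ⟨i, rfl⟩)
    · exact hN3 (he i)
    · exact hN1 (hf i)
  · rintro _ (⟨i, rfl⟩ | ⟨i, rfl⟩)
    · refine key _ (fun v hv => ?_) (fun h hh => ?_) fun v hv => hN3 (br_mem_lieSpan (he i) hv)
      · exact (sup_le hN1 hN2) (br_mem_lieSpan_sup C.cartan_le hE hF hef hhf i hv)
      · obtain ⟨c, hc⟩ := hhe h hh i
        rw [hskew h hh _ c hc]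
        exact hN3 (Submodule.neg_mem _ (Submodule.smul_mem _ _ (he i)))
    · refine key _ (fun v hv => hN1 (br_mem_lieSpan (hf i) hv)) (fun h hh => ?_) fun v hv => ?_
      · obtain ⟨c, hc⟩ := hhf h hh i
        rw [hskew h hh _ c hc]
        exact hN1 (Submodule.neg_mem _ (Submodule.smul_mem _ _ (hf i)))
      · exact (sup_le hN3 hN2) (br_mem_lieSpan_sup C.cartan_le hF hE hfe hhe i hv)

end ChevalleyGenerators

/-! ### Averaging -/

section Reynolds

variable {Γ : Type*} [Group Γ] [Fintype Γ] (ρ : SuperAction Γ L)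

/-- The projection onto the fixed points. -/
def reynolds : L →ₗ[ℂ] L := (Fintype.card Γ : ℂ)⁻¹ • ∑ γ, ρ.toHom γ

theorem reynolds_mem (x : L) : reynolds ρ x ∈ ρ.fixed.toSubmodule := by
  intro δ
  simp only [reynolds, LinearMap.smul_apply, LinearMap.sum_apply, map_smul, map_sum]
  congr 1
  refine Fintype.sum_equiv (Equiv.mulLeft δ) _ _ fun γ => ?_
  rw [Equiv.coe_mulLeft, map_mul]
  rfl

theorem reynolds_eq {x : L} (hx : x ∈ ρ.fixed.toSubmodule) : reynolds ρ x = x := by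
  have : ∀ γ, ρ.toHom γ x = x := hx
  have h0 : (Fintype.card Γ : ℂ) ≠ 0 := by exact_mod_cast Fintype.card_ne_zero
  simp [reynolds, this, ← Nat.cast_smul_eq_nsmul ℂ, smul_smul, h0]

theorem reynolds_stable {N : Submodule ℂ L} (hN : ∀ γ, ∀ x ∈ N, ρ.toHom γ x ∈ N) {x : L}
    (hx : x ∈ N) : reynolds ρ x ∈ N := by
  simp only [reynolds, LinearMap.smul_apply, LinearMap.sum_apply]
  exact N.smul_mem _ (N.sum_mem fun γ _ => hN γ x hx)

/-- A projection maps a spanning set of the whole space to a spanning set of its image. -/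
theorem fixed_span {S : Set L} (hS : Submodule.span ℂ S = ⊤) :
    ρ.fixed.toSubmodule ≤ Submodule.span ℂ (reynolds ρ '' S) := by
  intro x hx
  rw [← reynolds_eq ρ hx, Submodule.span_image, hS]
  exact ⟨x, trivial, rfl⟩

end Reynolds

end SuperBasics

end TwistedWeyl
end

noncomputable section

namespace TwistedWeyl

theorem span_preimage_subtype {V : Type*} [AddCommGroup V] [Module ℂ V] {N : Submodule ℂ V}
    {R : Set V} (hR : R ⊆ N) (h : N ≤ Submodule.span ℂ R) :
    Submodule.span ℂ ((↑) ⁻¹' R : Set N) = ⊤ := by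
  refine Submodule.map_injective_of_injective N.injective_subtype ?_
  rw [Submodule.map_span, Submodule.map_top, Submodule.range_subtype]
  have : N.subtype '' ((↑) ⁻¹' R) = R := by
    rw [Submodule.coe_subtype]
    exact Subtype.image_preimage_coe _ _ |>.trans (Set.inter_eq_right.2 hR)
  rw [this]
  exact le_antisymm (Submodule.span_le.2 hR) h

/-! ### Weights -/

section Weights

variable {g : Type u} [AddCommGroup g] [Module ℂ g] [SuperSpace g] [LieSuperalgebra g]
variable {A : Type v} [CommRing A] [Algebra ℂ A] {Γ : Type w} [Group Γ]
variable (ρ : SuperAction Γ g) (τ : Γ →* (A ≃ₐ[ℂ] A)) {n : ℕ} (C : ChevalleyGenerators g n)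

/-- The adjoint action of `𝔥_Γ` on `𝔤`. -/
def adCartan : cartanFixed ρ C →ₗ[ℂ] Module.End ℂ g :=
  LieSuperalgebra.bracket ∘ₗ (cartanFixed ρ C).subtype

variable {ρ C} in
theorem mem_wtSpace_adCartan {x : g} {ν : Weight ρ C} :
    x ∈ wtSpace (adCartan ρ C) ν ↔ ∀ h : cartanFixed ρ C, br (h : g) x = ν h • x := Iff.rfl

variable {ρ C} in
theorem cartanFixed_even (h : cartanFixed ρ C) : (h : g) ∈ part g 0 := C.cartan_le h.2.1

variable {ρ C} in
theorem br_mem_wtSpace {x y : g} {μ ν : Weight ρ C} (hx : x ∈ wtSpace (adCartan ρ C) μ)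
    (hy : y ∈ wtSpace (adCartan ρ C) ν) : br x y ∈ wtSpace (adCartan ρ C) (μ + ν) := by
  rw [mem_wtSpace_adCartan] at *
  intro h
  rw [br_br_even (cartanFixed_even h), hx, hy]
  simp only [br, map_smul, LinearMap.smul_apply, LinearMap.add_apply]
  module

variable {ρ C} in
theorem cartan_le_wtSpace : C.cartan ≤ wtSpace (adCartan ρ C) 0 := fun x hx h => by
  rw [LinearMap.zero_apply, zero_smul]
  exact C.br_cartan_cartan h.2.1 hx

variable {ρ C} in
-- Γ fixes 𝔥_Γ pointwise, so it preserves each weight space; averaging therefore keeps weights.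
theorem map_mem_wtSpace {x : g} {ν : Weight ρ C} (hx : x ∈ wtSpace (adCartan ρ C) ν) (γ : Γ) :
    ρ.toHom γ x ∈ wtSpace (adCartan ρ C) ν := by
  rw [mem_wtSpace_adCartan] at *
  intro h
  have h1 : ρ.toHom γ h = h := h.2.2 γ
  have h2 := ρ.map_bracket γ h x
  rwa [h1, hx, map_smul, eq_comm] at h2

theorem rootSpace_le (α : Weight ρ C) : rootSpace ρ C α ≤ wtSpace (adCartan ρ C) α :=
  fun _ hx => hx.2

/-- The restriction to `𝔥_Γ` of the weight of `e i`. -/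
def simpleWeight (i : Fin n) : Weight ρ C :=
  (C.exists_simple_root i).choose ∘ₗ Submodule.inclusion inf_le_left

theorem e_mem_wtSpace (i : Fin n) : C.e i ∈ wtSpace (adCartan ρ C) (simpleWeight ρ C i) :=
  fun h => ((C.exists_simple_root i).choose_spec (Submodule.inclusion inf_le_left h)).1

theorem f_mem_wtSpace (i : Fin n) : C.f i ∈ wtSpace (adCartan ρ C) (-simpleWeight ρ C i) := by
  intro h
  rw [LinearMap.neg_apply, neg_smul]
  exact ((C.exists_simple_root i).choose_spec (Submodule.inclusion inf_le_left h)).2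

variable {ρ C}

theorem map_nPos (hdiag : ∀ γ, C.IsDiagramAutomorphism (ρ.toHom γ)) (γ : Γ) {x : g}
    (hx : x ∈ C.nPos) : ρ.toHom γ x ∈ C.nPos := by
  obtain ⟨σ, c, -, -, h⟩ := hdiag γ
  have he : ∀ i, ρ.toHom γ (C.e i) ∈ C.nPos := fun i => by
    rw [(h i).1]; exact Submodule.smul_mem _ _ (subset_lieSpan _ ⟨_, rfl⟩)
  have : C.nPos ≤ C.nPos.comap (ρ.toHom γ) := by
    refine lieSpan_le (by rintro _ ⟨i, rfl⟩; exact ⟨_, C.e_mem i⟩)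
      (by rintro _ ⟨i, rfl⟩; exact he i) ?_
    rintro _ ⟨i, rfl⟩ v hv
    change ρ.toHom γ (br (C.e i) v) ∈ C.nPos
    rw [ρ.map_bracket]
    exact br_mem_lieSpan (he i) hv
  exact this hx

theorem map_nNeg (hdiag : ∀ γ, C.IsDiagramAutomorphism (ρ.toHom γ)) (γ : Γ) {x : g}
    (hx : x ∈ C.nNeg) : ρ.toHom γ x ∈ C.nNeg := by
  obtain ⟨σ, c, -, -, h⟩ := hdiag γ
  have he : ∀ i, ρ.toHom γ (C.f i) ∈ C.nNeg := fun i => by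
    rw [(h i).2.1]; exact subset_lieSpan _ ⟨_, rfl⟩
  have : C.nNeg ≤ C.nNeg.comap (ρ.toHom γ) := by
    refine lieSpan_le (by rintro _ ⟨i, rfl⟩; exact ⟨_, C.f_mem i⟩)
      (by rintro _ ⟨i, rfl⟩; exact he i) ?_
    rintro _ ⟨i, rfl⟩ v hv
    change ρ.toHom γ (br (C.f i) v) ∈ C.nNeg
    rw [ρ.map_bracket]
    exact br_mem_lieSpan (he i) hv
  exact this hx

theorem map_cartan (hdiag : ∀ γ, C.IsDiagramAutomorphism (ρ.toHom γ)) (γ : Γ) {x : g}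
    (hx : x ∈ C.cartan) : ρ.toHom γ x ∈ C.cartan := by
  obtain ⟨σ, c, -, -, h⟩ := hdiag γ
  have : C.cartan ≤ C.cartan.comap (ρ.toHom γ) := Submodule.span_le.2 (by
    rintro _ ⟨i, rfl⟩
    change ρ.toHom γ (C.h i) ∈ C.cartan
    rw [(h i).2.2]
    exact Submodule.smul_mem _ _ (Submodule.subset_span ⟨_, rfl⟩))
  exact this hx

/-- The nonzero elements of `Q⁺`. -/
def posWeights (Δ : Set (Weight ρ C)) : Set (Weight ρ C) := {q | q ∈ posLattice Δ ∧ q ≠ 0}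

variable {Δ : Set (Weight ρ C)}

namespace IsConsistentSimpleSystem

/-- The height of a weight. -/
theorem exists_height (hΔ : IsConsistentSimpleSystem ρ C Δ) :
    ∃ φ : Weight ρ C →ₗ[ℂ] ℂ, ∀ q ∈ posLattice Δ, ∃ m : ℕ, φ q = m ∧ (m = 0 → q = 0) := by
  obtain ⟨φ, hφ⟩ := Module.exists_dual_forall_apply_eq_one hΔ.linearIndependent
  refine ⟨φ, fun q hq => ?_⟩
  induction hq using AddSubmonoid.closure_induction with
  | mem q hq => exact ⟨1, by simpa using hφ q hq, by simp⟩
  | zero => exact ⟨0, by simp, by simp⟩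
  | add p q _ _ hp hq =>
    obtain ⟨a, ha, ha'⟩ := hp
    obtain ⟨b, hb, hb'⟩ := hq
    refine ⟨a + b, by rw [map_add, ha, hb]; simp, fun h => ?_⟩
    rw [ha' (by omega), hb' (by omega), add_zero]

variable (hΔ : IsConsistentSimpleSystem ρ C Δ)
include hΔ

theorem eq_zero_of_add_eq_zero {p q : Weight ρ C} (hp : p ∈ posLattice Δ) (hq : q ∈ posLattice Δ)
    (h : p + q = 0) : p = 0 := by
  obtain ⟨φ, hφ⟩ := hΔ.exists_height
  obtain ⟨a, ha, ha'⟩ := hφ p hp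
  obtain ⟨b, hb, -⟩ := hφ q hq
  have h1 := congrArg φ h
  rw [map_add, ha, hb, map_zero] at h1
  have h2 : a + b = 0 := by exact_mod_cast h1
  exact ha' (by omega)

theorem add_mem_posWeights {p q : Weight ρ C} (hp : p ∈ posWeights Δ) (hq : q ∈ posLattice Δ) :
    p + q ∈ posWeights Δ :=
  ⟨add_mem hp.1 hq, fun h => hp.2 (hΔ.eq_zero_of_add_eq_zero hp.1 hq h)⟩

/-- The sum F of the translates of f_i under Γ is fixed, lies in 𝔫⁻ and has the weight of f_i
restricted to 𝔥_Γ. Once F ≠ 0, consistency of the triangular decompositions makes this weight a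
negative root of 𝔤^Γ. -/
theorem simpleWeight_mem [Finite Γ] (hdiag : ∀ γ, C.IsDiagramAutomorphism (ρ.toHom γ))
    (i : Fin n) : simpleWeight ρ C i ∈ posWeights Δ := by
  classical
  have := Fintype.ofFinite Γ
  choose σ c hc ha hσ using hdiag
  let F : g := ∑ γ, ρ.toHom γ (C.f i)
  have hFfix : F ∈ ρ.fixed.toSubmodule := by
    intro δ
    simp only [F, map_sum]
    refine Fintype.sum_equiv (Equiv.mulLeft δ) _ _ fun γ => ?_
    rw [Equiv.coe_mulLeft, map_mul]
    rfl
  have hFneg : F ∈ C.nNeg := Submodule.sum_mem _ fun γ _ => by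
    rw [(hσ γ i).2.1]; exact subset_lieSpan _ ⟨_, rfl⟩
  have hFwt : F ∈ wtSpace (adCartan ρ C) (-simpleWeight ρ C i) :=
    Submodule.sum_mem _ fun γ _ => map_mem_wtSpace (f_mem_wtSpace ρ C i) γ
  have hF0 : F ≠ 0 := by
    intro h0
    -- Only the translates equal to f_i pair nontrivially with e_i, so the coefficient counts the
    -- group elements whose permutation fixes i.
    have h1 : br (C.e i) F = ((Finset.univ.filter fun γ => σ γ i = i).card : ℂ) • C.h i := by
      simp only [F, br, map_sum]
      rw [Finset.card_filter]
      push_cast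
      rw [Finset.sum_smul]
      refine Finset.sum_congr rfl fun γ _ => ?_
      rw [(hσ γ i).2.1]
      by_cases h : σ γ i = i
      · rw [h, if_pos rfl, one_smul]; exact C.bracket_e_f i
      · rw [if_neg h, zero_smul]; exact C.bracket_e_f_of_ne i _ (Ne.symm h)
    rw [h0, br, map_zero] at h1
    have h2 := (smul_eq_zero.1 h1.symm).resolve_right (C.h_ne_zero i)
    rw [Nat.cast_eq_zero, Finset.card_eq_zero] at h2
    -- The identity of Γ is counted: it fixes the vector f_i, and its permutation cannot move i
    -- since [e_i, f_i] = h_i ≠ 0. So the coefficient is positive.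
    have h3 : σ 1 i = i := by
      by_contra hne
      have h4 := (hσ 1 i).2.1
      rw [map_one, Module.End.one_apply] at h4
      refine C.h_ne_zero i ?_
      rw [← C.bracket_e_f i, h4]
      exact C.bracket_e_f_of_ne i _ (Ne.symm hne)
    exact absurd (Finset.mem_filter.2 ⟨Finset.mem_univ (1 : Γ), h3⟩) (by rw [h2]; simp)
  have h1 : F ∈ ⨆ α ∈ {α | IsRoot ρ C α ∧ -α ∈ posLattice Δ}, wtSpace (adCartan ρ C) α := by
    have h2 : F ∈ C.nNeg ⊓ ρ.fixed.toSubmodule := ⟨hFneg, hFfix⟩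
    rw [← hΔ.nNeg_eq] at h2
    exact iSup₂_mono (fun α _ => rootSpace_le ρ C α) h2
  have h2 := mem_of_mem_iSup_wtSpace (P := {α | IsRoot ρ C α ∧ -α ∈ posLattice Δ}) hFwt hF0 h1
  refine ⟨by simpa using h2.2, fun h => h2.1.1 (by rw [h, neg_zero])⟩

end IsConsistentSimpleSystem

/-- Iterated brackets of homogeneous weight vectors are again homogeneous weight vectors, and their
weights stay in any set closed under addition. -/
theorem lieSpan_le_span_wtSpace {F : Fin n → g} (hF : ∀ i, ∃ d, F i ∈ part g d)
    {P : Set (Weight ρ C)} (hP : ∀ p ∈ P, ∀ q ∈ P, p + q ∈ P)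
    (hw : ∀ i, ∃ ν ∈ P, F i ∈ wtSpace (adCartan ρ C) ν) :
    lieSpan (Set.range F) ≤ Submodule.span ℂ {x | x ∈ lieSpan (Set.range F) ∧
      (∃ d, x ∈ part g d) ∧ ∃ ν ∈ P, x ∈ wtSpace (adCartan ρ C) ν} := by
  refine (lieSpan_le_span _).trans (Submodule.span_mono fun x hx => ⟨hx.mem_lieSpan,
    hx.homogeneous (by rintro _ ⟨i, rfl⟩; exact hF i), ?_⟩)
  induction hx with
  | base h => obtain ⟨i, rfl⟩ := h; exact hw i
  | br _ _ h1 h2 =>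
    obtain ⟨μ, hμ, h1⟩ := h1
    obtain ⟨ν, hν, h2⟩ := h2
    exact ⟨_, hP _ hμ _ hν, br_mem_wtSpace h1 h2⟩

variable (Δ) in
/-- The homogeneous weight vectors in `𝔫⁺`, the elements of `𝔥`, and the homogeneous weight vectors
in `𝔫⁻`. -/
def triangularVectors : Set g :=
  {x | x ∈ C.nPos ∧ (∃ d, x ∈ part g d) ∧ ∃ ν ∈ posWeights Δ, x ∈ wtSpace (adCartan ρ C) ν} ∪
  C.cartan ∪
  {x | x ∈ C.nNeg ∧ (∃ d, x ∈ part g d) ∧ ∃ ν ∈ posWeights Δ, x ∈ wtSpace (adCartan ρ C) (-ν)}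

variable [Finite Γ] (hdiag : ∀ γ, C.IsDiagramAutomorphism (ρ.toHom γ))
  (hΔ : IsConsistentSimpleSystem ρ C Δ)

include hdiag hΔ

theorem span_triangularVectors : Submodule.span ℂ (triangularVectors Δ) = ⊤ := by
  rw [← top_le_iff, ← C.sup_eq_top]
  refine sup_le (sup_le ?_ ?_) ?_
  · have h1 := lieSpan_le_span_wtSpace (ρ := ρ) (C := C) (F := C.f) (P := {ν | -ν ∈ posWeights Δ})
      (fun i => ⟨_, C.f_mem i⟩)
      (fun p hp q hq => by
        have := hΔ.add_mem_posWeights hp hq.1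
        rwa [← neg_add] at this)
      (fun i => ⟨_, by simpa using hΔ.simpleWeight_mem hdiag i, f_mem_wtSpace ρ C i⟩)
    refine h1.trans (Submodule.span_mono ?_)
    rintro x ⟨hx, hd, ν, hν, hw⟩
    exact Or.inr ⟨hx, hd, -ν, hν, by rwa [neg_neg]⟩
  · exact fun x hx => Submodule.subset_span (Or.inl (Or.inr hx))
  · have h1 := lieSpan_le_span_wtSpace (ρ := ρ) (C := C) (F := C.e) (P := posWeights Δ)
      (fun i => ⟨_, C.e_mem i⟩)
      (fun p hp q hq => hΔ.add_mem_posWeights hp hq.1)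
      (fun i => ⟨_, hΔ.simpleWeight_mem hdiag i, e_mem_wtSpace ρ C i⟩)
    exact h1.trans (Submodule.span_mono fun x hx => Or.inl (Or.inl hx))

/-- `𝔤^Γ` is spanned by triangular vectors. -/
theorem span_triangularVectors_fixed :
    Submodule.span ℂ {x : Fixed ρ | (x : g) ∈ triangularVectors Δ} = ⊤ := by
  have := Fintype.ofFinite Γ
  have h1 := fixed_span ρ (span_triangularVectors hdiag hΔ)
  have h2 : reynolds ρ '' triangularVectors Δ ⊆ ρ.fixed.toSubmodule := by
    rintro _ ⟨x, -, rfl⟩; exact reynolds_mem ρ x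
  rw [← top_le_iff, ← span_preimage_subtype h2 h1]
  refine Submodule.span_mono ?_
  rintro y ⟨x, hx, hxy⟩
  have hd : ∀ d, x ∈ part g d → reynolds ρ x ∈ part g d := fun d =>
    reynolds_stable ρ fun γ => ρ.map_part γ d
  have hw : ∀ ν : Weight ρ C, x ∈ wtSpace (adCartan ρ C) ν →
      reynolds ρ x ∈ wtSpace (adCartan ρ C) ν := fun ν =>
    reynolds_stable ρ fun γ y hy => map_mem_wtSpace hy γ
  change (y : g) ∈ triangularVectors Δ
  rw [← hxy]
  rcases hx with (⟨h3, ⟨d, h4⟩, ν, hν, h5⟩ | hx) | ⟨h3, ⟨d, h4⟩, ν, hν, h5⟩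
  · exact Or.inl (Or.inl ⟨reynolds_stable ρ (fun γ y => map_nPos hdiag γ) h3, ⟨d, hd d h4⟩, ν, hν,
      hw _ h5⟩)
  · exact Or.inl (Or.inr (reynolds_stable ρ (fun γ y => map_cartan hdiag γ) hx))
  · exact Or.inr ⟨reynolds_stable ρ (fun γ y => map_nNeg hdiag γ) h3, ⟨d, hd d h4⟩, ν, hν,
      hw _ h5⟩

end Weights

/-! ### The triangular spanning set of the equivariant map superalgebra. -/

section MapWeights

variable {g : Type u} [AddCommGroup g] [Module ℂ g] [SuperSpace g] [LieSuperalgebra g]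
variable {A : Type v} [CommRing A] [Algebra ℂ A] {Γ : Type w} [Group Γ]
variable (ρ : SuperAction Γ g) (τ : Γ →* (A ≃ₐ[ℂ] A)) {n : ℕ} (C : ChevalleyGenerators g n)

/-- The image of `h ∈ 𝔥_Γ` in `(𝔤 ⊗ A)^Γ`. -/
def cartanMap : cartanFixed ρ C →ₗ[ℂ] EqMap ρ τ :=
  (incl ρ τ).toLinearMap ∘ₗ cartanIncl ρ C

theorem cartanMap_even (h : cartanFixed ρ C) : cartanMap ρ τ C h ∈ part (EqMap ρ τ) 0 := by
  have h1 : (h : g) ⊗ₜ[ℂ] (1 : A) ∈ tensorSub A (part g 0) :=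
    tmul_mem_tensorSub A (cartanFixed_even h) 1
  exact h1

variable {C}

/-- The weight vectors of weight `ν` in `(𝔤 ⊗ A)^Γ`. -/
def IsWeightElement (ν : Weight ρ C) (z : EqMap ρ τ) : Prop :=
  ∀ h, br (cartanMap ρ τ C h) z = ν h • z

/-- Homogeneous weight vectors of positive weight in `(𝔫⁺ ⊗ A)^Γ`. -/
def posElements (Δ : Set (Weight ρ C)) : Set (EqMap ρ τ) :=
  {z | (z : g ⊗[ℂ] A) ∈ tensorSub A C.nPos ∧ (∃ d, z ∈ part (EqMap ρ τ) d) ∧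
    ∃ ν ∈ posWeights Δ, IsWeightElement ρ τ ν z}

variable (C) in
/-- The elements of `(𝔥 ⊗ A)^Γ`. -/
def cartanElements : Set (EqMap ρ τ) := {z | (z : g ⊗[ℂ] A) ∈ tensorSub A C.cartan}

/-- Homogeneous weight vectors of negative weight in `(𝔫⁻ ⊗ A)^Γ`. -/
def negElements (Δ : Set (Weight ρ C)) : Set (EqMap ρ τ) :=
  {z | (z : g ⊗[ℂ] A) ∈ tensorSub A C.nNeg ∧ (∃ d, z ∈ part (EqMap ρ τ) d) ∧
    ∃ ν ∈ posWeights Δ, IsWeightElement ρ τ (-ν) z}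

theorem br_tmul (x y : g) (a b : A) :
    br (x ⊗ₜ[ℂ] a : g ⊗[ℂ] A) (y ⊗ₜ[ℂ] b) = br x y ⊗ₜ[ℂ] (a * b) := rfl

variable {ρ τ}

theorem br_tensorSub {P Q R : Submodule ℂ g} (h : ∀ x ∈ P, ∀ y ∈ Q, br x y ∈ R)
    {z z' : g ⊗[ℂ] A} (hz : z ∈ tensorSub A P) (hz' : z' ∈ tensorSub A Q) :
    br z z' ∈ tensorSub A R := by
  have h1 : ∀ x ∈ P, ∀ a : A,
      tensorSub A Q ≤ (tensorSub A R).comap (LieSuperalgebra.bracket (x ⊗ₜ[ℂ] a)) :=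
    fun x hx a => tensorSub_le A fun y hy b => tmul_mem_tensorSub A (h x hx y hy) (a * b)
  have h2 : tensorSub A P ≤
      (tensorSub A R).comap ((LieSuperalgebra.bracket (L := g ⊗[ℂ] A)).flip z') :=
    tensorSub_le A fun x hx a => h1 x hx a hz'
  exact h2 hz

theorem map_tensorSub {P : Submodule ℂ g} (hP : ∀ γ, ∀ x ∈ P, ρ.toHom γ x ∈ P) (γ : Γ)
    {z : g ⊗[ℂ] A} (hz : z ∈ tensorSub A P) : (mapAction ρ τ).toHom γ z ∈ tensorSub A P := by
  have h2 : tensorSub A P ≤ (tensorSub A P).comap ((mapAction ρ τ).toHom γ) :=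
    tensorSub_le A fun x hx a => tmul_mem_tensorSub A (hP γ x hx) (τ γ a)
  exact h2 hz

theorem isWeightElement_of_mem {z : EqMap ρ τ} {ν : Weight ρ C}
    (hz : (z : g ⊗[ℂ] A) ∈ tensorSub A (wtSpace (adCartan ρ C) ν)) : IsWeightElement ρ τ ν z := by
  intro h
  refine Subtype.ext ?_
  have h2 : tensorSub A (wtSpace (adCartan ρ C) ν) ≤ LinearMap.ker
      (LieSuperalgebra.bracket ((h : g) ⊗ₜ[ℂ] (1 : A)) - ν h • LinearMap.id) :=
    tensorSub_le A fun x hx a => by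
      rw [LinearMap.mem_ker, LinearMap.sub_apply, sub_eq_zero]
      change br ((h : g) ⊗ₜ[ℂ] (1 : A)) (x ⊗ₜ[ℂ] a) = ν h • (x ⊗ₜ[ℂ] a)
      rw [br_tmul, mem_wtSpace_adCartan.1 hx, one_mul, TensorProduct.smul_tmul']
  have h3 := h2 hz
  rw [LinearMap.mem_ker, LinearMap.sub_apply, sub_eq_zero] at h3
  exact h3

theorem IsWeightElement.of_cartan {z : EqMap ρ τ} (hz : z ∈ cartanElements ρ τ C) :
    IsWeightElement ρ τ (0 : Weight ρ C) z :=
  isWeightElement_of_mem (tensorSub_le (P := tensorSub A (wtSpace (adCartan ρ C) 0)) A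
    (fun _ hx a => tmul_mem_tensorSub A (cartan_le_wtSpace hx) a) hz)

theorem even_of_cartan {z : EqMap ρ τ} (hz : z ∈ cartanElements ρ τ C) :
    z ∈ part (EqMap ρ τ) 0 := by
  have h1 : (z : g ⊗[ℂ] A) ∈ tensorSub A (part g 0) :=
    tensorSub_le (P := tensorSub A (part g 0)) A
      (fun _ hx a => tmul_mem_tensorSub A (C.cartan_le hx) a) hz
  exact h1

theorem br_cartanElements {z z' : EqMap ρ τ} (hz : z ∈ cartanElements ρ τ C)
    (hz' : z' ∈ cartanElements ρ τ C) : br z z' = 0 := by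
  refine Subtype.ext ?_
  have h1 := br_tensorSub (R := ⊥) (fun x hx y hy => by
    rw [Submodule.mem_bot]; exact C.br_cartan_cartan hx hy) hz hz'
  have h2 : tensorSub A (⊥ : Submodule ℂ g) ≤ ⊥ := tensorSub_le A fun x hx a => by
    rw [(Submodule.mem_bot ℂ).1 hx, TensorProduct.zero_tmul]; exact Submodule.zero_mem _
  exact (Submodule.mem_bot ℂ).1 (h2 h1)

variable [Finite Γ] {Δ : Set (Weight ρ C)} (hdiag : ∀ γ, C.IsDiagramAutomorphism (ρ.toHom γ))
  (hΔ : IsConsistentSimpleSystem ρ C Δ)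
include hdiag hΔ

/-- `(𝔤 ⊗ A)^Γ` is spanned by triangular elements. -/
theorem span_elements : Submodule.span ℂ
    (posElements ρ τ Δ ∪ cartanElements ρ τ C ∪ negElements ρ τ Δ) = ⊤ := by
  have := Fintype.ofFinite Γ
  let S : Set (g ⊗[ℂ] A) := {z | ∃ x ∈ triangularVectors Δ, ∃ a : A, z = x ⊗ₜ[ℂ] a}
  have hS : Submodule.span ℂ S = ⊤ := by
    have h1 : ∀ a : A, (⊤ : Submodule ℂ g) ≤
        (Submodule.span ℂ S).comap ((TensorProduct.mk ℂ g A).flip a) := fun a => by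
      rw [← span_triangularVectors hdiag hΔ]
      exact Submodule.span_le.2 fun x hx => Submodule.subset_span ⟨x, hx, a, rfl⟩
    rw [← top_le_iff, ← TensorProduct.span_tmul_eq_top]
    exact Submodule.span_le.2 (by rintro _ ⟨x, a, rfl⟩; exact h1 a trivial)
  have h1 := fixed_span (mapAction ρ τ) hS
  have h2 : reynolds (mapAction ρ τ) '' S ⊆ (equivariantMap ρ τ).toSubmodule := by
    rintro _ ⟨x, -, rfl⟩; exact reynolds_mem _ x
  rw [← top_le_iff, ← span_preimage_subtype h2 h1]
  refine Submodule.span_mono ?_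
  rintro y ⟨_, ⟨x, hx, a, rfl⟩, hxy⟩
  have hN : ∀ N : Submodule ℂ g, (∀ γ, ∀ x ∈ N, ρ.toHom γ x ∈ N) → x ∈ N →
      (y : g ⊗[ℂ] A) ∈ tensorSub A N := fun N hN hx => by
    rw [← hxy]
    exact reynolds_stable _ (fun γ z => map_tensorSub hN γ) (tmul_mem_tensorSub A hx a)
  have hd : ∀ d, x ∈ part g d → y ∈ part (EqMap ρ τ) d := fun d hx => by
    have : (y : g ⊗[ℂ] A) ∈ tensorSub A (part g d) := hN _ (fun γ => ρ.map_part γ d) hx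
    exact this
  have hw : ∀ ν : Weight ρ C, x ∈ wtSpace (adCartan ρ C) ν → IsWeightElement ρ τ ν y :=
    fun ν hx => isWeightElement_of_mem (hN _ (fun γ y hy => map_mem_wtSpace hy γ) hx)
  rcases hx with (⟨h3, ⟨d, h4⟩, ν, hν, h5⟩ | hx) | ⟨h3, ⟨d, h4⟩, ν, hν, h5⟩
  · exact Or.inl (Or.inl ⟨hN _ (fun γ y => map_nPos hdiag γ) h3, ⟨d, hd d h4⟩, ν, hν, hw _ h5⟩)
  · exact Or.inl (Or.inr (hN _ (fun γ y => map_cartan hdiag γ) hx))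
  · exact Or.inr ⟨hN _ (fun γ y => map_nNeg hdiag γ) h3, ⟨d, hd d h4⟩, ν, hν, hw _ h5⟩

/-- `(𝔫⁺ ⊗ A)^Γ` is spanned by homogeneous weight vectors of positive weight. -/
theorem mem_span_posElements {z : EqMap ρ τ} (hz : (z : g ⊗[ℂ] A) ∈ tensorSub A C.nPos) :
    z ∈ Submodule.span ℂ (posElements ρ τ Δ) := by
  have := Fintype.ofFinite Γ
  let R : g ⊗[ℂ] A →ₗ[ℂ] EqMap ρ τ :=
    (reynolds (mapAction ρ τ)).codRestrict (equivariantMap ρ τ).toSubmodule (reynolds_mem _)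
  have hR : R z = z := Subtype.ext (reynolds_eq _ z.2)
  have h1 : ∀ a : A, C.nPos ≤ ((Submodule.span ℂ (posElements ρ τ Δ)).comap R).comap
      ((TensorProduct.mk ℂ g A).flip a) := by
    intro a
    have h1 := lieSpan_le_span_wtSpace (ρ := ρ) (C := C) (F := C.e) (P := posWeights Δ)
      (fun i => ⟨_, C.e_mem i⟩)
      (fun p hp q hq => hΔ.add_mem_posWeights hp hq.1)
      (fun i => ⟨_, hΔ.simpleWeight_mem hdiag i, e_mem_wtSpace ρ C i⟩)
    refine h1.trans (Submodule.span_le.2 ?_)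
    rintro x ⟨h3, ⟨d, h4⟩, ν, hν, h5⟩
    refine Submodule.subset_span ?_
    have hN : ∀ N : Submodule ℂ g, (∀ γ, ∀ x ∈ N, ρ.toHom γ x ∈ N) → x ∈ N →
        (R (x ⊗ₜ[ℂ] a) : g ⊗[ℂ] A) ∈ tensorSub A N := fun N hN hx =>
      reynolds_stable _ (fun γ z => map_tensorSub hN γ) (tmul_mem_tensorSub A hx a)
    have hd : (R (x ⊗ₜ[ℂ] a) : g ⊗[ℂ] A) ∈ tensorSub A (part g d) :=
      hN _ (fun γ => ρ.map_part γ d) h4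
    exact ⟨hN _ (fun γ y => map_nPos hdiag γ) h3, ⟨d, hd⟩, ν, hν,
      isWeightElement_of_mem (hN _ (fun γ y hy => map_mem_wtSpace hy γ) h5)⟩
  rw [← hR]
  exact tensorSub_le (P := (Submodule.span ℂ (posElements ρ τ Δ)).comap R) A
    (fun x hx a => h1 a hx) hz

end MapWeights

end TwistedWeyl
end

noncomputable section

namespace TwistedWeyl

/-! ### The even part of a Lie superalgebra -/

section EvenPart

variable (L : Type*) [AddCommGroup L] [Module ℂ L] [SuperSpace L] [LieSuperalgebra L]

/-- The even part of a Lie superalgebra, a Lie algebra. -/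
abbrev EvenPart : Type _ := part L 0

variable {L}

instance : Bracket (EvenPart L) (EvenPart L) where
  bracket x y := ⟨br (x : L) (y : L), by
    simpa using LieSuperalgebra.bracket_mem (L := L) x.2 y.2⟩

theorem coe_lie_evenPart (x y : EvenPart L) : ((⁅x, y⁆ : EvenPart L) : L) = br (x : L) (y : L) :=
  rfl

instance : LieRing (EvenPart L) where
  add_lie x y z := Subtype.ext (by simp [coe_lie_evenPart, br])
  lie_add x y z := Subtype.ext (by simp [coe_lie_evenPart, br])
  lie_self x := Subtype.ext (two_smul_cancel (br_skew_even x.2 x))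
  leibniz_lie x y z := Subtype.ext (br_br_even x.2 y z)

instance : LieAlgebra ℂ (EvenPart L) where
  lie_smul c x y := Subtype.ext (by simp [coe_lie_evenPart, br])

theorem act_br_even {V : Type*} [AddCommGroup V] [Module ℂ V] [SuperSpace V] [LieSupermodule L V]
    {x : L} (hx : x ∈ part L 0) (y : L) (v : V) :
    act (br x y) v = act x (act y v) - act y (act x v) := by
  obtain ⟨a, ha, b, hb, rfl⟩ := exists_add_eq y
  have h1 := LieSupermodule.act_bracket hx ha v
  have h2 := LieSupermodule.act_bracket hx hb v
  rw [koszul_zero_left, one_smul] at h1 h2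
  simp only [br, act, map_add, LinearMap.add_apply] at *
  rw [h1, h2]; abel

/-- The action of the even part of `L'` on an `L`-module, for a homomorphism `L' → L`. -/
def evenRep {L' : Type*} [AddCommGroup L'] [Module ℂ L'] [SuperSpace L'] [LieSuperalgebra L']
    (φ : LieSuperHom L' L) (V : Type*) [AddCommGroup V] [Module ℂ V] [SuperSpace V]
    [LieSupermodule L V] : LieRep (EvenPart L') V where
  toLin := LieSupermodule.act ∘ₗ φ.toLinearMap ∘ₗ (part L' 0).subtype
  map_lie z z' := LinearMap.ext fun v => by
    have h1 := act_br_even (φ.map_part 0 _ z.2) (φ.toLinearMap z') v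
    have h2 : φ.toLinearMap (br (z : L') (z' : L')) = br (φ.toLinearMap z) (φ.toLinearMap z') :=
      φ.map_bracket _ _
    change act (φ.toLinearMap (br (z : L') (z' : L'))) v = _
    rw [h2]
    exact h1

variable (L) in
/-- The adjoint action of the even part. -/
def evenAd : LieRep (EvenPart L) L where
  toLin := LieSuperalgebra.bracket ∘ₗ (part L 0).subtype
  map_lie z z' := LinearMap.ext fun v => eq_sub_of_add_eq (br_br_even z.2 z' v).symm

end EvenPart

/-! ### Coordinates and traces of diagonal operators. -/

theorem repr_eq_zero_of_wtSpace {V T ι : Type*} [AddCommGroup V] [Module ℂ V] [AddCommGroup T]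
    [Module ℂ T] [Fintype ι] {a : T →ₗ[ℂ] Module.End ℂ V} (b : Module.Basis ι ℂ V)
    {η : ι → Module.Dual ℂ T} (hb : ∀ k, b k ∈ wtSpace a (η k)) {ν : Module.Dual ℂ T} {v : V}
    (hv : v ∈ wtSpace a ν) {k : ι} (hk : η k ≠ ν) : b.repr v k = 0 := by
  obtain ⟨h, hh⟩ : ∃ h, η k h ≠ ν h := by
    by_contra! hc; exact hk (LinearMap.ext hc)
  have h1 : ∀ v : V, b.repr (a h v) k = η k h * b.repr v k := by
    intro v
    conv_lhs => rw [← b.sum_repr v]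
    simp only [map_sum, map_smul, mem_wtSpace.1 (hb _), Module.Basis.repr_self,
      Finsupp.finsetSum_apply, Finsupp.smul_apply, smul_eq_mul]
    rw [Finset.sum_eq_single k]
    · simp [mul_comm]
    · intro l _ hl; simp [hl]
    · simp
  have h2 := h1 v
  rw [mem_wtSpace.1 hv h, map_smul, Finsupp.smul_apply, smul_eq_mul] at h2
  have h3 : (η k h - ν h) * b.repr v k = 0 := by rw [sub_mul, h2]; ring
  exact (mul_eq_zero.1 h3).resolve_left (sub_ne_zero.2 hh)

theorem trace_eq_sum_of_diagonal {V ι : Type*} [AddCommGroup V] [Module ℂ V] [Fintype ι]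
    (b : Module.Basis ι ℂ V) {f : Module.End ℂ V} {c : ι → ℂ} (hf : ∀ k, f (b k) = c k • b k) :
    LinearMap.trace ℂ V f = ∑ k, c k := by
  classical
  rw [LinearMap.trace_eq_matrix_trace ℂ b]
  refine Finset.sum_congr rfl fun k _ => ?_
  rw [Matrix.diag_apply, LinearMap.toMatrix_apply, hf, map_smul, Module.Basis.repr_self]
  simp

/-- If `[e, f] = h` commutes with `e` and `f`, then all eigenvalues of `h` vanish. -/
theorem eigenvalue_eq_zero_of_commute {V : Type*} [AddCommGroup V] [Module ℂ V]
    [FiniteDimensional ℂ V] {e f h : Module.End ℂ V} (hef : e * f - f * e = h)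
    (he : h * e = e * h) (hf : h * f = f * h) {c : ℂ} {v : V} (hv : h v = c • v) (hv0 : v ≠ 0) :
    c = 0 := by
  let E := Module.End.eigenspace h c
  have hE : ∀ k : Module.End ℂ V, h * k = k * h → ∀ x ∈ E, k x ∈ E := by
    intro k hk x hx
    rw [Module.End.mem_eigenspace_iff] at *
    have := DFunLike.congr_fun hk x
    simp only [Module.End.mul_apply] at this
    rw [this, hx, map_smul]
  let X : Module.End ℂ E := e.restrict (hE e he)
  let Y : Module.End ℂ E := f.restrict (hE f hf)
  -- On the c-eigenspace of h the commutator is the scalar c. Its trace is both 0 and c times the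
  -- dimension.
  have h1 : X * Y - Y * X = c • 1 := by
    ext x
    have hx := Module.End.mem_eigenspace_iff.1 x.2
    rw [← hef] at hx
    exact hx
  have h2 := congrArg (LinearMap.trace ℂ E) h1
  rw [map_sub, LinearMap.trace_mul_comm, sub_self, map_smul, LinearMap.trace_one, smul_eq_mul,
    eq_comm, mul_eq_zero] at h2
  refine h2.resolve_right fun h3 => hv0 ?_
  have h4 : Module.finrank ℂ E = 0 := by exact_mod_cast h3
  have h5 := Submodule.finrank_eq_zero.1 h4
  have h6 : v ∈ E := Module.End.mem_eigenspace_iff.2 hv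
  rw [h5] at h6
  exact (Submodule.mem_bot ℂ).1 h6

/-! ### Lie superalgebras with a root decomposition -/

/-- A root decomposition of a Lie superalgebra that has trivial center and a nondegenerate
invariant form. -/
structure RootDecomposition (L T : Type*) [AddCommGroup L] [Module ℂ L] [SuperSpace L]
    [LieSuperalgebra L] [AddCommGroup T] [Module ℂ T] where
  j : T →ₗ[ℂ] L
  j_even : ∀ h, j h ∈ part L 0
  j_injective : Function.Injective j
  br_j : ∀ h h' : T, br (j h : L) (j h') = 0
  Qp : AddSubmonoid (Module.Dual ℂ T)
  ht : Module.Dual ℂ T →ₗ[ℂ] ℂ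
  ht_Qp : ∀ q ∈ Qp, ∃ n : ℕ, ht q = n ∧ (n = 0 → q = 0)
  -- Conjugation of coordinates makes it possible to test the trace form on the Cartan subalgebra by
  -- a sum of squared absolute values.
  exists_conj : ∀ t, ∃ t', ∀ q ∈ Qp, q t' = starRingEnd ℂ (q t)
  S : Set L
  S_homogeneous : ∀ s ∈ S, ∃ d, s ∈ part L d
  S_weight : ∀ s ∈ S, (∃ h, j h = s) ∨
    ∃ ν : Module.Dual ℂ T, (ν ∈ Qp ∨ -ν ∈ Qp) ∧ ν ≠ 0 ∧ ∀ h, br (j h) s = ν h • s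
  S_span : Submodule.span ℂ S = ⊤
  center : ∀ x : L, (∀ y, br x y = 0) → x = 0
  B : LinearMap.BilinForm ℂ L
  B_even : ∀ x ∈ part L 0, ∀ y ∈ part L 1, B x y = 0
  B_inv : ∀ x y z : L, B (br x y) z = B x (br y z)
  B_nondegenerate : ∀ x : L, (∀ y, B x y = 0) → x = 0

namespace RootDecomposition

variable {L T : Type*} [AddCommGroup L] [Module ℂ L] [SuperSpace L] [LieSuperalgebra L]
  [AddCommGroup T] [Module ℂ T] (R : RootDecomposition L T)

/-- The adjoint action of the Cartan subalgebra. -/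
def cartanAd : T →ₗ[ℂ] Module.End ℂ L := LieSuperalgebra.bracket ∘ₗ R.j

/-- The Cartan subalgebra as a subspace of the even part. -/
def jEven : T →ₗ[ℂ] EvenPart L := R.j.codRestrict (part L 0) R.j_even

theorem coe_jEven (h : T) : (R.jEven h : L) = R.j h := rfl

theorem mem_wtSpace_cartanAd {x : L} {ν : Module.Dual ℂ T} :
    x ∈ wtSpace R.cartanAd ν ↔ ∀ h, br (R.j h) x = ν h • x := Iff.rfl

theorem exists_weight {s : L} (hs : s ∈ R.S) : ∃ ν : Module.Dual ℂ T,
    (ν ∈ R.Qp ∨ -ν ∈ R.Qp) ∧ s ∈ wtSpace R.cartanAd ν ∧ (ν = 0 → ∃ h, R.j h = s) := by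
  rcases R.S_weight s hs with ⟨h, rfl⟩ | ⟨ν, h1, h2, h3⟩
  · exact ⟨0, Or.inl (zero_mem _), fun h' => by
      rw [LinearMap.zero_apply, zero_smul]; exact R.br_j _ _, fun _ => ⟨h, rfl⟩⟩
  · exact ⟨ν, h1, h3, fun h => absurd h h2⟩

/-- The even elements of the spanning set span the even part. -/
theorem span_even : Submodule.span ℂ {z : EvenPart L | (z : L) ∈ R.S} = ⊤ := by
  have h2 : R.S ∩ part L 0 ⊆ part L 0 := Set.inter_subset_right
  have h1 : part L 0 ≤ Submodule.span ℂ (R.S ∩ part L 0) := by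
    let P : L →ₗ[ℂ] L := (2⁻¹ : ℂ) • (LinearMap.id + parity L)
    have hP : (⊤ : Submodule ℂ L) ≤ (Submodule.span ℂ (R.S ∩ part L 0)).comap P := by
      rw [← R.S_span]
      refine Submodule.span_le.2 fun s hs => ?_
      change P s ∈ Submodule.span ℂ (R.S ∩ part L 0)
      obtain ⟨d, hd⟩ := R.S_homogeneous s hs
      have hd2 : ∀ k : ZMod 2, k = 0 ∨ k = 1 := by decide
      have hv : (1 : ZMod 2).val = 1 := by decide
      rcases hd2 d with rfl | rfl
      · have : P s = s := by
          simp only [P, LinearMap.smul_apply, LinearMap.add_apply, parity_of_mem hd,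
            LinearMap.id_apply, ZMod.val_zero]
          module
        rw [this]; exact Submodule.subset_span ⟨hs, hd⟩
      · have : P s = 0 := by
          simp only [P, LinearMap.smul_apply, LinearMap.add_apply, parity_of_mem hd,
            LinearMap.id_apply, hv]
          module
        rw [this]; exact Submodule.zero_mem _
    intro x hx
    have : P x = x := by
      simp only [P, LinearMap.smul_apply, LinearMap.add_apply, parity_of_mem hx,
        LinearMap.id_apply, ZMod.val_zero]
      module
    rw [← this]; exact hP trivial
  rw [← top_le_iff, ← span_preimage_subtype h2 h1]
  exact Submodule.span_mono fun x hx => hx.1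

theorem exists_basis [FiniteDimensional ℂ L] : ∃ (ι : Set L) (_ : Fintype ι)
    (b : Module.Basis ι ℂ L), ∀ i, b i ∈ R.S := by
  refine ⟨_, FiniteDimensional.fintypeBasisIndex (Module.Basis.ofSpan R.S_span.ge),
    Module.Basis.ofSpan R.S_span.ge, fun i => Module.Basis.ofSpan_subset R.S_span.ge ⟨i, rfl⟩⟩

theorem exists_basis_even [FiniteDimensional ℂ L] : ∃ (ι : Set (EvenPart L)) (_ : Fintype ι)
    (b : Module.Basis ι ℂ (EvenPart L)), ∀ i, (b i : L) ∈ R.S :=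
  ⟨_, FiniteDimensional.fintypeBasisIndex (Module.Basis.ofSpan R.span_even.ge),
    Module.Basis.ofSpan R.span_even.ge, fun i => Module.Basis.ofSpan_subset R.span_even.ge ⟨i, rfl⟩⟩

theorem br_mem_wtSpace {x y : L} {μ ν : Module.Dual ℂ T} (hx : x ∈ wtSpace R.cartanAd μ)
    (hy : y ∈ wtSpace R.cartanAd ν) : br x y ∈ wtSpace R.cartanAd (μ + ν) := by
  rw [mem_wtSpace_cartanAd] at *
  intro h
  rw [br_br_even (R.j_even h), hx, hy]
  simp only [br, map_smul, LinearMap.smul_apply, LinearMap.add_apply]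
  module

section Basis

variable {J : Type*} (b : Module.Basis J ℂ L) (hb : ∀ k, b k ∈ R.S)
  {η : J → Module.Dual ℂ T} (hη : ∀ k, b k ∈ wtSpace R.cartanAd (η k))

include hη

/-- An element of the Cartan subalgebra on which all weights vanish is central, and the center is
trivial. -/
theorem eq_zero_of_weights {t : T} (h : ∀ k, η k t = 0) : t = 0 := by
  refine R.j_injective ?_
  rw [map_zero]
  refine R.center _ fun y => ?_
  have : LieSuperalgebra.bracket (R.j t) = 0 := b.ext fun k => by
    have := R.mem_wtSpace_cartanAd.1 (hη k) t
    rw [h, zero_smul] at this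
    exact this
  rw [br, this, LinearMap.zero_apply]

theorem B_eq_zero {x : L} {α : Module.Dual ℂ T} (hx : x ∈ wtSpace R.cartanAd α) {k : J}
    (hk : R.B x (b k) ≠ 0) : η k = -α := by
  ext h
  have h1 : R.B (br x (R.j h)) (b k) = R.B x (br (R.j h) (b k)) := R.B_inv _ _ _
  have h2 : br x (R.j h) = -(α h • x) := by
    rw [← R.mem_wtSpace_cartanAd.1 hx, br_skew_even (R.j_even h), neg_neg]
  rw [h2, R.mem_wtSpace_cartanAd.1 (hη k), map_neg, map_smul, map_smul, LinearMap.neg_apply,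
    LinearMap.smul_apply, smul_eq_mul, smul_eq_mul, ← neg_mul] at h1
  exact (mul_right_cancel₀ hk h1).symm

include hb

variable [Fintype J]

theorem exists_j_eq {x : L} (hx : x ∈ wtSpace R.cartanAd 0) : ∃ h, R.j h = x := by
  change x ∈ LinearMap.range R.j
  rw [← b.sum_repr x]
  refine Submodule.sum_mem _ fun k _ => ?_
  by_cases hk : η k = 0
  · refine Submodule.smul_mem _ _ ?_
    obtain ⟨ν, -, h2, h3⟩ := R.exists_weight (hb k)
    refine h3 ?_
    have := mem_of_mem_iSup_wtSpace (P := {η k}) h2 (b.ne_zero k) (by simpa using hη k)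
    rw [Set.mem_singleton_iff.1 this, hk]
  · rw [repr_eq_zero_of_wtSpace b hη hx hk, zero_smul]; exact Submodule.zero_mem _

/-- Every even root vector is part of an `𝔰𝔩₂`-triple. -/
theorem exists_triple [FiniteDimensional ℂ L] {x : EvenPart L} (hx0 : x ≠ 0)
    {α : Module.Dual ℂ T} (hα : α ≠ 0) (hx : (x : L) ∈ wtSpace R.cartanAd α) :
    ∃ (y : EvenPart L) (t : T), (y : L) ∈ wtSpace R.cartanAd (-α) ∧ ⁅x, y⁆ = R.jEven t ∧
      α t = 2 := by
  obtain ⟨k, hk⟩ : ∃ k, R.B x (b k) ≠ 0 := by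
    by_contra! hc
    refine hx0 (Subtype.ext (R.B_nondegenerate _ fun y => ?_))
    have : R.B x = 0 := b.ext hc
    rw [this, LinearMap.zero_apply]
  have hkα := R.B_eq_zero b hη hx hk
  have hkeven : b k ∈ part L 0 := by
    obtain ⟨d, hd⟩ := R.S_homogeneous _ (hb k)
    have hd2 : ∀ k : ZMod 2, k = 0 ∨ k = 1 := by decide
    rcases hd2 d with rfl | rfl
    · exact hd
    · exact absurd (R.B_even _ x.2 _ hd) hk
  let y : EvenPart L := ⟨b k, hkeven⟩
  have hy : (y : L) ∈ wtSpace R.cartanAd (-α) := by rw [← hkα]; exact hη k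
  obtain ⟨t, ht⟩ := R.exists_j_eq b hb hη (by simpa using R.br_mem_wtSpace hx hy)
  have hxy : ⁅x, y⁆ = R.jEven t := Subtype.ext ht.symm
  -- By invariance, B([x, y], h) = α(h) B(x, y) with B(x, y) ≠ 0, so [x, y] = 0 would force α = 0.
  have ht0 : t ≠ 0 := by
    rintro rfl
    refine hα (LinearMap.ext fun h => ?_)
    have h1 : R.B (br (x : L) (y : L)) (R.j h) = R.B x (br (y : L) (R.j h)) := R.B_inv _ _ _
    rw [← ht, map_zero, map_zero, LinearMap.zero_apply, br_skew_even y.2,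
      R.mem_wtSpace_cartanAd.1 hy, LinearMap.neg_apply, neg_smul, neg_neg, map_smul, smul_eq_mul,
      eq_comm] at h1
    exact (mul_eq_zero.1 h1).resolve_right hk
  -- If α(t) = 0, then t = [x, y] commutes with x and y. A trace argument makes all its eigenvalues
  -- on L vanish, so t would be zero. Hence y and t can be rescaled by 2 / α(t).
  have hαt : α t ≠ 0 := by
    intro h0
    refine ht0 (R.eq_zero_of_weights b hη fun l => ?_)
    have h1 : ⁅R.jEven t, x⁆ = 0 := Subtype.ext (by
      rw [coe_lie_evenPart, coe_jEven, R.mem_wtSpace_cartanAd.1 hx, h0, zero_smul]; rfl)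
    have h2 : ⁅R.jEven t, y⁆ = 0 := Subtype.ext (by
      rw [coe_lie_evenPart, coe_jEven, R.mem_wtSpace_cartanAd.1 hy, LinearMap.neg_apply, h0,
        neg_zero, zero_smul]; rfl)
    have h3 := (evenAd L).map_lie x y
    have h4 := (evenAd L).map_lie (R.jEven t) x
    have h5 := (evenAd L).map_lie (R.jEven t) y
    rw [h1, map_zero, eq_comm, sub_eq_zero] at h4
    rw [h2, map_zero, eq_comm, sub_eq_zero] at h5
    rw [hxy] at h3
    exact eigenvalue_eq_zero_of_commute h3.symm h4 h5 (R.mem_wtSpace_cartanAd.1 (hη l) t)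
      (b.ne_zero l)
  refine ⟨(2 / α t) • y, (2 / α t) • t, Submodule.smul_mem _ _ hy, ?_, ?_⟩
  · rw [lie_smul, hxy, map_smul]
  · rw [map_smul, smul_eq_mul, div_mul_cancel₀ _ hαt]

end Basis

theorem lie_jEven {x : EvenPart L} {α : Module.Dual ℂ T} (hx : (x : L) ∈ wtSpace R.cartanAd α)
    (h : T) : ⁅R.jEven h, x⁆ = α h • x :=
  Subtype.ext (R.mem_wtSpace_cartanAd.1 hx h)

theorem isSl2_evenAd {x y : EvenPart L} {t : T} {α : Module.Dual ℂ T}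
    (hx : (x : L) ∈ wtSpace R.cartanAd α) (hy : (y : L) ∈ wtSpace R.cartanAd (-α))
    (hxy : ⁅x, y⁆ = R.jEven t) (hα : α t = 2) {V : Type*} [AddCommGroup V] [Module ℂ V]
    (φ : LieRep (EvenPart L) V) : IsSl2 (φ x) (φ y) (φ (R.jEven t)) where
  e_f := by rw [← φ.map_lie, hxy]
  h_e := by rw [← φ.map_lie, R.lie_jEven hx, hα, map_smul]
  h_f := by rw [← φ.map_lie, R.lie_jEven hy, LinearMap.neg_apply, hα, neg_smul, map_neg, map_smul]

theorem exists_int_of_triple [FiniteDimensional ℂ L] {x y : EvenPart L} {t : T}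
    {α : Module.Dual ℂ T} (hx : (x : L) ∈ wtSpace R.cartanAd α)
    (hy : (y : L) ∈ wtSpace R.cartanAd (-α)) (hxy : ⁅x, y⁆ = R.jEven t) (hα : α t = 2)
    {u : L} (hu0 : u ≠ 0) {η : Module.Dual ℂ T} (hu : u ∈ wtSpace R.cartanAd η) :
    ∃ n : ℤ, η t = n := by
  have H := R.isSl2_evenAd hx hy hxy hα (evenAd L)
  obtain ⟨p, hp⟩ := exists_pow_eq_zero two_ne_zero H.h_e ⊤ (by simp) (by simp)
  obtain ⟨q, hq⟩ := exists_pow_eq_zero (neg_ne_zero.2 two_ne_zero)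
    (H.h_f.trans (neg_smul _ _).symm) ⊤ (by simp) (by simp)
  exact H.exists_int hu0 (R.mem_wtSpace_cartanAd.1 hu t) (hp u trivial) (hq u trivial)

/-- The trace form of the adjoint action of the even part. -/
def traceForm (L : Type*) [AddCommGroup L] [Module ℂ L] [SuperSpace L] [LieSuperalgebra L] :
    LinearMap.BilinForm ℂ (EvenPart L) :=
  LinearMap.mk₂ ℂ (fun x y => LinearMap.trace ℂ L (evenAd L x * evenAd L y))
    (by intros; simp [add_mul]) (by intros; simp) (by intros; simp [mul_add]) (by intros; simp)

theorem traceForm_apply (x y : EvenPart L) :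
    traceForm L x y = LinearMap.trace ℂ L (evenAd L x * evenAd L y) := rfl

theorem traceForm_symm (x y : EvenPart L) : traceForm L x y = traceForm L y x :=
  LinearMap.trace_mul_comm _ _ _

theorem traceForm_lie (x y z : EvenPart L) : traceForm L ⁅x, y⁆ z = traceForm L x ⁅y, z⁆ := by
  simp only [traceForm_apply, LieRep.map_lie, sub_mul, mul_sub, map_sub]
  congr 1
  rw [mul_assoc, LinearMap.trace_mul_comm, mul_assoc]

theorem traceForm_j {J : Type*} [Fintype J] (b : Module.Basis J ℂ L) {η : J → Module.Dual ℂ T}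
    (hη : ∀ k, b k ∈ wtSpace R.cartanAd (η k)) (h h' : T) :
    traceForm L (R.jEven h) (R.jEven h') = ∑ k, η k h * η k h' :=
  trace_eq_sum_of_diagonal b fun k => by
    have h1 : evenAd L (R.jEven h) (b k) = _ := R.mem_wtSpace_cartanAd.1 (hη k) h
    have h2 : evenAd L (R.jEven h') (b k) = _ := R.mem_wtSpace_cartanAd.1 (hη k) h'
    rw [Module.End.mul_apply, h2, map_smul, h1, smul_smul, mul_comm]

/-- The action of the Cartan subalgebra on the even part. -/
def cartanEven : T →ₗ[ℂ] Module.End ℂ (EvenPart L) := (LieRep.ad (EvenPart L)).toLin ∘ₗ R.jEven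

theorem mem_wtSpace_cartanEven {x : EvenPart L} {ν : Module.Dual ℂ T} :
    x ∈ wtSpace R.cartanEven ν ↔ (x : L) ∈ wtSpace R.cartanAd ν :=
  forall_congr' fun _ => Subtype.ext_iff

/-- The radical is stable under the Cartan subalgebra, so it suffices to treat weight vectors in it.
For an element t of the Cartan subalgebra, pairing with its conjugate gives the sum of |η_k(t)|².
For a root vector x with triple (x, y, h), invariance makes (h, h) vanish, but this is the sum of
the squares of the integers η_k(h). In both cases the Cartan element is zero; for a root vector this
contradicts α(h) = 2. -/
theorem traceForm_nondegenerate (R : RootDecomposition L T) [FiniteDimensional ℂ L] : (traceForm L).Nondegenerate := by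
  obtain ⟨J, _, b, hb⟩ := R.exists_basis
  obtain ⟨ι, _, b₀, hb₀⟩ := R.exists_basis_even
  choose η hη1 hη2 hη3 using fun k => R.exists_weight (hb k)
  choose ω _ hω2 _ using fun k => R.exists_weight (hb₀ k)
  have hω2' : ∀ k, b₀ k ∈ wtSpace R.cartanEven (ω k) := fun k =>
    R.mem_wtSpace_cartanEven.2 (hω2 k)
  let N : Submodule ℂ (EvenPart L) := LinearMap.ker (traceForm L)
  have hNw : ∀ ν, ∀ x ∈ N, x ∈ wtSpace R.cartanEven ν → x = 0 := by
    intro ν x hxN hx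
    have hxN' : ∀ z, traceForm L x z = 0 := fun z => by
      rw [LinearMap.mem_ker.1 hxN, LinearMap.zero_apply]
    rw [R.mem_wtSpace_cartanEven] at hx
    by_cases hν : ν = 0
    · subst hν
      obtain ⟨t, ht⟩ := R.exists_j_eq b hb hη2 hx
      have hx' : x = R.jEven t := Subtype.ext ht.symm
      obtain ⟨t', ht'⟩ := R.exists_conj t
      have h1 : ∀ k, η k t' = starRingEnd ℂ (η k t) := fun k => by
        rcases hη1 k with h | h
        · exact ht' _ h
        · have := ht' _ h
          rw [LinearMap.neg_apply, LinearMap.neg_apply, map_neg, neg_inj] at this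
          exact this
      have h2 := hxN' (R.jEven t')
      rw [hx', R.traceForm_j b hη2] at h2
      have h3 : ∑ k, Complex.normSq (η k t) = 0 := by
        have : ((∑ k, Complex.normSq (η k t) : ℝ) : ℂ) = 0 := by
          rw [← h2, Complex.ofReal_sum]
          exact Finset.sum_congr rfl fun k _ => by rw [h1, Complex.mul_conj]
        exact_mod_cast this
      have h4 : t = 0 := R.eq_zero_of_weights b hη2 fun k =>
        Complex.normSq_eq_zero.1 ((Finset.sum_eq_zero_iff_of_nonneg fun k _ =>
          Complex.normSq_nonneg _).1 h3 k (Finset.mem_univ k))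
      rw [hx', h4, map_zero]
    · by_contra hx0
      obtain ⟨y, t, hy, hxy, hαt⟩ := R.exists_triple b hb hη2 hx0 hν hx
      choose m hm using fun k => R.exists_int_of_triple hx hy hxy hαt (b.ne_zero k) (hη2 k)
      have h1 : traceForm L (R.jEven t) (R.jEven t) = 0 := by
        rw [← hxy, traceForm_lie, hxN']
      rw [R.traceForm_j b hη2] at h1
      have h2 : ∑ k, m k * m k = 0 := by
        have : ((∑ k, m k * m k : ℤ) : ℂ) = 0 := by
          rw [← h1]; push_cast
          exact Finset.sum_congr rfl fun k _ => by rw [hm]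
        exact_mod_cast this
      have h3 : t = 0 := R.eq_zero_of_weights b hη2 fun k => by
        have := (Finset.sum_eq_zero_iff_of_nonneg fun k _ => mul_self_nonneg (m k)).1 h2 k
          (Finset.mem_univ k)
        rw [hm, mul_self_eq_zero.1 this, Int.cast_zero]
      rw [h3, map_zero] at hαt
      exact two_ne_zero hαt.symm
  have hNst : ∀ h, ∀ x ∈ N, R.cartanEven h x ∈ N := by
    intro h x hx
    refine LinearMap.mem_ker.2 (LinearMap.ext fun z => ?_)
    change traceForm L ⁅R.jEven h, x⁆ z = 0
    rw [← lie_skew, map_neg, LinearMap.neg_apply, traceForm_lie, LinearMap.mem_ker.1 hx,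
      LinearMap.zero_apply, neg_zero]
  have hN : N = ⊥ := by
    rw [eq_bot_iff]
    have h1 : N ≤ ⨆ ν ∈ Set.univ, wtSpace R.cartanEven ν := fun x _ => by
      rw [← b₀.sum_repr x]
      exact Submodule.sum_mem _ fun k _ => Submodule.smul_mem _ _
        (le_iSup₂ (f := fun ν (_ : ν ∈ Set.univ) => wtSpace R.cartanEven ν) (ω k) trivial (hω2' k))
    refine (le_iSup_inf_wtSpace hNst h1).trans (iSup₂_le fun ν _ x hx => ?_)
    exact (Submodule.mem_bot ℂ).2 (hNw ν x hx.1 hx.2)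
  have hl : (traceForm L).SeparatingLeft := fun x hx => by
    have : x ∈ N := LinearMap.mem_ker.2 (LinearMap.ext hx)
    rw [hN] at this
    exact (Submodule.mem_bot ℂ).1 this
  exact ⟨hl, fun x hx => hl x fun y => by rw [traceForm_symm]; exact hx y⟩

/-- The even part of a Lie superalgebra with a root decomposition is reductive. -/
theorem exists_splitReductive [FiniteDimensional ℂ L] : ∃ (ι : Set (EvenPart L)) (_ : Fintype ι)
    (J : Set L) (_ : Fintype J) (D : SplitReductive (EvenPart L) T ι J),
    D.j = R.jEven ∧ D.Qp = R.Qp ∧ D.ht = R.ht := by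
  classical
  obtain ⟨J, _, b, hb⟩ := R.exists_basis
  obtain ⟨ι, _, b₀, hb₀⟩ := R.exists_basis_even
  choose η hη1 hη2 hη3 using fun k => R.exists_weight (hb k)
  choose ω hω1 hω2 hω3 using fun k => R.exists_weight (hb₀ k)
  have htr : ∀ i, ∃ (y : EvenPart L) (t : T), ω i ≠ 0 → (y : L) ∈ wtSpace R.cartanAd (-ω i) ∧
      ⁅b₀ i, y⁆ = R.jEven t ∧ ω i t = 2 := fun i => by
    by_cases h : ω i = 0
    · exact ⟨0, 0, fun h' => absurd h h'⟩
    · obtain ⟨y, t, h1⟩ := R.exists_triple b hb hη2 (b₀.ne_zero i) h (hω2 i)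
      exact ⟨y, t, fun _ => h1⟩
  choose y t hyt using htr
  refine ⟨ι, inferInstance, J, inferInstance,
    { j := R.jEven
      j_injective := fun h h' hh => R.j_injective (congrArg Subtype.val hh)
      lie_j := fun h h' => Subtype.ext (R.br_j h h')
      b := b₀
      wt := ω
      lie_b := fun h i => R.lie_jEven (hω2 i) h
      mem_range_j := fun i hi => by
        obtain ⟨h, hh⟩ := hω3 i hi
        exact ⟨h, Subtype.ext hh⟩
      Qp := R.Qp
      ht := R.ht
      ht_Qp := R.ht_Qp
      wt_mem := hω1
      κ := traceForm L
      κ_nondegenerate := R.traceForm_nondegenerate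
      κ_symm := traceForm_symm
      κ_lie := traceForm_lie
      η := η
      κ_j := R.traceForm_j b hη2
      η_sep := fun h hh => R.eq_zero_of_weights b hη2 hh
      x := b₀
      y := y
      cr := t
      lie_x := fun i _ h => R.lie_jEven (hω2 i) h
      lie_y := fun i hi h => by
        rw [R.lie_jEven (hyt i hi).1, LinearMap.neg_apply, neg_smul]
      lie_x_y := fun i hi => (hyt i hi).2.1
      wt_cr := fun i hi => (hyt i hi).2.2
      η_cr := fun i hi k => R.exists_int_of_triple (hω2 i) (hyt i hi).1 (hyt i hi).2.1
        (hyt i hi).2.2 (b.ne_zero k) (hη2 k) }, rfl, rfl, rfl⟩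

end RootDecomposition

end TwistedWeyl
end

namespace TwistedWeyl

namespace SplitReductive

variable {K T ι J : Type*} [LieRing K] [LieAlgebra ℂ K] [AddCommGroup T] [Module ℂ T] [Fintype ι]
  [Fintype J] (D : SplitReductive K T ι J)
variable {V : Type*} [AddCommGroup V] [Module ℂ V] {φ : LieRep K V}

/-! #### Locally finite weight modules -/

/-- The simple weights: positive weights that are not sums of two positive weights. -/
def Simple (i : ι) : Prop :=
  D.Pos i ∧ ¬∃ k l, D.Pos k ∧ D.Pos l ∧ D.wt i = D.wt k + D.wt l

/-- Induction on the height: a positive weight that is not simple splits into two positive weights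
of smaller height. -/
theorem wt_mem_closure_simple {i : ι} (hi : D.Pos i) :
    D.wt i ∈ AddSubmonoid.closure {q | ∃ k, D.Simple k ∧ D.wt k = q} := by
  obtain ⟨m, -, hm⟩ := D.ht_pos hi.2 hi.1
  induction m using Nat.strong_induction_on generalizing i with
  | _ m ih =>
    by_cases hs : D.Simple i
    · exact AddSubmonoid.subset_closure ⟨i, hs, rfl⟩
    · have h1 : ∃ k l, D.Pos k ∧ D.Pos l ∧ D.wt i = D.wt k + D.wt l := by
        by_contra hc; exact hs ⟨hi, hc⟩
      obtain ⟨k, l, hk, hl, hkl⟩ := h1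
      obtain ⟨a, ha, hka⟩ := D.ht_pos hk.2 hk.1
      obtain ⟨b, hb, hlb⟩ := D.ht_pos hl.2 hl.1
      have h2 : m = a + b := by
        rw [hkl, map_add, hka, hlb] at hm
        exact_mod_cast hm.symm
      rw [hkl]
      exact add_mem (ih a (by omega) hk hka) (ih b (by omega) hl hlb)

/-- The weight takes the value 2 at its own coroot and is a sum of simple weights with integral
values there, so one of these values is positive. -/
theorem exists_simple_pos {i : ι} (hi : D.Pos i) :
    ∃ k, D.Simple k ∧ ∃ m : ℕ, 0 < m ∧ D.wt k (D.cr i) = m := by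
  by_contra! hc
  have h1 : ∀ q ∈ AddSubmonoid.closure {q | ∃ k, D.Simple k ∧ D.wt k = q},
      ∃ m : ℕ, q (D.cr i) = -(m : ℂ) := by
    intro q hq
    induction hq using AddSubmonoid.closure_induction with
    | mem q hq =>
      obtain ⟨k, hk, rfl⟩ := hq
      obtain ⟨n, hn⟩ := D.exists_int_wt hi.1 k
      rcases lt_or_ge 0 n with h | h
      · lift n to ℕ using h.le
        exact absurd hn (hc k hk n (by exact_mod_cast h))
      · obtain ⟨m, rfl⟩ := Int.exists_eq_neg_ofNat h
        exact ⟨m, by rw [hn]; push_cast; rfl⟩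
    | zero => exact ⟨0, by simp⟩
    | add p q _ _ hp hq =>
      obtain ⟨a, ha⟩ := hp
      obtain ⟨b, hb⟩ := hq
      exact ⟨a + b, by rw [LinearMap.add_apply, ha, hb]; push_cast; ring⟩
  obtain ⟨m, hm⟩ := h1 _ (D.wt_mem_closure_simple hi)
  rw [D.wt_cr i hi.1] at hm
  have : ((2 + m : ℕ) : ℂ) = 0 := by push_cast; rw [hm]; ring
  have : 2 + m = 0 := by exact_mod_cast this
  omega

/-- Both Cartan integers are positive multiples of κ(cr i, cr k), so they have the same sign. -/
theorem pos_of_pos {i k : ι} (hi : D.wt i ≠ 0) (hk : D.wt k ≠ 0) {m : ℕ} (hm : 0 < m)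
    (h : D.wt k (D.cr i) = m) : ∃ n : ℕ, 0 < n ∧ D.wt i (D.cr k) = n := by
  obtain ⟨r, hr, h1⟩ := D.exists_pos_mul hi
  obtain ⟨s, hs, h2⟩ := D.exists_pos_mul hk
  obtain ⟨n, hn⟩ := D.exists_int_wt hk i
  have h3 := h1 (D.cr k)
  rw [D.κ_symm, h2, h, hn] at h3
  have h4 : s * m = r * n := by exact_mod_cast h3
  have h5 : 0 < r * n := by rw [← h4]; positivity
  have h6 : 0 < n := by
    have := (mul_pos_iff_of_pos_left hr).1 h5
    exact_mod_cast this
  lift n to ℕ using h6.le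
  exact ⟨n, by exact_mod_cast h6, by rw [hn]; simp⟩

theorem pow_mem_wts {μ ν : Module.Dual ℂ T} {z : K} (hz : z ∈ D.rts ν) {v : V}
    (hv : v ∈ D.wts φ μ) (n : ℕ) : (φ z ^ n) v ∈ D.wts φ (μ + n • ν) := by
  induction n with
  | zero => simpa using hv
  | succ n ih =>
    rw [pow_succ', Module.End.mul_apply, succ_nsmul, ← add_assoc]
    exact D.act_mem_wts hz ih

/-- The reflection of a weight at a root for which the root vectors act locally nilpotently. -/
theorem reflect_mem {i : ι} (hi : D.wt i ≠ 0) (hx : ∀ v, ∃ p : ℕ, (φ (D.x i) ^ p) v = 0)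
    (hy : ∀ v, ∃ p : ℕ, (φ (D.y i) ^ p) v = 0) {μ : Module.Dual ℂ T} (hμ : D.wts φ μ ≠ ⊥) :
    D.wts φ (μ - μ (D.cr i) • D.wt i) ≠ ⊥ := by
  obtain ⟨v, hv, hv0⟩ := Submodule.exists_mem_ne_zero_of_ne_bot hμ
  obtain ⟨p, hp⟩ := hx v
  obtain ⟨q, hq⟩ := hy v
  have hv' := (D.mem_wts φ).1 hv (D.cr i)
  obtain ⟨n, hn⟩ := (D.isSl2 φ hi).exists_int hv0 hv' hp hq
  rcases le_or_gt 0 n with h | h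
  · lift n to ℕ using h
    rw [hn] at hv'
    refine (Submodule.ne_bot_iff _).2 ⟨(φ (D.y i) ^ n) v, ?_, fun h0 => hv0 ?_⟩
    · have := D.pow_mem_wts (D.y_mem hi) hv n
      rw [hn, sub_eq_add_neg]
      convert this using 2
      rw [smul_neg, ← Nat.cast_smul_eq_nsmul ℂ]; simp
    · exact (D.isSl2 φ hi).eq_zero_of_f_pow (by simpa using hv') h0 hp
  · obtain ⟨m, rfl⟩ := Int.exists_eq_neg_ofNat h.le
    rw [hn] at hv'
    refine (Submodule.ne_bot_iff _).2 ⟨(φ (D.x i) ^ m) v, ?_, fun h0 => hv0 ?_⟩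
    · have := D.pow_mem_wts (D.x_mem hi) hv m
      rw [hn, sub_eq_add_neg]
      convert this using 2
      rw [← Nat.cast_smul_eq_nsmul ℂ]; simp
    · exact (D.isSl2 φ hi).eq_zero_of_e_pow (by simpa using hv') h0 hq

theorem reflect_wt {i k : ι} (hi : D.wt i ≠ 0) :
    ∃ l, D.wt l = D.wt k - D.wt k (D.cr i) • D.wt i := by
  have h1 : D.wts (LieRep.ad K) (D.wt k) ≠ ⊥ :=
    (Submodule.ne_bot_iff _).2 ⟨D.b k, D.b_mem k, D.b.ne_zero k⟩
  have h2 := D.reflect_mem hi (fun z => (D.exists_pow_ad hi z).1)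
    (fun z => (D.exists_pow_ad hi z).2) h1
  obtain ⟨z, hz, hz0⟩ := Submodule.exists_mem_ne_zero_of_ne_bot h2
  exact D.exists_wt_eq hz hz0

section Bounded

variable {lam : Module.Dual ℂ T} (hP : ∀ μ, D.wts φ μ ≠ ⊥ → lam - μ ∈ D.Qp)
include hP

/-- Each step upward along a positive weight lowers the height of lam - μ by a positive integer,
while the height of an occurring difference is a natural number. -/
theorem exists_bound {i : ι} (hi : D.Pos i) (μ : Module.Dual ℂ T) :
    ∃ N : ℕ, ∀ k, N ≤ k → D.wts φ (μ + k • D.wt i) = ⊥ := by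
  obtain ⟨a, ha, hia⟩ := D.ht_pos hi.2 hi.1
  obtain ⟨N, hN⟩ := exists_nat_gt (D.ht (lam - μ)).re
  refine ⟨N, fun k hk => by_contra fun hc => ?_⟩
  obtain ⟨n, hn, -⟩ := D.ht_Qp _ (hP _ hc)
  rw [← sub_sub, map_sub, map_nsmul, hia, sub_eq_iff_eq_add] at hn
  have h1 := congrArg Complex.re hn
  simp only [Complex.add_re, Complex.natCast_re, nsmul_eq_mul, Complex.mul_re,
    Complex.natCast_im, mul_zero, sub_zero] at h1
  rw [h1] at hN
  have h2 : (n : ℝ) + k * a < N := hN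
  have h3 : n + k * a < N := by exact_mod_cast h2
  nlinarith

theorem exists_pow_pos_eq_zero {i : ι} (hi : D.Pos i) {z : K} (hz : z ∈ D.rts (D.wt i))
    (hwt : ⨆ μ, D.wts φ μ = ⊤) (v : V) : ∃ p : ℕ, (φ z ^ p) v = 0 := by
  have hv : v ∈ ⨆ μ, D.wts φ μ := by rw [hwt]; trivial
  induction hv using Submodule.iSup_induction' with
  | mem μ x hx =>
    obtain ⟨N, hN⟩ := D.exists_bound hP hi μ
    have := D.pow_mem_wts hz hx N
    rw [hN N le_rfl] at this
    exact ⟨N, (Submodule.mem_bot ℂ).1 this⟩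
  | zero => exact ⟨0, by simp⟩
  | add x y _ _ hx hy =>
    obtain ⟨p, hp⟩ := hx
    obtain ⟨q, hq⟩ := hy
    refine ⟨p + q, ?_⟩
    rw [map_add]
    nth_rewrite 1 [add_comm p q]
    rw [pow_add, pow_add, Module.End.mul_apply, Module.End.mul_apply, hp, hq, map_zero, map_zero,
      add_zero]

variable (hwt : ⨆ μ, D.wts φ μ = ⊤)
  (hnil : ∀ i, D.Simple i → ∀ v, ∃ p : ℕ, (φ (D.y i) ^ p) v = 0)
include hwt hnil

/-- Induction on the height of the root. Reflect the descending string at a simple root s whose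
coroot pairs positively with it. The reflected root is nonzero. If it is positive, its height is
smaller and the induction hypothesis applies; if it is negative, the reflected string ascends along
a positive root and is bounded by lam. -/
theorem exists_bound_neg {i : ι} (hi : D.Pos i) (μ : Module.Dual ℂ T) :
    ∃ N : ℕ, ∀ k, N ≤ k → D.wts φ (μ - k • D.wt i) = ⊥ := by
  obtain ⟨m, -, hm⟩ := D.ht_pos hi.2 hi.1
  induction m using Nat.strong_induction_on generalizing i μ with
  | _ m ih =>
    obtain ⟨s, hs, m', hm', hsm⟩ := D.exists_simple_pos hi
    obtain ⟨n, hn, hin⟩ := D.pos_of_pos hi.1 hs.1.1 hm' hsm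
    obtain ⟨l, hl⟩ := D.reflect_wt (k := i) hs.1.1
    have href : ∀ k : ℕ, D.wts φ (μ - k • D.wt i) ≠ ⊥ →
        D.wts φ (μ - μ (D.cr s) • D.wt s - k • D.wt l) ≠ ⊥ := by
      intro k hk
      have h1 := D.reflect_mem hs.1.1 (D.exists_pow_pos_eq_zero hP hs.1 (D.x_mem hs.1.1) hwt)
        (hnil s hs) hk
      convert h1 using 2
      rw [hl, LinearMap.sub_apply, LinearMap.smul_apply, hin,
        ← Nat.cast_smul_eq_nsmul ℂ, ← Nat.cast_smul_eq_nsmul ℂ]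
      module
    have hl0 : D.wt l ≠ 0 := by
      intro h0
      rw [h0] at hl
      have h1 := DFunLike.congr_fun hl (D.cr s)
      rw [LinearMap.zero_apply, LinearMap.sub_apply, LinearMap.smul_apply, D.wt_cr s hs.1.1, hin,
        smul_eq_mul] at h1
      have h2 : (n : ℂ) = 0 := by linear_combination h1
      have h3 : n = 0 := by exact_mod_cast h2
      omega
    rcases D.wt_mem l with hlQ | hlQ
    · obtain ⟨a, ha, hla⟩ := D.ht_pos hlQ hl0
      obtain ⟨c, hc, hsc⟩ := D.ht_pos hs.1.2 hs.1.1
      have h1 : a < m := by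
        have h2 := congrArg D.ht hl
        rw [map_sub, map_smul, hla, hm, hin, hsc, smul_eq_mul, eq_sub_iff_add_eq] at h2
        have h3 : a + n * c = m := by exact_mod_cast h2
        have : 0 < n * c := Nat.mul_pos hn hc
        omega
      obtain ⟨N, hN⟩ := ih a h1 ⟨hl0, hlQ⟩ (μ - μ (D.cr s) • D.wt s) hla
      exact ⟨N, fun k hk => by_contra fun hc => href k hc (hN k hk)⟩
    · obtain ⟨l', hl'⟩ := D.exists_wt_eq_neg l
      obtain ⟨N, hN⟩ := D.exists_bound hP (i := l')
        ⟨by rw [hl']; exact neg_ne_zero.2 hl0, by rw [hl']; exact hlQ⟩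
        (μ - μ (D.cr s) • D.wt s)
      refine ⟨N, fun k hk => by_contra fun hc => href k hc ?_⟩
      have := hN k hk
      rwa [hl', smul_neg, ← sub_eq_add_neg] at this

/-- A weight module, with weights bounded above, on which the negative simple root vectors act
locally nilpotently is locally finite. -/
theorem finitePart_eq_top : finitePart (Set.range φ.toLin) = ⊤ := by
  classical
  let e := Fintype.equivFin ι
  let x : Fin (Fintype.card ι) → Module.End ℂ V := fun k => φ (D.b (e.symm k))
  have hspan : ∀ z, φ z ∈ Submodule.span ℂ (Set.range x) := by
    intro z
    rw [← D.b.sum_repr z, map_sum]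
    exact Submodule.sum_mem _ fun i _ => by
      rw [map_smul]
      exact Submodule.smul_mem _ _ (Submodule.subset_span ⟨e i, by simp [x]⟩)
  have hwtmem : ∀ S : Submodule ℂ V, (∀ μ, ∀ v ∈ D.wts φ μ, v ∈ S) → S = ⊤ := fun S hS => by
    rw [← top_le_iff, ← hwt]
    exact iSup_le fun μ v hv => hS μ v hv
  -- Cartan elements act diagonally on weight vectors; root vectors of either sign act nilpotently,
  -- because the weight strings in both directions are finite.
  have hlf : ∀ k, locallyFinitePart (x k) = ⊤ := by
    intro k
    refine hwtmem _ fun μ v hv => ?_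
    by_cases h0 : D.wt (e.symm k) = 0
    · obtain ⟨h, hh⟩ := D.mem_range_j _ h0
      have : x k v = μ h • v := by
        change φ (D.b (e.symm k)) v = _
        rw [← hh]; exact (D.mem_wts φ).1 hv h
      exact mem_locallyFinitePart_of_eigen this
    · rcases D.wt_mem (e.symm k) with h | h
      · obtain ⟨p, hp⟩ := D.exists_pow_pos_eq_zero hP ⟨h0, h⟩ (D.b_mem _) hwt v
        exact mem_locallyFinitePart_of_pow hp
      · obtain ⟨l, hl⟩ := D.exists_wt_eq_neg (e.symm k)
        obtain ⟨N, hN⟩ := D.exists_bound_neg hP hwt hnil (i := l)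
          ⟨by rw [hl]; exact neg_ne_zero.2 h0, by rw [hl]; exact h⟩ μ
        have h1 := D.pow_mem_wts (D.b_mem (e.symm k)) hv N
        have h2 := hN N le_rfl
        rw [hl, smul_neg, sub_neg_eq_add] at h2
        rw [h2] at h1
        exact mem_locallyFinitePart_of_pow ((Submodule.mem_bot ℂ).1 h1)
  rw [eq_top_iff]
  intro v _
  obtain ⟨U, hU, hv, hst⟩ := exists_finite_stable_of_span x
    (fun i k => by rw [← φ.map_lie]; exact hspan _) hlf v
  refine ⟨U, hU, hv, ?_⟩
  rintro _ ⟨z, rfl⟩ u hu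
  have h1 : Submodule.span ℂ (Set.range x) ≤ U.comap (LinearMap.applyₗ u) :=
    Submodule.span_le.2 (by rintro _ ⟨i, rfl⟩; exact hst i u hu)
  exact h1 (hspan z)

end Bounded

end SplitReductive

end TwistedWeyl

noncomputable section

namespace TwistedWeyl

/-! ### The even part of 𝔤^Γ as a split reductive Lie algebra. -/

section FixedReductive

variable {g : Type u} [AddCommGroup g] [Module ℂ g] [SuperSpace g] [LieSuperalgebra g]
variable {Γ : Type w} [Group Γ] {ρ : SuperAction Γ g} {n : ℕ} {C : ChevalleyGenerators g n}
variable {Δ : Set (Weight ρ C)}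

/-- The center is a graded ideal, and simplicity leaves only zero since the bracket is not
identically zero. -/
theorem IsBasicClassical.eq_zero_of_central {L : Type*} [AddCommGroup L] [Module ℂ L]
    [SuperSpace L] [LieSuperalgebra L] (hL : IsBasicClassical L) {x : L} (hx : ∀ y, br x y = 0) :
    x = 0 := by
  let I : Submodule ℂ L := LinearMap.ker (LieSuperalgebra.bracket (L := L))
  have hI : ∀ x ∈ I, ∀ y, br x y = 0 := fun x hx y => by
    rw [br, LinearMap.mem_ker.1 hx, LinearMap.zero_apply]
  have hpar : ∀ x ∈ I, parity L x ∈ I := fun x hx => LinearMap.mem_ker.2 (LinearMap.ext fun y => by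
    have h1 := parity_br x (parity L y)
    rw [hI x hx, map_zero, parity_parity] at h1
    exact h1.symm)
  rcases hL.simple I hpar (fun x hx y => by rw [hI x hx]; exact Submodule.zero_mem _) with h | h
  · have : x ∈ I := LinearMap.mem_ker.2 (LinearMap.ext hx)
    rw [h] at this
    exact (Submodule.mem_bot ℂ).1 this
  · obtain ⟨a, b, hab⟩ := hL.nonabelian
    exact absurd (hI a (by rw [h]; trivial) b) hab

/-- Since Δ is linearly independent, its conjugated values at t extend to a linear functional on the
dual space, which by finite dimension is evaluation at some t'. Additivity carries the identity over
to Q⁺. -/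
theorem exists_dual_conj {T : Type*} [AddCommGroup T] [Module ℂ T] [FiniteDimensional ℂ T]
    {Δ : Set (Module.Dual ℂ T)} (hΔ : LinearIndepOn ℂ id Δ) (t : T) :
    ∃ t', ∀ q ∈ AddSubmonoid.closure Δ, q t' = starRingEnd ℂ (q t) := by
  let b := Module.Basis.extend hΔ
  let F : Module.Dual ℂ (Module.Dual ℂ T) := b.constr ℂ fun i => starRingEnd ℂ (b i t)
  have hF : ∀ q ∈ Δ, F q = starRingEnd ℂ (q t) := by
    intro q hq
    have h1 : b ⟨q, hΔ.subset_extend _ hq⟩ = q := Module.Basis.extend_apply_self hΔ _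
    have h2 := b.constr_basis ℂ (fun i => starRingEnd ℂ (b i t)) ⟨q, hΔ.subset_extend _ hq⟩
    rw [h1] at h2
    exact h2
  refine ⟨(Module.evalEquiv ℂ T).symm F, fun q hq => ?_⟩
  have h1 : q ((Module.evalEquiv ℂ T).symm F) = F q := Module.apply_evalEquiv_symm_apply ℂ T q F
  rw [h1]
  induction hq using AddSubmonoid.closure_induction with
  | mem q hq => exact hF q hq
  | zero => simp
  | add p q _ _ hp hq =>
    rw [map_add, LinearMap.add_apply, map_add,
      hp (Module.apply_evalEquiv_symm_apply ℂ T p F),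
      hq (Module.apply_evalEquiv_symm_apply ℂ T q F)]

variable (ρ C) in
/-- The inclusion of `𝔥_Γ` into the even part of `𝔤^Γ`. -/
def evenCartan : cartanFixed ρ C →ₗ[ℂ] EvenPart (Fixed ρ) :=
  (cartanIncl ρ C).codRestrict (part (Fixed ρ) 0) cartanFixed_even

/-- The root decomposition of `𝔤^Γ`. -/
def rootDecomposition [Finite Γ] [FiniteDimensional ℂ g]
    (hdiag : ∀ γ, C.IsDiagramAutomorphism (ρ.toHom γ)) (hgΓ : IsBasicClassical (Fixed ρ))
    (hΔ : IsConsistentSimpleSystem ρ C Δ) : RootDecomposition (Fixed ρ) (cartanFixed ρ C) where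
  j := cartanIncl ρ C
  j_even := cartanFixed_even
  j_injective := Submodule.inclusion_injective _
  br_j h h' := Subtype.ext (C.br_cartan_cartan h.2.1 h'.2.1)
  Qp := posLattice Δ
  ht := hΔ.exists_height.choose
  ht_Qp := hΔ.exists_height.choose_spec
  exists_conj := exists_dual_conj hΔ.linearIndependent
  S := {x : Fixed ρ | (x : g) ∈ triangularVectors Δ}
  S_homogeneous := by
    rintro s ((⟨-, h, -⟩ | h) | ⟨-, h, -⟩)
    · exact h
    · exact ⟨0, C.cartan_le h⟩
    · exact h
  S_weight := by
    rintro s ((⟨-, -, ν, hν, h⟩ | h) | ⟨-, -, ν, hν, h⟩)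
    · exact Or.inr ⟨ν, Or.inl hν.1, hν.2, fun t => Subtype.ext (h t)⟩
    · exact Or.inl ⟨⟨s, h, s.2⟩, rfl⟩
    · exact Or.inr ⟨-ν, Or.inr (by rw [neg_neg]; exact hν.1), neg_ne_zero.2 hν.2,
        fun t => Subtype.ext (h t)⟩
  S_span := span_triangularVectors_fixed hdiag hΔ
  center x := hgΓ.eq_zero_of_central
  B := hgΓ.basic.choose
  B_even := hgΓ.basic.choose_spec.1
  B_inv := hgΓ.basic.choose_spec.2.2.1
  B_nondegenerate := hgΓ.basic.choose_spec.2.2.2.1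

theorem exists_reductive [Finite Γ] [FiniteDimensional ℂ g]
    (hdiag : ∀ γ, C.IsDiagramAutomorphism (ρ.toHom γ)) (hgΓ : IsBasicClassical (Fixed ρ))
    (hΔ : IsConsistentSimpleSystem ρ C Δ) :
    ∃ (ι : Set (EvenPart (Fixed ρ))) (_ : Fintype ι) (J : Set (Fixed ρ)) (_ : Fintype J)
      (D : SplitReductive (EvenPart (Fixed ρ)) (cartanFixed ρ C) ι J),
      D.j = evenCartan ρ C ∧ D.Qp = posLattice Δ := by
  obtain ⟨ι, h1, J, h2, D, h3, h4, -⟩ := (rootDecomposition hdiag hgΓ hΔ).exists_splitReductive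
  exact ⟨ι, h1, J, h2, D, h3, h4⟩

section Reductive

variable {ι J : Type*} [Fintype ι] [Fintype J]
  {D : SplitReductive (EvenPart (Fixed ρ)) (cartanFixed ρ C) ι J}

theorem mem_rts_iff (hj : D.j = evenCartan ρ C) {z : EvenPart (Fixed ρ)} {α : Weight ρ C} :
    z ∈ D.rts α ↔ ((z : Fixed ρ) : g) ∈ rootSpace ρ C α ⊓ part g 0 := by
  rw [D.mem_rts, hj]
  constructor
  · exact fun h => ⟨⟨z.1.2, fun t => congrArg (fun z : EvenPart (Fixed ρ) => ((z : Fixed ρ) : g))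
      (h t)⟩, z.2⟩
  · exact fun h t => Subtype.ext (Subtype.ext (h.1.2 t))

theorem isEvenRoot_iff (hj : D.j = evenCartan ρ C) {α : Weight ρ C} :
    IsEvenRoot ρ C α ↔ α ≠ 0 ∧ ∃ i, D.wt i = α := by
  refine and_congr_right fun _ => ⟨fun h => ?_, ?_⟩
  · obtain ⟨z, hz, hz0⟩ := Submodule.exists_mem_ne_zero_of_ne_bot h
    let z' : EvenPart (Fixed ρ) := ⟨⟨z, hz.1.1⟩, hz.2⟩
    refine D.exists_wt_eq (z := z') ((mem_rts_iff hj).2 hz) fun h0 => hz0 ?_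
    exact congrArg (fun z : EvenPart (Fixed ρ) => ((z : Fixed ρ) : g)) h0
  · rintro ⟨i, rfl⟩
    refine (Submodule.ne_bot_iff _).2 ⟨_, (mem_rts_iff hj).1 (D.b_mem i), fun h0 => ?_⟩
    exact D.b.ne_zero i (Subtype.ext (Subtype.ext h0))

theorem isEvenSimple_of_simple (hj : D.j = evenCartan ρ C) (hQ : D.Qp = posLattice Δ) {i : ι}
    (hi : D.Simple i) : IsEvenSimple Δ (D.wt i) := by
  refine ⟨⟨(isEvenRoot_iff hj).2 ⟨hi.1.1, i, rfl⟩, hQ ▸ hi.1.2⟩, ?_⟩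
  rintro ⟨β, γ, ⟨hβ, hβQ⟩, ⟨hγ, hγQ⟩, h⟩
  obtain ⟨hβ0, k, rfl⟩ := (isEvenRoot_iff hj).1 hβ
  obtain ⟨hγ0, l, rfl⟩ := (isEvenRoot_iff hj).1 hγ
  exact hi.2 ⟨k, l, ⟨hβ0, hQ ▸ hβQ⟩, ⟨hγ0, hQ ▸ hγQ⟩, h⟩

theorem isCorootTriple (hj : D.j = evenCartan ρ C) {i : ι} (hi : D.wt i ≠ 0) :
    IsCorootTriple (D.wt i) (D.x i : Fixed ρ) (D.y i : Fixed ρ) (D.cr i) where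
  xp_mem := (mem_rts_iff hj).1 (D.x_mem hi)
  xm_mem := (mem_rts_iff hj).1 (D.y_mem hi)
  bracket_eq := by
    have h1 := D.lie_x_y i hi
    rw [hj] at h1
    exact congrArg Subtype.val h1
  apply_eq_two := D.wt_cr i hi

end Reductive

namespace IsCorootTriple

variable {α : Weight ρ C} {xp xm : Fixed ρ} {h : cartanFixed ρ C} (H : IsCorootTriple α xp xm h)
include H

theorem isSl2 {V : Type*} [AddCommGroup V] [Module ℂ V] (φ : LieRep (EvenPart (Fixed ρ)) V) :
    IsSl2 (φ ⟨xp, H.xp_mem.2⟩) (φ ⟨xm, H.xm_mem.2⟩) (φ (evenCartan ρ C h)) where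
  e_f := by
    rw [← φ.map_lie]
    congr 1
    exact Subtype.ext H.bracket_eq
  h_e := by
    rw [← φ.map_lie, ← map_smul, ← H.apply_eq_two]
    congr 1
    exact Subtype.ext (Subtype.ext (H.xp_mem.1.2 h))
  h_f := by
    rw [← φ.map_lie, ← map_smul, ← map_neg, ← H.apply_eq_two]
    congr 1
    refine Subtype.ext (Subtype.ext ((H.xm_mem.1.2 h).trans ?_))
    rw [LinearMap.neg_apply, neg_smul]
    rfl

/-- As α(h) = 2, the bracket h and hence xp are nonzero, so α is a positive root; consistency places
its root space in 𝔫⁺. -/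
theorem xp_mem_nPos (hΔ : IsConsistentSimpleSystem ρ C Δ) (hα : IsEvenSimple Δ α) :
    (xp : g) ∈ C.nPos := by
  have h0 : xp ≠ 0 := by
    rintro rfl
    have h1 := H.bracket_eq
    rw [br, map_zero, LinearMap.zero_apply, eq_comm] at h1
    have h2 : h = 0 := Submodule.inclusion_injective _ (h1.trans (map_zero _).symm)
    have h3 := H.apply_eq_two
    rw [h2, map_zero] at h3
    exact two_ne_zero h3.symm
  have hr : IsRoot ρ C α := ⟨hα.1.1.1, (Submodule.ne_bot_iff _).2
    ⟨xp, H.xp_mem.1, fun h => h0 (Subtype.ext h)⟩⟩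
  have h1 : (xp : g) ∈ C.nPos ⊓ ρ.fixed.toSubmodule := by
    rw [← hΔ.nPos_eq]
    exact (le_iSup₂ (f := fun α (_ : α ∈ {α | IsRoot ρ C α ∧ α ∈ posLattice Δ}) =>
      rootSpace ρ C α) α ⟨hr, hα.1.2⟩) H.xp_mem.1
  exact h1.1

end IsCorootTriple

/-- The identity homomorphism. -/
def LieSuperHom.id (L : Type*) [AddCommGroup L] [Module ℂ L] [SuperSpace L] [LieSuperalgebra L] :
    LieSuperHom L L where
  toLinearMap := LinearMap.id
  map_part _ _ hx := hx
  map_bracket _ _ := rfl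

/-- The values of dominant weights at the simple coroots are natural numbers. -/
theorem exists_nat_of_dominant (hΔ : IsConsistentSimpleSystem ρ C Δ) {lam : Weight ρ C}
    (hlam : lam ∈ dominantWeights ρ C) {α : Weight ρ C} (hα : IsEvenSimple Δ α)
    {xp xm : Fixed ρ} {h : cartanFixed ρ C} (H : IsCorootTriple α xp xm h) :
    ∃ m : ℕ, lam h = m := by
  obtain ⟨M, _, _, _, _, hfd, -, m, hm0, hm1, hm2⟩ := hlam
  have H' := H.isSl2 (evenRep (LieSuperHom.id (Fixed ρ)) M)
  obtain ⟨q, hq⟩ := exists_pow_eq_zero (neg_ne_zero.2 two_ne_zero)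
    (H'.h_f.trans (neg_smul _ _).symm) ⊤ (by simp) (by simp)
  refine H'.exists_nat (N := ⊥) (by simp) (by simp) (by simp) (u := m) (by simpa using hm0)
    (hm2 h) (q := q) ?_ ?_
  · exact (Submodule.mem_bot ℂ).2 (hm1 xp (H.xp_mem_nPos hΔ hα))
  · exact (Submodule.mem_bot ℂ).2 (hq m trivial)

end FixedReductive

/-! ### Modules over the equivariant map superalgebra and the category 𝓘^Γ. -/

section MapModules

variable {g : Type u} [AddCommGroup g] [Module ℂ g] [SuperSpace g] [LieSuperalgebra g]
variable {A : Type v} [CommRing A] [Algebra ℂ A] {Γ : Type w} [Group Γ]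
variable {ρ : SuperAction Γ g} {τ : Γ →* (A ≃ₐ[ℂ] A)} {n : ℕ} {C : ChevalleyGenerators g n}
variable {Δ : Set (Weight ρ C)}
variable {V : Type*} [AddCommGroup V] [Module ℂ V] [SuperSpace V] [LieSupermodule (EqMap ρ τ) V]

variable (ρ τ C V) in
/-- The action of `𝔥_Γ` on a `(𝔤 ⊗ A)^Γ`-module. -/
def cartanOp : cartanFixed ρ C →ₗ[ℂ] Module.End ℂ V := LieSupermodule.act ∘ₗ cartanMap ρ τ C

theorem act_mem_wtSpace {μ ν : Weight ρ C} {z : EqMap ρ τ} (hz : IsWeightElement ρ τ ν z) {v : V}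
    (hv : v ∈ wtSpace (cartanOp ρ τ C V) μ) : act z v ∈ wtSpace (cartanOp ρ τ C V) (μ + ν) := by
  intro h
  have h1 := act_br_even (cartanMap_even ρ τ C h) z v
  have h2 : act (cartanMap ρ τ C h) v = μ h • v := hv h
  rw [hz h, h2, eq_sub_iff_add_eq] at h1
  change act (cartanMap ρ τ C h) (act z v) = _
  rw [← h1, act, map_smul, map_smul, LinearMap.smul_apply, LinearMap.add_apply, add_smul, add_comm]

theorem exists_weight_of_mem {z : EqMap ρ τ}
    (hz : z ∈ posElements ρ τ Δ ∪ cartanElements ρ τ C ∪ negElements ρ τ Δ) :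
    ∃ ν : Weight ρ C, IsWeightElement ρ τ ν z := by
  rcases hz with (⟨-, -, ν, -, h⟩ | h) | ⟨-, -, ν, -, h⟩
  · exact ⟨ν, h⟩
  · exact ⟨0, .of_cartan h⟩
  · exact ⟨-ν, h⟩

/-- A subspace that is stable under a spanning set of `(𝔤 ⊗ A)^Γ` is stable. -/
theorem act_mem_of_span {S : Set (EqMap ρ τ)} (hS : Submodule.span ℂ S = ⊤) {N : Submodule ℂ V}
    {v : V} (hN : ∀ z ∈ S, act z v ∈ N) (z : EqMap ρ τ) : act z v ∈ N := by
  have : Submodule.span ℂ S ≤ N.comap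
      ((LieSupermodule.act (L := EqMap ρ τ) (V := V)).flip v) := Submodule.span_le.2 hN
  rw [hS] at this
  exact this trivial

section Nilpotent

variable {y : EqMap ρ τ} (hy : y ∈ part (EqMap ρ τ) 0)
include hy

/-- Leibniz rule: y^m (z v) is a combination of ((ad y)^a z) (y^b v) with a + b = m, and for m ≥ q +
p either a ≥ q or b ≥ p. Since y is even, no signs occur. -/
theorem pow_act_eq_zero {m : ℕ} : ∀ {q p : ℕ} {z : EqMap ρ τ} {v : V},
    ((LieSuperalgebra.bracket y : Module.End ℂ (EqMap ρ τ)) ^ q) z = 0 →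
    ((act y : Module.End ℂ V) ^ p) v = 0 → q + p ≤ m →
    ((act y : Module.End ℂ V) ^ m) (act z v) = 0 := by
  induction m with
  | zero =>
    intro q p z v hq hp hm
    obtain rfl : q = 0 := by omega
    rw [pow_zero, Module.End.one_apply] at hq
    simp only [hq, act, map_zero, LinearMap.zero_apply]
  | succ m ih =>
    intro q p z v hq hp hm
    have h1 := act_br_even hy z v
    rw [pow_succ, Module.End.mul_apply, ← eq_sub_iff_add_eq.1 h1, map_add]
    have hz : ((act y : Module.End ℂ V) ^ m) (act (br y z) v) = 0 := by
      cases q with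
      | zero =>
        rw [pow_zero, Module.End.one_apply] at hq
        simp only [hq, br, act, map_zero, LinearMap.zero_apply]
      | succ q => exact ih (by rwa [pow_succ] at hq) hp (by omega)
    have hv : ((act y : Module.End ℂ V) ^ m) (act z (act y v)) = 0 := by
      cases p with
      | zero =>
        rw [pow_zero, Module.End.one_apply] at hp
        rw [hp, map_zero, map_zero, map_zero]
      | succ p => exact ih hq (by rwa [pow_succ] at hp) (by omega)
    rw [hz, hv, add_zero]

/-- When y is ad-nilpotent on every element, the vectors killed by some power of y form a submodule;
it contains the generator. -/
theorem exists_pow_act_eq_zero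
    (had : ∀ z, ∃ q : ℕ, ((LieSuperalgebra.bracket y : Module.End ℂ (EqMap ρ τ)) ^ q) z = 0)
    {w : V} (hgen : Generates (EqMap ρ τ) w) (hw : ∃ p : ℕ, ((act y : Module.End ℂ V) ^ p) w = 0)
    (v : V) : ∃ p : ℕ, ((act y : Module.End ℂ V) ^ p) v = 0 := by
  have hmono : ∀ {p q : ℕ} {v : V}, p ≤ q → ((act y : Module.End ℂ V) ^ p) v = 0 →
      ((act y : Module.End ℂ V) ^ q) v = 0 := by
    intro p q v hpq hp
    obtain ⟨k, rfl⟩ := Nat.exists_eq_add_of_le' hpq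
    rw [pow_add, Module.End.mul_apply, hp, map_zero]
  let N : Submodule ℂ V :=
    { carrier := {v | ∃ p : ℕ, ((act y : Module.End ℂ V) ^ p) v = 0}
      add_mem' := by
        rintro a b ⟨p, hp⟩ ⟨q, hq⟩
        exact ⟨p + q, by
          rw [map_add, hmono (Nat.le_add_right _ _) hp, hmono (Nat.le_add_left _ _) hq, add_zero]⟩
      zero_mem' := ⟨0, map_zero _⟩
      smul_mem' := by
        rintro c a ⟨p, hp⟩
        exact ⟨p, by rw [map_smul, hp, smul_zero]⟩ }
  have hN : N = ⊤ := hgen N hw fun z v hv => by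
    obtain ⟨p, hp⟩ := hv
    obtain ⟨q, hq⟩ := had z
    exact ⟨q + p, pow_act_eq_zero hy hq hp le_rfl⟩
  have : v ∈ N := by rw [hN]; trivial
  exact this

end Nilpotent

/-- Root vectors of `𝔤^Γ` act nilpotently on `(𝔤 ⊗ A)^Γ`. -/
theorem exists_pow_bracket_eq_zero [FiniteDimensional ℂ g] {y : Fixed ρ} {h : g} {c : ℂ}
    (hh : h ∈ part g 0) (hc : c ≠ 0) (hy : br h (y : g) = c • (y : g)) (z : EqMap ρ τ) :
    ∃ q : ℕ, ((LieSuperalgebra.bracket ((incl ρ τ).toLinearMap y) :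
      Module.End ℂ (EqMap ρ τ)) ^ q) z = 0 := by
  -- On 𝔤 ⊗ A the bracket with y ⊗ 1 is ad y ⊗ id. Nilpotency can thus be proved on the
  -- finite-dimensional space 𝔤, even if A is infinite-dimensional.
  let ady : Module.End ℂ g := LieSuperalgebra.bracket (y : g)
  let adh : Module.End ℂ g := LieSuperalgebra.bracket h
  have h1 : adh * ady - ady * adh = c • ady := by
    ext x
    have h2 := br_br_even hh (y : g) x
    rw [hy] at h2
    have h3 : br (c • (y : g)) x = c • br (y : g) x := by
      rw [br, map_smul, LinearMap.smul_apply]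
    rw [h3] at h2
    exact sub_eq_of_eq_add h2
  obtain ⟨q, hq⟩ := exists_pow_eq_zero hc h1 ⊤ (by simp) (by simp)
  have h2 : ady ^ q = 0 := LinearMap.ext fun x => hq x trivial
  have h3 : (LieSuperalgebra.bracket ((y : g) ⊗ₜ[ℂ] (1 : A)) : Module.End ℂ (g ⊗[ℂ] A)) =
      ady.rTensor A := by
    refine TensorProduct.ext' fun x a => ?_
    change br ((y : g) ⊗ₜ[ℂ] (1 : A)) (x ⊗ₜ[ℂ] a) = br (y : g) x ⊗ₜ[ℂ] a
    rw [br_tmul, one_mul]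
  have h4 : ∀ k : ℕ, (((LieSuperalgebra.bracket ((incl ρ τ).toLinearMap y) :
      Module.End ℂ (EqMap ρ τ)) ^ k) z : g ⊗[ℂ] A) = (ady.rTensor A ^ k) z := by
    intro k
    induction k with
    | zero => rfl
    | succ k ih =>
      rw [pow_succ', pow_succ', Module.End.mul_apply, Module.End.mul_apply, ← ih, ← h3]
      rfl
  refine ⟨q, Subtype.ext ?_⟩
  rw [h4, LinearMap.rTensor_pow, h2, LinearMap.rTensor_zero]
  rfl

theorem range_evenRep : Set.range (evenRep (incl ρ τ) V).toLin =
    {T : V →ₗ[ℂ] V | ∃ x ∈ part (Fixed ρ) 0, T = act ((incl ρ τ).toLinearMap x)} := by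
  ext T
  constructor
  · rintro ⟨x, rfl⟩; exact ⟨x, x.2, rfl⟩
  · rintro ⟨x, hx, rfl⟩; exact ⟨⟨x, hx⟩, rfl⟩

section Category

variable [Finite Γ] (hdiag : ∀ γ, C.IsDiagramAutomorphism (ρ.toHom γ))
  (hΔ : IsConsistentSimpleSystem ρ C Δ)
include hdiag hΔ

/-- A module that is generated by a weight vector is the sum of its weight spaces. -/
theorem iSup_wtSpace_eq_top {lam : Weight ρ C} {w : V} (hgen : Generates (EqMap ρ τ) w)
    (hw : w ∈ weightSpace τ V lam) : ⨆ μ, wtSpace (cartanOp ρ τ C V) μ = ⊤ := by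
  refine hgen _ ((le_iSup (wtSpace (cartanOp ρ τ C V)) lam) hw) fun z v hv => ?_
  refine act_mem_of_span (span_elements hdiag hΔ) (fun z hz => ?_) z
  obtain ⟨ν, hν⟩ := exists_weight_of_mem hz
  have : ⨆ μ, wtSpace (cartanOp ρ τ C V) μ ≤ (⨆ μ, wtSpace (cartanOp ρ τ C V) μ).comap (act z) :=
    iSup_le fun μ v hv => (le_iSup (wtSpace (cartanOp ρ τ C V)) (μ + ν)) (act_mem_wtSpace hν hv)
  exact this hv

/-- A criterion for a module to belong to the category `𝓘^Γ`. -/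
theorem inCategory_of_generates [FiniteDimensional ℂ g] (hgΓ : IsBasicClassical (Fixed ρ))
    {lam : Weight ρ C} {w : V} (hgen : Generates (EqMap ρ τ) w) (hw : w ∈ weightSpace τ V lam)
    (hwts : ∀ μ, ∀ v ∈ weightSpace τ V μ, v ≠ 0 → lam - μ ∈ posLattice Δ)
    (hnil : ∀ α xp xm h, IsEvenSimple Δ α → IsCorootTriple α xp xm h →
      ∃ p : ℕ, ((act ((incl ρ τ).toLinearMap xm) : Module.End ℂ V) ^ p) w = 0) :
    InCategory ρ τ V := by
  obtain ⟨ι, _, J, _, D, hj, hQ⟩ := exists_reductive hdiag hgΓ hΔ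
  have hwtsD : ∀ μ, D.wts (evenRep (incl ρ τ) V) μ = wtSpace (cartanOp ρ τ C V) μ := fun μ => by
    ext v
    rw [D.mem_wts, hj]
    exact Iff.rfl
  have hwt : ⨆ μ, D.wts (evenRep (incl ρ τ) V) μ = ⊤ := by
    simp only [hwtsD]
    exact iSup_wtSpace_eq_top hdiag hΔ hgen hw
  rw [InCategory, ← range_evenRep]
  refine D.isFinitelySemisimple (D.finitePart_eq_top (lam := lam) (fun μ hμ => ?_) hwt
    fun i hi v => ?_) hwt
  · rw [hwtsD] at hμ
    obtain ⟨v, hv, hv0⟩ := Submodule.exists_mem_ne_zero_of_ne_bot hμ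
    rw [hQ]
    exact hwts μ v hv hv0
  -- Local nilpotency of the negative simple root vectors spreads from the generator w to the whole
  -- module.
  · have H := isCorootTriple hj hi.1.1
    refine exists_pow_act_eq_zero (y := (incl ρ τ).toLinearMap (D.y i : Fixed ρ))
      ((incl ρ τ).map_part 0 _ (D.y i).2) (fun z => ?_) hgen
      (hnil _ _ _ _ (isEvenSimple_of_simple hj hQ hi) H) v
    refine exists_pow_bracket_eq_zero (h := (D.cr i : g)) (c := -2) (cartanFixed_even _)
      (by norm_num) ?_ z
    rw [H.xm_mem.1.2, LinearMap.neg_apply, H.apply_eq_two]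

end Category

/-- The defining relations of `V̄(lam)` hold for highest weight vectors in objects of `𝓘^Γ`. -/
theorem pow_act_eq_zero_of_inCategory (hΔ : IsConsistentSimpleSystem ρ C Δ)
    (hV : InCategory ρ τ V) {lam : Weight ρ C} {v : V} (hv : IsHighestWeightVector τ lam v)
    {α : Weight ρ C} {xp xm : Fixed ρ} {h : cartanFixed ρ C} (hα : IsEvenSimple Δ α)
    (H : IsCorootTriple α xp xm h) {m : ℕ} (hm : lam h = m) :
    ((act ((incl ρ τ).toLinearMap xm) : Module.End ℂ V) ^ (m + 1)) v = 0 := by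
  have hfin := finitePart_eq_top_of_semisimple hV
  have hv' : v ∈ finitePart {T : V →ₗ[ℂ] V |
      ∃ x ∈ part (Fixed ρ) 0, T = act ((incl ρ τ).toLinearMap x)} := by rw [hfin]; trivial
  obtain ⟨U, hU, hvU, hst⟩ := hv'
  have H' := H.isSl2 (evenRep (incl ρ τ) V)
  obtain ⟨q, hq⟩ := exists_pow_eq_zero (neg_ne_zero.2 two_ne_zero)
    (H'.h_f.trans (neg_smul _ _).symm) U (fun u hu => hst _ ⟨_, (evenCartan ρ C h).2, rfl⟩ u hu)
    (fun u hu => hst _ ⟨_, H.xm_mem.2, rfl⟩ u hu)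
  refine H'.f_pow_eq_zero (u := v) ?_ ?_ (hq v hvU)
  · rw [← hm]; exact hv.cartan_act h
  · exact hv.nPos_act _ (tmul_mem_tensorSub A (H.xp_mem_nPos hΔ hα) 1)

end MapModules

end TwistedWeyl
end

noncomputable section

namespace TwistedWeyl

/-! ### Highest weight modules -/

section HighestWeight

variable {g : Type u} [AddCommGroup g] [Module ℂ g] [SuperSpace g] [LieSuperalgebra g]
variable {A : Type v} [CommRing A] [Algebra ℂ A] {Γ : Type w} [Group Γ]
variable {ρ : SuperAction Γ g} {τ : Γ →* (A ≃ₐ[ℂ] A)} {n : ℕ} {C : ChevalleyGenerators g n}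
variable {Δ : Set (Weight ρ C)}
variable {V : Type*} [AddCommGroup V] [Module ℂ V] [SuperSpace V] [LieSupermodule (EqMap ρ τ) V]

variable (ρ τ C V) in
/-- The algebra of operators on `V` that is generated by `(𝔥 ⊗ A)^Γ`. -/
def cartanAlgebra : Subalgebra ℂ (Module.End ℂ V) :=
  Algebra.adjoin ℂ ((fun z : EqMap ρ τ => (act z : Module.End ℂ V)) '' cartanElements ρ τ C)

theorem act_mem_cartanAlgebra {z : EqMap ρ τ} (hz : z ∈ cartanElements ρ τ C) :
    (act z : Module.End ℂ V) ∈ cartanAlgebra ρ τ C V :=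
  Algebra.subset_adjoin ⟨z, hz, rfl⟩

theorem cartanAlgebra_stable {N : Submodule ℂ V}
    (hN : ∀ z ∈ cartanElements ρ τ C, ∀ v ∈ N, act z v ∈ N) {a : Module.End ℂ V}
    (ha : a ∈ cartanAlgebra ρ τ C V) : ∀ v ∈ N, a v ∈ N := by
  induction ha using Algebra.adjoin_induction with
  | mem x hx => obtain ⟨z, hz, rfl⟩ := hx; exact hN z hz
  | algebraMap r => exact fun v hv => N.smul_mem r hv
  | add x y _ _ hx hy => exact fun v hv => N.add_mem (hx v hv) (hy v hv)
  | mul x y _ _ hx hy => exact fun v hv => hx _ (hy v hv)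

/-- The generators commute because 𝔥 is abelian and even: [h ⊗ a, h' ⊗ b] = [h, h'] ⊗ ab = 0. This
commutativity is what makes the uniqueness argument work. -/
theorem cartanAlgebra_comm {a b : Module.End ℂ V} (ha : a ∈ cartanAlgebra ρ τ C V)
    (hb : b ∈ cartanAlgebra ρ τ C V) : a * b = b * a := by
  have hcomm : ∀ x ∈ (fun z : EqMap ρ τ => (act z : Module.End ℂ V)) '' cartanElements ρ τ C,
      ∀ y ∈ (fun z : EqMap ρ τ => (act z : Module.End ℂ V)) '' cartanElements ρ τ C,
      x * y = y * x := by
    rintro _ ⟨z, hz, rfl⟩ _ ⟨z', hz', rfl⟩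
    refine LinearMap.ext fun v => ?_
    have h1 := act_br_even (even_of_cartan hz) z' v
    rw [br_cartanElements hz hz', act, map_zero, LinearMap.zero_apply, eq_comm, sub_eq_zero] at h1
    exact h1
  exact congrArg Subtype.val ((Algebra.isMulCommutative_adjoin ℂ hcomm).is_comm.comm
    ⟨a, ha⟩ ⟨b, hb⟩)

variable (τ) in
/-- The space of vectors of weight `lam` that are killed by `(𝔫⁺ ⊗ A)^Γ`. -/
def highestWeightSpace (lam : Weight ρ C) (V : Type*) [AddCommGroup V] [Module ℂ V] [SuperSpace V]
    [LieSupermodule (EqMap ρ τ) V] : Submodule ℂ V where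
  carrier := {v | v ∈ wtSpace (cartanOp ρ τ C V) lam ∧
    ∀ z : EqMap ρ τ, (z : g ⊗[ℂ] A) ∈ tensorSub A C.nPos → act z v = 0}
  add_mem' ha hb := ⟨Submodule.add_mem _ ha.1 hb.1, fun z hz => by
    rw [map_add, ha.2 z hz, hb.2 z hz, add_zero]⟩
  zero_mem' := ⟨Submodule.zero_mem _, fun z _ => map_zero _⟩
  smul_mem' c v hv := ⟨Submodule.smul_mem _ c hv.1, fun z hz => by
    rw [map_smul, hv.2 z hz, smul_zero]⟩

/-- The algebra (𝔥 ⊗ A)^Γ has weight zero and normalizes (𝔫⁺ ⊗ A)^Γ. -/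
theorem cartan_mem_highestWeightSpace {lam : Weight ρ C} {z : EqMap ρ τ}
    (hz : z ∈ cartanElements ρ τ C) {v : V} (hv : v ∈ highestWeightSpace τ lam V) :
    act z v ∈ highestWeightSpace τ lam V := by
  refine ⟨by simpa using act_mem_wtSpace (.of_cartan hz) hv.1, fun y hy => ?_⟩
  have h1 := act_br_even (even_of_cartan hz) y v
  have h2 : ((br z y : EqMap ρ τ) : g ⊗[ℂ] A) ∈ tensorSub A C.nPos :=
    br_tensorSub (fun _ hx _ hy => C.br_cartan_nPos hx hy) hz hy
  rw [hv.2 _ h2, hv.2 _ hy, map_zero, zero_sub, eq_comm, neg_eq_zero] at h1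
  exact h1

theorem cartanAlgebra_mem_highestWeightSpace {lam : Weight ρ C} {a : Module.End ℂ V}
    (ha : a ∈ cartanAlgebra ρ τ C V) {v : V} (hv : v ∈ highestWeightSpace τ lam V) :
    a v ∈ highestWeightSpace τ lam V :=
  cartanAlgebra_stable (fun _ hz _ hv => cartan_mem_highestWeightSpace hz hv) ha v hv

theorem cartanAlgebra_mem_part {i : ZMod 2} {a : Module.End ℂ V}
    (ha : a ∈ cartanAlgebra ρ τ C V) {v : V} (hv : v ∈ part V i) : a v ∈ part V i :=
  cartanAlgebra_stable (N := part V i) (fun z hz v hv => by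
    simpa using LieSupermodule.act_mem (even_of_cartan hz) hv) ha v hv

theorem IsHighestWeightVector.mem {lam : Weight ρ C} {v : V} (hv : IsHighestWeightVector τ lam v) :
    v ∈ highestWeightSpace τ lam V := ⟨hv.cartan_act, hv.nPos_act⟩

variable [Finite Γ] (hdiag : ∀ γ, C.IsDiagramAutomorphism (ρ.toHom γ))
  (hΔ : IsConsistentSimpleSystem ρ C Δ) {lam : Weight ρ C} {v : V}
  (hgen : Generates (EqMap ρ τ) v) (hv : v ∈ highestWeightSpace τ lam V)
include hdiag hΔ hgen hv

/-- A module that is generated by a highest weight vector `v` is the sum of the `(𝔥 ⊗ A)^Γ`-module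
generated by `v` and of weight spaces of lower weight. -/
theorem sup_iSup_eq_top :
    (Subalgebra.toSubmodule (cartanAlgebra ρ τ C V)).map (LinearMap.applyₗ v) ⊔
      ⨆ μ ∈ {μ | lam - μ ∈ posWeights Δ}, wtSpace (cartanOp ρ τ C V) μ = ⊤ := by
  set M := (Subalgebra.toSubmodule (cartanAlgebra ρ τ C V)).map (LinearMap.applyₗ v) with hM
  have hMhw : M ≤ highestWeightSpace τ lam V := by
    rintro _ ⟨a, ha, rfl⟩
    exact cartanAlgebra_mem_highestWeightSpace ha hv
  let op : EqMap ρ τ → Module.End ℂ V := fun z => act z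
  let X : Set (Module.End ℂ V) := op '' (posElements ρ τ Δ ∪ cartanElements ρ τ C)
  let Y : Set (Module.End ℂ V) := op '' negElements ρ τ Δ
  let L : Submodule ℂ (Module.End ℂ V) :=
    LinearMap.range (LieSupermodule.act (L := EqMap ρ τ) (V := V))
  have hL : L ≤ Submodule.span ℂ (X ∪ Y) := by
    rintro _ ⟨z, rfl⟩
    have h1 : Submodule.span ℂ (posElements ρ τ Δ ∪ cartanElements ρ τ C ∪ negElements ρ τ Δ) ≤
        (Submodule.span ℂ (X ∪ Y)).comap (LieSupermodule.act (L := EqMap ρ τ) (V := V)) :=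
      Submodule.span_le.2 fun z hz => Submodule.subset_span (by
        rcases hz with hz | hz
        · exact Or.inl ⟨z, hz, rfl⟩
        · exact Or.inr ⟨z, hz, rfl⟩)
    rw [span_elements hdiag hΔ] at h1
    exact h1 trivial
  have hXY : ∀ x ∈ X, ∀ y ∈ Y, ∃ c : ℂ, x * y - c • (y * x) ∈ L := by
    rintro _ ⟨x, hx, rfl⟩ _ ⟨y, ⟨-, ⟨e, hye⟩, -⟩, rfl⟩
    obtain ⟨d, hxd⟩ : ∃ d, x ∈ part (EqMap ρ τ) d := by
      rcases hx with ⟨-, h, -⟩ | h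
      · exact h
      · exact ⟨0, even_of_cartan h⟩
    exact ⟨koszul d e, br x y, LinearMap.ext fun u => LieSupermodule.act_bracket hxd hye u⟩
  have hXM : ∀ x ∈ X, ∀ u ∈ M, x u ∈ M := by
    rintro _ ⟨x, hx | hx, rfl⟩ u hu
    · have : act x u = 0 := (hMhw hu).2 x hx.1
      change act x u ∈ M
      rw [this]
      exact Submodule.zero_mem _
    · obtain ⟨a, ha, rfl⟩ := hu
      exact ⟨act x * a, (cartanAlgebra ρ τ C V).mul_mem (act_mem_cartanAlgebra hx) ha, rfl⟩
  -- M is stable under the positive and the Cartan elements, so the weak Poincaré–Birkhoff–Witt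
  -- argument shows that negative elements alone generate the module from M. They take M and the
  -- lower weight spaces to strictly lower weights.
  have htop : closureUnder Y (M : Set V) = ⊤ := hgen _
    (subset_closureUnder _ _ ⟨1, (cartanAlgebra ρ τ C V).one_mem, rfl⟩) fun z u hu =>
      closureUnder_stable_of_span hL hXY hXM ⟨z, rfl⟩ hu
  rw [← top_le_iff, ← htop]
  refine closureUnder_le (fun u hu => Submodule.mem_sup_left hu) ?_
  rintro _ ⟨y, ⟨-, -, ν, hν, hy⟩, rfl⟩ u hu
  refine Submodule.mem_sup_right ?_
  have h1 : M ⊔ ⨆ μ ∈ {μ | lam - μ ∈ posWeights Δ}, wtSpace (cartanOp ρ τ C V) μ ≤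
      (⨆ μ ∈ {μ | lam - μ ∈ posWeights Δ}, wtSpace (cartanOp ρ τ C V) μ).comap (act y) := by
    have hle : ∀ μ, lam - μ ∈ posWeights Δ → wtSpace (cartanOp ρ τ C V) μ ≤
        ⨆ μ ∈ {μ | lam - μ ∈ posWeights Δ}, wtSpace (cartanOp ρ τ C V) μ := fun μ hμ =>
      le_iSup₂ (f := fun μ (_ : μ ∈ {μ | lam - μ ∈ posWeights Δ}) =>
        wtSpace (cartanOp ρ τ C V) μ) μ hμ
    refine sup_le (fun m hm => ?_) (iSup₂_le fun μ hμ m hm => ?_)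
    · exact hle (lam + -ν) (by simpa using hν) (act_mem_wtSpace hy (hMhw hm).1)
    · refine hle (μ + -ν) ?_ (act_mem_wtSpace hy hm)
      have := hΔ.add_mem_posWeights hμ hν.1
      convert this using 1
      abel
  exact h1 hu

/-- The weights of highest weight modules. -/
theorem sub_mem_posLattice {μ : Weight ρ C} {u : V} (hu : u ∈ weightSpace τ V μ) (hu0 : u ≠ 0) :
    lam - μ ∈ posLattice Δ := by
  refine mem_of_mem_iSup_wtSpace (a := cartanOp ρ τ C V) (P := {μ | lam - μ ∈ posLattice Δ}) hu hu0
    ?_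
  have h1 : u ∈ (⊤ : Submodule ℂ V) := trivial
  rw [← sup_iSup_eq_top hdiag hΔ hgen hv] at h1
  revert h1
  refine fun h => (sup_le ?_ ?_ : _ ≤
    ⨆ μ ∈ {μ | lam - μ ∈ posLattice Δ}, wtSpace (cartanOp ρ τ C V) μ) h
  · rintro _ ⟨a, ha, rfl⟩
    refine (le_iSup₂ (f := fun μ (_ : μ ∈ {μ | lam - μ ∈ posLattice Δ}) =>
      wtSpace (cartanOp ρ τ C V) μ) lam ?_) (cartanAlgebra_mem_highestWeightSpace ha hv).1
    change lam - lam ∈ posLattice Δ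
    rw [sub_self]; exact zero_mem _
  · exact iSup₂_le fun μ hμ => le_iSup₂ (f := fun μ (_ : μ ∈ {μ | lam - μ ∈ posLattice Δ}) =>
      wtSpace (cartanOp ρ τ C V) μ) μ hμ.1

/-- The highest weight space is generated by `v` as a module over `(𝔥 ⊗ A)^Γ`. -/
theorem exists_cartanAlgebra_apply_eq {u : V} (hu : u ∈ weightSpace τ V lam) :
    ∃ a ∈ cartanAlgebra ρ τ C V, a v = u := by
  have h1 : u ∈ (⊤ : Submodule ℂ V) := trivial
  rw [← sup_iSup_eq_top hdiag hΔ hgen hv] at h1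
  obtain ⟨_, ⟨a, ha, rfl⟩, r, hr, h2⟩ := Submodule.mem_sup.1 h1
  refine ⟨a, ha, ?_⟩
  -- The remainder r = u - a v has weight lam but lies in the sum of the strictly lower weight
  -- spaces, so it must be zero.
  by_contra hne
  have hr0 : r ≠ 0 := fun h0 => hne (by rw [h0, add_zero] at h2; exact h2)
  have h3 : r ∈ wtSpace (cartanOp ρ τ C V) lam := by
    rw [eq_sub_of_add_eq' h2]
    exact Submodule.sub_mem _ hu (cartanAlgebra_mem_highestWeightSpace ha hv).1
  have h4 := mem_of_mem_iSup_wtSpace (P := {μ | lam - μ ∈ posWeights Δ}) h3 hr0 hr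
  exact h4.2 (sub_self lam)

end HighestWeight

end TwistedWeyl
end

noncomputable section

namespace TwistedWeyl

/-! ### Enveloping algebras and twisted homomorphisms -/

section Twist

variable {L : Type*} [AddCommGroup L] [Module ℂ L] [SuperSpace L]

/-- The map `x ↦ (-1)^{d |x|} x`. -/
def twist (d : ZMod 2) : L →ₗ[ℂ] L := (parity L) ^ d.val

theorem twist_of_mem {d i : ZMod 2} {x : L} (hx : x ∈ part L i) :
    twist d x = koszul d i • x := by
  have : ∀ k : ℕ, (parity L ^ k) x = ((-1 : ℂ) ^ i.val) ^ k • x := by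
    intro k
    induction k with
    | zero => simp
    | succ k ih =>
      rw [pow_succ', Module.End.mul_apply, ih, map_smul, parity_of_mem hx, smul_smul, pow_succ]
  rw [twist, this, koszul, ← pow_mul, mul_comm]

theorem twist_twist (d : ZMod 2) (x : L) : twist d (twist d x) = x := by
  obtain ⟨a, ha, b, hb, rfl⟩ := exists_add_eq x
  simp only [map_add, twist_of_mem ha, twist_of_mem hb, map_smul, smul_smul, koszul_mul_self,
    one_smul]

theorem twist_even {d : ZMod 2} {x : L} (hx : x ∈ part L 0) : twist d x = x := by
  rw [twist_of_mem hx, koszul_zero_right, one_smul]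

theorem twist_mem {d i : ZMod 2} {x : L} (hx : x ∈ part L i) : twist d x ∈ part L i := by
  rw [twist_of_mem hx]; exact Submodule.smul_mem _ _ hx

theorem parity_twist (d : ZMod 2) (x : L) : parity L (twist d x) = twist d (parity L x) := by
  obtain ⟨a, ha, b, hb, rfl⟩ := exists_add_eq x
  simp only [map_add, twist_of_mem ha, twist_of_mem hb, map_smul, parity_of_mem ha,
    parity_of_mem hb]
  module

theorem koszul_add (d i j : ZMod 2) : koszul d (i + j) = koszul d i * koszul d j := by
  rw [koszul, koszul, koszul, mul_comm, pow_mul, sign_add, mul_pow, ← pow_mul, ← pow_mul,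
    mul_comm i.val, mul_comm j.val]

variable [LieSuperalgebra L]

theorem br_twist (d : ZMod 2) (x y : L) : br (twist d x) (twist d y) = twist d (br x y) := by
  obtain ⟨a, ha, b, hb, rfl⟩ := exists_add_eq x
  obtain ⟨p, hp, q, hq, rfl⟩ := exists_add_eq y
  simp only [br, map_add, LinearMap.add_apply, map_smul, LinearMap.smul_apply, twist_of_mem ha,
    twist_of_mem hb, twist_of_mem hp, twist_of_mem hq,
    twist_of_mem (LieSuperalgebra.bracket_mem ha hp),
    twist_of_mem (LieSuperalgebra.bracket_mem ha hq),
    twist_of_mem (LieSuperalgebra.bracket_mem hb hp),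
    twist_of_mem (LieSuperalgebra.bracket_mem hb hq), koszul_add]
  module

variable {V : Type*} [AddCommGroup V] [Module ℂ V] [SuperSpace V] [LieSupermodule L V]
  {V' : Type*} [AddCommGroup V'] [Module ℂ V'] [SuperSpace V'] [LieSupermodule L V']

theorem parity_act_parity (x : L) (v : V) : parity V (act x v) = act (parity L x) (parity V v) := by
  obtain ⟨a, ha, b, hb, rfl⟩ := exists_add_eq x
  simp only [act, map_add, LinearMap.add_apply, parity_of_mem ha, parity_of_mem hb, map_smul,
    LinearMap.smul_apply, ← parity_act ha, ← parity_act hb]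

/-- Homomorphisms of degree `d` in terms of the parity operators. -/
theorem isHom_of_twist {d : ZMod 2} {f : V →ₗ[ℂ] V'}
    (h1 : ∀ v, parity V' (f v) = (-1 : ℂ) ^ d.val • f (parity V v))
    (h2 : ∀ (x : L) v, f (act x v) = act (twist d x) (f v)) : IsHom L d f := by
  refine ⟨fun i v hv => mem_part_of_parity ?_, fun i x hx v => ?_⟩
  · rw [h1, parity_of_mem hv, map_smul, smul_smul, sign_add, mul_comm]
  · rw [h2, twist_of_mem hx, act, map_smul, LinearMap.smul_apply]

/-- The sign rule becomes an identity linear in x, valid for inhomogeneous elements as well. -/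
theorem IsHom.map_act {d : ZMod 2} {f : V →ₗ[ℂ] V'} (hf : IsHom L d f) (x : L) (v : V) :
    f (act x v) = act (twist d x) (f v) := by
  obtain ⟨a, ha, b, hb, rfl⟩ := exists_add_eq x
  simp only [act, map_add, LinearMap.add_apply, twist_of_mem ha, twist_of_mem hb, map_smul,
    LinearMap.smul_apply, ← hf.2 _ a ha, ← hf.2 _ b hb]

theorem IsHom.map_act_even {d : ZMod 2} {f : V →ₗ[ℂ] V'} (hf : IsHom L d f) {x : L}
    (hx : x ∈ part L 0) (v : V) : f (act x v) = act x (f v) := by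
  rw [hf.map_act, twist_even hx]

theorem IsHom.act_map {d : ZMod 2} {f : V →ₗ[ℂ] V'} (hf : IsHom L d f) (x : L) (v : V) :
    act x (f v) = f (act (twist d x) v) := by
  rw [hf.map_act, twist_twist]

theorem IsHom.comp {d d' : ZMod 2} {V'' : Type*} [AddCommGroup V''] [Module ℂ V''] [SuperSpace V'']
    [LieSupermodule L V''] {f : V →ₗ[ℂ] V'} {f' : V' →ₗ[ℂ] V''} (hf' : IsHom L d' f')
    (hf : IsHom L d f) : IsHom L (d + d') (f' ∘ₗ f) := by
  refine ⟨fun i v hv => ?_, fun i x hx v => ?_⟩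
  · rw [← add_assoc]; exact hf'.1 _ _ (hf.1 _ _ hv)
  · rw [LinearMap.comp_apply, hf.2 i x hx, map_smul, hf'.2 i x hx, smul_smul, LinearMap.comp_apply]
    congr 1
    have hc : ∀ a b : ZMod 2, koszul a b = koszul b a := fun a b => by
      rw [koszul, koszul, mul_comm]
    rw [hc (d + d'), koszul_add, hc d, hc d']

/-- The image of a generator under a surjective homomorphism is a generator. -/
theorem IsHom.generates {d : ZMod 2} {f : V →ₗ[ℂ] V'} (hf : IsHom L d f)
    (hs : Function.Surjective f) {v : V} (hv : Generates L v) : Generates L (f v) := by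
  intro N hN hst
  have h1 := hv (N.comap f) hN fun x w hw => by
    change f (act x w) ∈ N
    rw [hf.map_act]
    exact hst _ _ hw
  rw [eq_top_iff]
  intro u _
  obtain ⟨w, rfl⟩ := hs u
  have : w ∈ N.comap f := by rw [h1]; trivial
  exact this

theorem IsHom.surjective {d : ZMod 2} {f : V →ₗ[ℂ] V'} (hf : IsHom L d f) {v : V}
    (hv : Generates L (f v)) : Function.Surjective f := by
  rw [← LinearMap.range_eq_top]
  refine hv _ ⟨v, rfl⟩ ?_
  rintro x _ ⟨w, rfl⟩
  exact ⟨_, (hf.act_map x w).symm⟩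

/-- Even homomorphisms are determined by the image of a generator. -/
theorem IsHom.eq_id {f : V →ₗ[ℂ] V} (hf : IsHom L 0 f) {v : V} (hv : Generates L v)
    (h : f v = v) : f = LinearMap.id := by
  have h1 := hv (LinearMap.eqLocus f LinearMap.id) h fun x w hw => by
    change f (act x w) = act x w
    have hw' : f w = w := hw
    have h0 : twist 0 x = x := by simp [twist]
    rw [hf.map_act, hw', h0]
  exact LinearMap.ext fun w => by
    have : w ∈ LinearMap.eqLocus f LinearMap.id := by rw [h1]; trivial
    exact this

end Twist

/-! ### The universal property of the enveloping superalgebra and its twisted actions. -/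

namespace UEnv

variable {L : Type*} [AddCommGroup L] [Module ℂ L] [SuperSpace L] [LieSuperalgebra L]

/-- The universal property of the enveloping algebra. -/
def lift {B : Type*} [Ring B] [Algebra ℂ B] (F : L →ₗ[ℂ] B)
    (hF : ∀ i j, ∀ x ∈ part L i, ∀ y ∈ part L j,
      F (br x y) = F x * F y - koszul i j • (F y * F x)) : UEnv L →ₐ[ℂ] B :=
  RingQuot.liftAlgHom ℂ ⟨TensorAlgebra.lift ℂ F, fun _ _ h => by
    obtain ⟨hx, hy⟩ := h
    simp only [map_sub, map_mul, map_smul, TensorAlgebra.lift_ι_apply]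
    exact hF _ _ _ hx _ hy⟩

theorem lift_ι {B : Type*} [Ring B] [Algebra ℂ B] (F : L →ₗ[ℂ] B)
    (hF : ∀ i j, ∀ x ∈ part L i, ∀ y ∈ part L j,
      F (br x y) = F x * F y - koszul i j • (F y * F x)) (x : L) : lift F hF (ι x) = F x := by
  have h := RingQuot.liftAlgHom_mkAlgHom_apply ℂ (TensorAlgebra.lift ℂ F)
    (s := UEnvRel L) (fun _ _ h => by
      obtain ⟨hx, hy⟩ := h
      simp only [map_sub, map_mul, map_smul, TensorAlgebra.lift_ι_apply]
      exact hF _ _ _ hx _ hy) (TensorAlgebra.ι ℂ x)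
  rw [TensorAlgebra.lift_ι_apply] at h
  exact h

/-- The enveloping algebra is generated by `1` under left multiplication. -/
theorem eq_top_of_stable {N : Submodule ℂ (UEnv L)} (h1 : 1 ∈ N) (h : ∀ x, ∀ u ∈ N, ι x * u ∈ N) :
    N = ⊤ := by
  have key : ∀ u : UEnv L, ∀ n ∈ N, u * n ∈ N := by
    intro u
    obtain ⟨t, rfl⟩ := RingQuot.mkAlgHom_surjective ℂ (UEnvRel L) u
    induction t using TensorAlgebra.induction with
    | algebraMap r =>
      intro n hn
      have : RingQuot.mkAlgHom ℂ (UEnvRel L) (algebraMap ℂ _ r) = algebraMap ℂ (UEnv L) r :=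
        AlgHom.commutes _ r
      rw [this, ← Algebra.smul_def]
      exact N.smul_mem r hn
    | ι x => exact fun n hn => h x n hn
    | mul a b ha hb =>
      intro n hn
      have h2 : RingQuot.mkAlgHom ℂ (UEnvRel L) (a * b) = (RingQuot.mkAlgHom ℂ (UEnvRel L) a) *
        RingQuot.mkAlgHom ℂ (UEnvRel L) b := map_mul _ _ _
      have h3 := mul_assoc (G := UEnv L) (RingQuot.mkAlgHom ℂ (UEnvRel L) a)
        (RingQuot.mkAlgHom ℂ (UEnvRel L) b) n
      rw [h2]
      exact h3 ▸ ha _ (hb n hn)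
    | add a b ha hb =>
      intro n hn
      have h2 : RingQuot.mkAlgHom ℂ (UEnvRel L) (a + b) = (RingQuot.mkAlgHom ℂ (UEnvRel L) a) +
        RingQuot.mkAlgHom ℂ (UEnvRel L) b := map_add _ _ _
      have h3 := add_mul (R := UEnv L) (RingQuot.mkAlgHom ℂ (UEnvRel L) a)
        (RingQuot.mkAlgHom ℂ (UEnvRel L) b) n
      rw [h2]
      exact h3 ▸ N.add_mem (ha n hn) (hb n hn)
  rw [eq_top_iff]
  intro u _
  simpa using key u 1 h1

/-- The homomorphism of enveloping algebras that is induced by a homomorphism. -/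
def map {K : Type*} [AddCommGroup K] [Module ℂ K] [SuperSpace K] [LieSuperalgebra K]
    (φ : LieSuperHom K L) : UEnv K →ₐ[ℂ] UEnv L :=
  lift (ι ∘ₗ φ.toLinearMap) fun i j x hx y hy => by
    have h1 : φ.toLinearMap (br x y) = br (φ.toLinearMap x) (φ.toLinearMap y) := φ.map_bracket x y
    rw [LinearMap.comp_apply, h1]
    exact ι_br (φ.map_part i x hx) (φ.map_part j y hy)

theorem map_ι {K : Type*} [AddCommGroup K] [Module ℂ K] [SuperSpace K] [LieSuperalgebra K]
    (φ : LieSuperHom K L) (x : K) : map φ (ι x) = ι (φ.toLinearMap x) := lift_ι _ _ x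

variable (V : Type*) [AddCommGroup V] [Module ℂ V] [SuperSpace V] [LieSupermodule L V]

/-- The action of the enveloping algebra on a module, twisted by `d`. -/
def rep (d : ZMod 2) : UEnv L →ₐ[ℂ] Module.End ℂ V :=
  lift (LieSupermodule.act ∘ₗ twist d) fun i j x hx y hy => by
    refine LinearMap.ext fun v => ?_
    have h1 := LieSupermodule.act_bracket (twist_mem (d := d) hx) (twist_mem (d := d) hy) v
    rw [br_twist] at h1
    exact h1

theorem rep_ι (d : ZMod 2) (x : L) : rep V d (ι x) = act (twist d x) := lift_ι _ _ x

theorem parity_rep (d : ZMod 2) (u : UEnv L) (v : V) :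
    parity V (rep V d u v) = rep V d (parity (UEnv L) u) (parity V v) := by
  let N : Submodule ℂ (UEnv L) :=
    { carrier := {u | ∀ v, parity V (rep V d u v) = rep V d (parity (UEnv L) u) (parity V v)}
      add_mem' := fun ha hb v => by
        simp only [map_add, LinearMap.add_apply, ha v, hb v]
      zero_mem' := fun v => by simp only [map_zero, LinearMap.zero_apply]
      smul_mem' := fun c a ha v => by
        simp only [map_smul, LinearMap.smul_apply, ha v] }
  have hN : N = ⊤ := by
    refine eq_top_of_stable (fun v => ?_) fun x u hu v => ?_
    · rw [parity_eq]; simp only [map_one, Module.End.one_apply]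
    · have hu' := hu v
      rw [parity_eq] at hu' ⊢
      rw [map_mul, map_mul, map_mul, Module.End.mul_apply, Module.End.mul_apply, ← hu', rep_ι,
        parityHom_ι, rep_ι, ← parity_twist, parity_act_parity]
  have : u ∈ N := by rw [hN]; trivial
  exact this v

end UEnv

/-! ### Homomorphisms from induced modules -/

section InducedHom

variable {K : Type*} [AddCommGroup K] [Module ℂ K] [SuperSpace K] [LieSuperalgebra K]
  {L : Type*} [AddCommGroup L] [Module ℂ L] [SuperSpace L] [LieSuperalgebra L]
  (φ : LieSuperHom K L)

theorem SubSupermodule.gen_le {V : Type*} [AddCommGroup V] [Module ℂ V] [SuperSpace V]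
    [LieSupermodule L V] {S : Set V} {N : Submodule ℂ V} (hS : S ⊆ N)
    (hp : ∀ v ∈ N, parity V v ∈ N) (ha : ∀ x : L, ∀ v ∈ N, act x v ∈ N) :
    (SubSupermodule.gen L S).toSubmodule ≤ N := sInf_le ⟨hS, hp, ha⟩

theorem SubSupermodule.subset_gen {V : Type*} [AddCommGroup V] [Module ℂ V] [SuperSpace V]
    [LieSupermodule L V] (S : Set V) : S ⊆ (SubSupermodule.gen L S).toSubmodule :=
  fun _ hv => Submodule.mem_sInf.2 fun _ hN => hN.1 hv

theorem parity_mkQ {V : Type*} [AddCommGroup V] [Module ℂ V] [SuperSpace V]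
    [LieSupermodule L V] (N : SubSupermodule L V) (v : V) :
    parity (V ⧸ N.toSubmodule) (N.toSubmodule.mkQ v) = N.toSubmodule.mkQ (parity V v) := by
  obtain ⟨a, ha, b, hb, rfl⟩ := exists_add_eq v
  have h0 : N.toSubmodule.mkQ a ∈ part (V ⧸ N.toSubmodule) 0 := ⟨a, ha, rfl⟩
  have h1 : N.toSubmodule.mkQ b ∈ part (V ⧸ N.toSubmodule) 1 := ⟨b, hb, rfl⟩
  simp only [map_add, parity_of_mem h0, parity_of_mem h1, parity_of_mem ha, parity_of_mem hb,
    map_smul]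

theorem parity_induced (M : Type*) [AddCommGroup M] [Module ℂ M] [SuperSpace M]
    [LieSupermodule K M] (q : Induced φ M) : parity (Induced φ M) q = inducedParity φ M q := by
  obtain ⟨a, ha, b, hb, rfl⟩ := exists_add_eq q
  rw [map_add, map_add, parity_of_mem ha, parity_of_mem hb, (mem_part_induced φ M).1 ha,
    (mem_part_induced φ M).1 hb]

variable {M : Type*} [AddCommGroup M] [Module ℂ M] [SuperSpace M] [LieSupermodule K M]
  {V : Type*} [AddCommGroup V] [Module ℂ V] [SuperSpace V] [LieSupermodule L V]

/-- Homomorphisms from an induced module (Frobenius reciprocity). -/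
theorem exists_induced_hom {d : ZMod 2} (ψ : M →ₗ[ℂ] V)
    (h1 : ∀ m, parity V (ψ m) = (-1 : ℂ) ^ d.val • ψ (parity M m))
    (h2 : ∀ (y : K) m, ψ (act y m) = act (twist d (φ.toLinearMap y)) (ψ m)) :
    ∃ f : Induced φ M →ₗ[ℂ] V, IsHom L d f ∧ ∀ m, f (Induced.mk φ M 1 m) = ψ m := by
  -- The map sends u ⊗ m to u acting on ψ(m) through the action twisted by d; the twist accounts for
  -- the signs of a homomorphism of degree d.
  let f₀ : UEnv L ⊗[ℂ] M →ₗ[ℂ] V :=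
    TensorProduct.lift ((LinearMap.lcomp ℂ V ψ) ∘ₗ (UEnv.rep V d).toLinearMap)
  have hf₀ : ∀ u m, f₀ (u ⊗ₜ m) = UEnv.rep V d u (ψ m) := fun u m => rfl
  have hbal : balanced φ M ≤ LinearMap.ker f₀ := Submodule.span_le.2 (by
    rintro _ ⟨u, y, m, rfl⟩
    change f₀ _ = 0
    rw [map_sub, hf₀, hf₀, h2, map_mul, Module.End.mul_apply, UEnv.rep_ι, sub_self])
  let f := (balanced φ M).liftQ f₀ hbal
  have hf : ∀ z, f ((balanced φ M).mkQ z) = f₀ z := fun z => rfl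
  refine ⟨f, isHom_of_twist (fun q => ?_) fun x q => ?_, fun m => ?_⟩
  · obtain ⟨z, rfl⟩ := (balanced φ M).mkQ_surjective q
    have h3 : parity (Induced φ M) ((balanced φ M).mkQ z) =
        (balanced φ M).mkQ (tensorParity M z) := by
      rw [parity_induced]; rfl
    rw [h3, hf, hf]
    induction z using TensorProduct.induction_on with
    | zero => simp
    | tmul u m =>
      have h4 : tensorParity M (u ⊗ₜ[ℂ] m) = parity (UEnv L) u ⊗ₜ parity M m := rfl
      rw [h4, hf₀, hf₀, UEnv.parity_rep, h1, map_smul]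
    | add y z hy hz =>
      simp only [map_add, smul_add]
      rw [hy (parity_induced φ M _), hz (parity_induced φ M _)]
  · obtain ⟨z, rfl⟩ := (balanced φ M).mkQ_surjective q
    change f₀ ((LinearMap.mulLeft ℂ (UEnv.ι x)).rTensor M z) = act (twist d x) (f₀ z)
    induction z using TensorProduct.induction_on with
    | zero => simp
    | tmul u m =>
      rw [LinearMap.rTensor_tmul, LinearMap.mulLeft_apply, hf₀, hf₀, map_mul,
        Module.End.mul_apply, UEnv.rep_ι]
    | add y z hy hz => simp only [map_add, hy, hz]
  · change f₀ (1 ⊗ₜ m) = ψ m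
    rw [hf₀, map_one, Module.End.one_apply]

end InducedHom

end TwistedWeyl
end

noncomputable section

namespace TwistedWeyl

/-! ### Quotients and generators -/

section Quotients

variable {L : Type*} [AddCommGroup L] [Module ℂ L] [SuperSpace L] [LieSuperalgebra L]
  {V : Type*} [AddCommGroup V] [Module ℂ V] [SuperSpace V] [LieSupermodule L V]
  {V' : Type*} [AddCommGroup V'] [Module ℂ V'] [SuperSpace V'] [LieSupermodule L V']

/-- Applying the parity operator to x v = 0 shows that the parity image of x also kills the
homogeneous vector v. So the even and the odd part of x kill v separately, and signs on them do not
matter. -/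
theorem act_twist_eq_zero {x : L} {i d : ZMod 2} {v : V} (hv : v ∈ part V i) (h : act x v = 0) :
    act (twist d x) v = 0 := by
  have h1 : act (parity L x) v = 0 := by
    have h2 := parity_act_parity x v
    rw [h, map_zero, parity_of_mem hv, map_smul] at h2
    exact (smul_eq_zero.1 h2.symm).resolve_left (pow_ne_zero _ (by norm_num))
  obtain ⟨a, ha, b, hb, rfl⟩ := exists_add_eq x
  have hv1 : (1 : ZMod 2).val = 1 := by decide
  rw [map_add, parity_of_mem ha, parity_of_mem hb, hv1, ZMod.val_zero, pow_zero, one_smul,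
    pow_one, neg_one_smul, ← sub_eq_add_neg] at h1
  simp only [act, map_add, map_sub, LinearMap.add_apply, LinearMap.sub_apply] at h h1
  have ha0 : (2 : ℂ) • LieSupermodule.act a v = 0 := by
    rw [two_smul]
    have := congrArg₂ (· + ·) h h1
    simpa using this
  have ha1 : LieSupermodule.act a v = 0 := by simpa using ha0
  have hb1 : LieSupermodule.act b v = 0 := by simpa [ha1] using h
  simp only [act, map_add, twist_of_mem ha, twist_of_mem hb, map_smul, LinearMap.add_apply,
    LinearMap.smul_apply, ha1, hb1, smul_zero, add_zero]

theorem isHom_mkQ (N : SubSupermodule L V) : IsHom L 0 N.toSubmodule.mkQ :=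
  ⟨fun i v hv => by rw [add_zero]; exact ⟨v, hv, rfl⟩, fun i x _ v => by
    have h : koszul 0 i = 1 := by simp [koszul]
    rw [h, one_smul]
    rfl⟩

theorem IsHom.liftQ {d : ZMod 2} {f : V →ₗ[ℂ] V'} (hf : IsHom L d f) {N : SubSupermodule L V}
    (hN : N.toSubmodule ≤ LinearMap.ker f) : IsHom L d (N.toSubmodule.liftQ f hN) := by
  refine ⟨?_, fun i x hx q => ?_⟩
  · rintro i _ ⟨v, hv, rfl⟩
    exact hf.1 i v hv
  · obtain ⟨v, rfl⟩ := N.toSubmodule.mkQ_surjective q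
    exact hf.2 i x hx v

theorem IsHom.map_parity {d : ZMod 2} {f : V →ₗ[ℂ] V'} (hf : IsHom L d f) (v : V) :
    parity V' (f v) = (-1 : ℂ) ^ d.val • f (parity V v) := by
  obtain ⟨a, ha, b, hb, rfl⟩ := exists_add_eq v
  simp only [map_add, parity_of_mem ha, parity_of_mem hb, parity_of_mem (hf.1 _ _ ha),
    parity_of_mem (hf.1 _ _ hb), sign_add, map_smul]
  module

theorem IsHom.pow_act_map {d : ZMod 2} {f : V →ₗ[ℂ] V'} (hf : IsHom L d f) {x : L}
    (hx : x ∈ part L 0) (k : ℕ) (v : V) :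
    f (((act x : Module.End ℂ V) ^ k) v) = ((act x : Module.End ℂ V') ^ k) (f v) := by
  induction k with
  | zero => rw [pow_zero, pow_zero, Module.End.one_apply, Module.End.one_apply]
  | succ k ih =>
    rw [pow_succ', pow_succ', Module.End.mul_apply, Module.End.mul_apply, hf.map_act_even hx, ih]

theorem IsHom.pow_act_map_eq_zero {d : ZMod 2} {f : V →ₗ[ℂ] V'} (hf : IsHom L d f) {x : L}
    (hx : x ∈ part L 0) {k : ℕ} {v : V} (h : ((act x : Module.End ℂ V) ^ k) v = 0) :
    ((act x : Module.End ℂ V') ^ k) (f v) = 0 := by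
  rw [← hf.pow_act_map hx, h, map_zero]

/-- The kernel of a homogeneous homomorphism is graded and stable, hence a subsupermodule. -/
theorem IsHom.gen_le_ker {d : ZMod 2} {f : V →ₗ[ℂ] V'} (hf : IsHom L d f) {S : Set V}
    (hS : ∀ v ∈ S, f v = 0) : (SubSupermodule.gen L S).toSubmodule ≤ LinearMap.ker f := by
  refine SubSupermodule.gen_le hS (fun v hv => ?_) fun x v hv => ?_
  · rw [LinearMap.mem_ker] at hv ⊢
    have h1 := hf.map_parity v
    rw [hv, map_zero] at h1
    exact (smul_eq_zero.1 h1.symm).resolve_left (pow_ne_zero _ (by norm_num))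
  · rw [LinearMap.mem_ker] at hv ⊢
    rw [hf.map_act, hv, map_zero]

theorem UEnv.generates_one : Generates L (1 : UEnv L) :=
  fun _ h1 h => UEnv.eq_top_of_stable h1 h

theorem UEnv.parityHom_map {K : Type*} [AddCommGroup K] [Module ℂ K] [SuperSpace K]
    [LieSuperalgebra K] (φ : LieSuperHom K L) (u : UEnv K) :
    UEnv.parityHom (UEnv.map φ u) = UEnv.map φ (UEnv.parityHom u) := by
  have h : (UEnv.parityHom (L := L)).comp (UEnv.map φ) = (UEnv.map φ).comp UEnv.parityHom :=
    UEnv.hom_ext fun x => by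
      simp only [AlgHom.comp_apply, UEnv.map_ι, UEnv.parityHom_ι, φ.map_parity]
  exact DFunLike.congr_fun h u

theorem pow_act_one_mk {N : SubSupermodule L (UEnv L)} (x : L) (k : ℕ) :
    ((act x : Module.End ℂ (UEnv L ⧸ N.toSubmodule)) ^ k) (N.toSubmodule.mkQ 1) =
      N.toSubmodule.mkQ (UEnv.ι x ^ k) := by
  induction k with
  | zero => rw [pow_zero, pow_zero, Module.End.one_apply]
  | succ k ih =>
    rw [pow_succ', Module.End.mul_apply, ih, pow_succ']
    rfl

section Induced

variable {K : Type*} [AddCommGroup K] [Module ℂ K] [SuperSpace K] [LieSuperalgebra K]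
  (φ : LieSuperHom K L) {M : Type*} [AddCommGroup M] [Module ℂ M] [SuperSpace M]
  [LieSupermodule K M]

theorem act_induced_mk (y : K) (m : M) :
    act (φ.toLinearMap y) (Induced.mk φ M 1 m) = Induced.mk φ M 1 (act y m) := by
  have h1 : act (φ.toLinearMap y) (Induced.mk φ M 1 m) =
      Induced.mk φ M (UEnv.ι (φ.toLinearMap y) * 1) m := rfl
  rw [h1, mul_one]
  refine (Submodule.Quotient.eq _).2 (Submodule.subset_span ⟨1, y, m, ?_⟩)
  rw [one_mul]

theorem pow_act_induced_mk (y : K) (m : M) (k : ℕ) :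
    ((act (φ.toLinearMap y) : Module.End ℂ (Induced φ M)) ^ k) (Induced.mk φ M 1 m) =
      Induced.mk φ M 1 (((act y : Module.End ℂ M) ^ k) m) := by
  induction k with
  | zero => rfl
  | succ k ih =>
    rw [pow_succ', Module.End.mul_apply, ih, pow_succ', Module.End.mul_apply, act_induced_mk]

/-- The map `m ↦ 1 ⊗ m`. -/
def inducedUnit (M : Type*) [AddCommGroup M] [Module ℂ M] [SuperSpace M]
    [LieSupermodule K M] : M →ₗ[ℂ] Induced φ M :=
  (balanced φ M).mkQ ∘ₗ TensorProduct.mk ℂ (UEnv L) M 1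

/-- A submodule containing 1 ⊗ m contains 1 ⊗ M, because K acts on 1 ⊗ M through its image in L.
Left multiplication then reaches every u ⊗ k. -/
theorem generates_induced {m : M} (hm : Generates K m) : Generates L (Induced.mk φ M 1 m) := by
  intro N hN hst
  have h1 : N.comap (inducedUnit φ M) = ⊤ := hm _ hN fun y k hk => by
    change Induced.mk φ M 1 (act y k) ∈ N
    rw [← act_induced_mk]
    exact hst _ _ hk
  have h2 : ∀ (u : UEnv L) (k : M), Induced.mk φ M u k ∈ N := by
    intro u k
    let P : Submodule ℂ (UEnv L) :=
      N.comap ((balanced φ M).mkQ ∘ₗ (TensorProduct.mk ℂ (UEnv L) M).flip k)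
    have hP : P = ⊤ := by
      refine UEnv.eq_top_of_stable ?_ fun x u hu => hst x _ hu
      have : k ∈ N.comap (inducedUnit φ M) := by rw [h1]; trivial
      exact this
    have : u ∈ P := by rw [hP]; trivial
    exact this
  rw [eq_top_iff]
  intro q _
  obtain ⟨z, rfl⟩ := (balanced φ M).mkQ_surjective q
  induction z using TensorProduct.induction_on with
  | zero => rw [map_zero]; exact N.zero_mem
  | tmul u k => exact h2 u k
  | add y z hy hz => rw [map_add]; exact N.add_mem (hy trivial) (hz trivial)

theorem induced_mk_mem_part {i : ZMod 2} {m : M} (hm : m ∈ part M i) :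
    Induced.mk φ M 1 m ∈ part (Induced φ M) i := by
  rw [mem_part_induced]
  change (balanced φ M).mkQ (parity (UEnv L) 1 ⊗ₜ[ℂ] parity M m) = _
  rw [UEnv.parity_eq, map_one, parity_of_mem hm, TensorProduct.tmul_smul, map_smul]
  rfl

end Induced

end Quotients

/-! ### The twisted global Weyl module -/

section Weyl

variable {g : Type u} [AddCommGroup g] [Module ℂ g] [SuperSpace g] [LieSuperalgebra g]
variable {A : Type v} [CommRing A] [Algebra ℂ A] {Γ : Type w} [Group Γ]
variable {ρ : SuperAction Γ g} {τ : Γ →* (A ≃ₐ[ℂ] A)} {n : ℕ} {C : ChevalleyGenerators g n}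
variable {Δ : Set (Weight ρ C)} {lam : Weight ρ C}

section Kac

theorem generates_kacVector : Generates (Fixed ρ) (kacVector Δ lam) :=
  (isHom_mkQ (SubSupermodule.gen (Fixed ρ) (kacRelations Δ lam))).generates
    (Submodule.mkQ_surjective _) UEnv.generates_one

theorem kacVector_mem_part : kacVector Δ lam ∈ part (KacModule Δ lam) 0 :=
  ⟨1, UEnv.mem_part.2 (by simp), rfl⟩

theorem mk_kacRelations {r : UEnv (Fixed ρ)} (hr : r ∈ kacRelations Δ lam) :
    (SubSupermodule.gen (Fixed ρ) (kacRelations Δ lam)).toSubmodule.mkQ r = 0 :=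
  (Submodule.Quotient.mk_eq_zero _).2 (SubSupermodule.subset_gen _ hr)

theorem act_kacVector (x : Fixed ρ) : act x (kacVector Δ lam) =
    (SubSupermodule.gen (Fixed ρ) (kacRelations Δ lam)).toSubmodule.mkQ (UEnv.ι x) :=
  congrArg (SubSupermodule.gen (Fixed ρ) (kacRelations Δ lam)).toSubmodule.mkQ (mul_one (UEnv.ι x))

theorem cartan_act_kacVector (h : cartanFixed ρ C) :
    act (cartanIncl ρ C h) (kacVector Δ lam) = lam h • kacVector Δ lam := by
  have h1 := mk_kacRelations (Δ := Δ) (lam := lam) (Or.inl (Or.inr ⟨h, rfl⟩))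
  rw [map_sub, map_smul, sub_eq_zero] at h1
  exact (act_kacVector _).trans h1

theorem pow_act_kacVector {α : Weight ρ C} {xp xm : Fixed ρ} {h : cartanFixed ρ C}
    (hα : IsEvenSimple Δ α) (H : IsCorootTriple α xp xm h) {m : ℕ} (hm : lam h = m) :
    ((act xm : Module.End ℂ (KacModule Δ lam)) ^ (m + 1)) (kacVector Δ lam) = 0 :=
  (pow_act_one_mk xm (m + 1)).trans
    (mk_kacRelations (Or.inr ⟨α, xp, xm, h, m, hα, H, hm, rfl⟩))

end Kac

section Properties

variable (τ) in
/-- The generator of `P^Γ(V̄(lam))`. -/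
def inducedVector (Δ : Set (Weight ρ C)) (lam : Weight ρ C) : InducedKac τ Δ lam :=
  Induced.mk (incl ρ τ) (KacModule Δ lam) 1 (kacVector Δ lam)

theorem generates_inducedVector : Generates (EqMap ρ τ) (inducedVector τ Δ lam) :=
  generates_induced _ generates_kacVector

theorem inducedVector_mem_weightSpace :
    inducedVector τ Δ lam ∈ weightSpace τ (InducedKac τ Δ lam) lam := fun h => by
  rw [inducedVector, act_induced_mk, cartan_act_kacVector]
  exact map_smul (inducedUnit (incl ρ τ) (KacModule Δ lam)) _ _

theorem isHom_weylQuotient : IsHom (EqMap ρ τ) 0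
    (truncation τ (InducedKac τ Δ lam) Δ lam).toSubmodule.mkQ := isHom_mkQ _

theorem generates_weylVector : Generates (EqMap ρ τ) (weylVector τ Δ lam) :=
  isHom_weylQuotient.generates (Submodule.mkQ_surjective _) generates_inducedVector

theorem weylVector_mem_part : weylVector τ Δ lam ∈ part (WeylModule τ Δ lam) 0 :=
  ⟨inducedVector τ Δ lam, induced_mk_mem_part _ kacVector_mem_part, rfl⟩

theorem IsHom.mem_weightSpace {V V' : Type*} [AddCommGroup V] [Module ℂ V] [SuperSpace V]
    [LieSupermodule (EqMap ρ τ) V] [AddCommGroup V'] [Module ℂ V'] [SuperSpace V']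
    [LieSupermodule (EqMap ρ τ) V'] {d : ZMod 2} {f : V →ₗ[ℂ] V'} (hf : IsHom (EqMap ρ τ) d f)
    {μ : Weight ρ C} {v : V} (hv : v ∈ weightSpace τ V μ) : f v ∈ weightSpace τ V' μ := by
  intro h
  have h1 := hf.map_act_even (cartanMap_even ρ τ C h) v
  have h2 : act (cartanMap ρ τ C h) v = μ h • v := hv h
  rw [h2, map_smul] at h1
  exact h1.symm

theorem weylVector_mem_weightSpace :
    weylVector τ Δ lam ∈ weightSpace τ (WeylModule τ Δ lam) lam :=
  isHom_weylQuotient.mem_weightSpace inducedVector_mem_weightSpace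

theorem pow_act_inducedVector {α : Weight ρ C} {xp xm : Fixed ρ} {h : cartanFixed ρ C}
    (hα : IsEvenSimple Δ α) (H : IsCorootTriple α xp xm h) {m : ℕ} (hm : lam h = m) :
    ((act ((incl ρ τ).toLinearMap xm) : Module.End ℂ (InducedKac τ Δ lam)) ^ (m + 1))
      (inducedVector τ Δ lam) = 0 := by
  rw [inducedVector, pow_act_induced_mk, pow_act_kacVector hα H hm]
  exact map_zero (inducedUnit (incl ρ τ) (KacModule Δ lam))

theorem pow_act_weylVector {α : Weight ρ C} {xp xm : Fixed ρ} {h : cartanFixed ρ C}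
    (hα : IsEvenSimple Δ α) (H : IsCorootTriple α xp xm h) {m : ℕ} (hm : lam h = m) :
    ((act ((incl ρ τ).toLinearMap xm) : Module.End ℂ (WeylModule τ Δ lam)) ^ (m + 1))
      (weylVector τ Δ lam) = 0 := by
  exact IsHom.pow_act_map_eq_zero (isHom_weylQuotient (τ := τ) (Δ := Δ) (lam := lam))
    (x := (incl ρ τ).toLinearMap xm) ((incl ρ τ).map_part 0 _ H.xm_mem.2)
    (pow_act_inducedVector hα H hm)

variable [Finite Γ] (hdiag : ∀ γ, C.IsDiagramAutomorphism (ρ.toHom γ))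
  (hΔ : IsConsistentSimpleSystem ρ C Δ)
include hdiag hΔ

/-- The weights of the Weyl module lie in `lam - Q⁺`. -/
theorem weyl_sub_mem_posLattice {μ : Weight ρ C} {u : WeylModule τ Δ lam}
    (hu : u ∈ weightSpace τ (WeylModule τ Δ lam) μ) (hu0 : u ≠ 0) : lam - μ ∈ posLattice Δ := by
  refine mem_of_mem_iSup_wtSpace (a := cartanOp ρ τ C (WeylModule τ Δ lam))
    (P := {μ | lam - μ ∈ posLattice Δ}) hu hu0 ?_
  obtain ⟨q, rfl⟩ := (truncation τ (InducedKac τ Δ lam) Δ lam).toSubmodule.mkQ_surjective u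
  have hq : q ∈ (⊤ : Submodule ℂ (InducedKac τ Δ lam)) := trivial
  rw [← iSup_wtSpace_eq_top hdiag hΔ generates_inducedVector inducedVector_mem_weightSpace] at hq
  have h1 : ⨆ ν, wtSpace (cartanOp ρ τ C (InducedKac τ Δ lam)) ν ≤
      (⨆ μ ∈ {μ | lam - μ ∈ posLattice Δ}, wtSpace (cartanOp ρ τ C (WeylModule τ Δ lam)) μ).comap
        (truncation τ (InducedKac τ Δ lam) Δ lam).toSubmodule.mkQ := by
    refine iSup_le fun ν p hp => ?_
    -- Weight vectors of admissible weight survive with the same weight; all others lie in the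
    -- truncated submodule and become zero.
    by_cases hν : lam - ν ∈ posLattice Δ
    · exact (le_iSup₂ (f := fun μ (_ : μ ∈ {μ | lam - μ ∈ posLattice Δ}) =>
        wtSpace (cartanOp ρ τ C (WeylModule τ Δ lam)) μ) ν hν)
          (isHom_weylQuotient.mem_weightSpace hp)
    · have h2 : (truncation τ (InducedKac τ Δ lam) Δ lam).toSubmodule.mkQ p = 0 :=
        (Submodule.Quotient.mk_eq_zero _).2 (SubSupermodule.subset_gen _ ⟨ν, hν, hp⟩)
      rw [Submodule.mem_comap, h2]
      exact Submodule.zero_mem _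
  exact h1 hq

/-- A positive weight element would send the generator to weight lam + ν with ν a nonzero element of
Q⁺, and no such weight occurs in the truncated module. Such elements span (𝔫⁺ ⊗ A)^Γ. -/
theorem weylVector_mem_highestWeightSpace :
    weylVector τ Δ lam ∈ highestWeightSpace τ lam (WeylModule τ Δ lam) := by
  refine ⟨weylVector_mem_weightSpace, fun z hz => ?_⟩
  have h1 : ∀ z ∈ posElements ρ τ Δ,
      z ∈ LinearMap.ker ((LieSupermodule.act (L := EqMap ρ τ)).flip (weylVector τ Δ lam)) := by
    rintro z ⟨-, -, ν, hν, hz⟩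
    by_contra h0
    have h2 := act_mem_wtSpace hz (weylVector_mem_weightSpace (τ := τ) (Δ := Δ) (lam := lam))
    have h3 := weyl_sub_mem_posLattice hdiag hΔ h2 h0
    rw [sub_add_cancel_left] at h3
    exact hν.2 (hΔ.eq_zero_of_add_eq_zero hν.1 h3 (add_neg_cancel ν))
  exact Submodule.span_le.2 h1 (mem_span_posElements hdiag hΔ hz)

theorem weyl_inCategory [FiniteDimensional ℂ g] (hgΓ : IsBasicClassical (Fixed ρ))
    (hlam : lam ∈ dominantWeights ρ C) : InCategory ρ τ (WeylModule τ Δ lam) :=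
  inCategory_of_generates hdiag hΔ hgΓ generates_weylVector weylVector_mem_weightSpace
    (fun _ _ hv hv0 => weyl_sub_mem_posLattice hdiag hΔ hv hv0) fun α xp xm h hα H => by
      obtain ⟨m, hm⟩ := exists_nat_of_dominant hΔ hlam hα H
      exact ⟨m + 1, pow_act_weylVector hα H hm⟩

end Properties

/-! ### Maps from the twisted global Weyl module. -/

section UniversalProperty

variable {V : Type*} [AddCommGroup V] [Module ℂ V] [SuperSpace V] [LieSupermodule (EqMap ρ τ) V]

/-- The generator of the Kac-type module is even while v has degree d, so the map u ↦ u v uses the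
action twisted by d. It respects the defining relations: twisting changes nothing on the even
elements involved, and `act_twist_eq_zero` handles 𝔫⁺. -/
theorem exists_kac_hom {d : ZMod 2} {v : V} (hd : v ∈ part V d)
    (hv : v ∈ highestWeightSpace τ lam V)
    (hrel : ∀ (α : Weight ρ C) (xp xm : Fixed ρ) (h : cartanFixed ρ C) (m : ℕ),
      IsEvenSimple Δ α → IsCorootTriple α xp xm h → lam h = m →
      ((act ((incl ρ τ).toLinearMap xm) : Module.End ℂ V) ^ (m + 1)) v = 0) :
    ∃ ψ : KacModule Δ lam →ₗ[ℂ] V, ψ (kacVector Δ lam) = v ∧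
      (∀ k, parity V (ψ k) = (-1 : ℂ) ^ d.val • ψ (parity (KacModule Δ lam) k)) ∧
      ∀ (y : Fixed ρ) k, ψ (act y k) = act (twist d ((incl ρ τ).toLinearMap y)) (ψ k) := by
  let R : UEnv (Fixed ρ) →ₐ[ℂ] Module.End ℂ V := (UEnv.rep V d).comp (UEnv.map (incl ρ τ))
  have hR : ∀ x, R (UEnv.ι x) = act (twist d ((incl ρ τ).toLinearMap x)) := fun x => by
    rw [AlgHom.comp_apply, UEnv.map_ι, UEnv.rep_ι]
  let ψ₀ : UEnv (Fixed ρ) →ₗ[ℂ] V := LinearMap.applyₗ v ∘ₗ R.toLinearMap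
  have hψ₀ : ∀ u, ψ₀ u = R u v := fun u => rfl
  have hpar : ∀ u, parity V (ψ₀ u) = (-1 : ℂ) ^ d.val • ψ₀ (parity (UEnv (Fixed ρ)) u) := by
    intro u
    rw [hψ₀, hψ₀, AlgHom.comp_apply, UEnv.parity_rep, parity_of_mem hd, map_smul, UEnv.parity_eq,
      UEnv.parity_eq, UEnv.parityHom_map, AlgHom.comp_apply]
  have hact : ∀ (x : Fixed ρ) u, ψ₀ (act x u) = act (twist d ((incl ρ τ).toLinearMap x)) (ψ₀ u) :=
    fun x u => by
      have h1 : (act x u : UEnv (Fixed ρ)) = UEnv.ι x * u := rfl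
      rw [h1, hψ₀, hψ₀, map_mul, hR, Module.End.mul_apply]
  have hker : (SubSupermodule.gen (Fixed ρ) (kacRelations Δ lam)).toSubmodule ≤
      LinearMap.ker ψ₀ := by
    refine SubSupermodule.gen_le ?_ (fun u hu => ?_) fun x u hu => ?_
    · rintro r ((⟨x, hx, rfl⟩ | ⟨h, rfl⟩) | ⟨α, xp, xm, h, m, hα, H, hm, rfl⟩)
      · change R _ v = 0
        rw [hR]
        exact act_twist_eq_zero hd (hv.2 _ (tmul_mem_tensorSub A hx 1))
      · change R _ v = 0
        have h1 : twist d ((incl ρ τ).toLinearMap (cartanIncl ρ C h)) =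
            (incl ρ τ).toLinearMap (cartanIncl ρ C h) := twist_even (cartanMap_even ρ τ C h)
        rw [map_sub, map_smul, map_one, hR, LinearMap.sub_apply, LinearMap.smul_apply,
          Module.End.one_apply, h1, sub_eq_zero]
        exact hv.1 h
      · change R _ v = 0
        have h1 : twist d ((incl ρ τ).toLinearMap xm) = (incl ρ τ).toLinearMap xm :=
          twist_even ((incl ρ τ).map_part 0 _ H.xm_mem.2)
        rw [map_pow, hR, h1]
        exact hrel α xp xm h m hα H hm
    · rw [LinearMap.mem_ker] at hu ⊢
      have h1 := hpar u
      rw [hu, map_zero] at h1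
      exact (smul_eq_zero.1 h1.symm).resolve_left (pow_ne_zero _ (by norm_num))
    · rw [LinearMap.mem_ker] at hu ⊢
      rw [hact, hu, map_zero]
  let ψ : KacModule Δ lam →ₗ[ℂ] V := Submodule.liftQ _ ψ₀ hker
  refine ⟨ψ, ?_, fun k => ?_, fun y k => ?_⟩
  · change R 1 v = v
    rw [map_one, Module.End.one_apply]
  · obtain ⟨u, rfl⟩ := Submodule.mkQ_surjective _ k
    rw [parity_mkQ]
    exact hpar u
  · obtain ⟨u, rfl⟩ := Submodule.mkQ_surjective _ k
    exact hact y u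

/-- The universal property of the twisted global Weyl module. -/
theorem exists_weyl_hom (hV : InCategory ρ τ V) (hΔ : IsConsistentSimpleSystem ρ C Δ)
    (hwts : ∀ μ, ∀ u ∈ weightSpace τ V μ, u ≠ 0 → lam - μ ∈ posLattice Δ) {v : V}
    (hv : IsHighestWeightVector τ lam v) {d : ZMod 2} (hd : v ∈ part V d) :
    ∃ f : WeylModule τ Δ lam →ₗ[ℂ] V, IsHom (EqMap ρ τ) d f ∧ f (weylVector τ Δ lam) = v := by
  obtain ⟨ψ, h0, h1, h2⟩ := exists_kac_hom (Δ := Δ) hd hv.mem fun α xp xm h m hα H hm =>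
    pow_act_eq_zero_of_inCategory hΔ hV hv hα H hm
  obtain ⟨f, hf, hfψ⟩ := exists_induced_hom (incl ρ τ) ψ h1 h2
  -- A weight vector of weight outside lam - Q⁺ has its image in a weight space of V that is zero by
  -- `hwts`.
  have hker : (truncation τ (InducedKac τ Δ lam) Δ lam).toSubmodule ≤ LinearMap.ker f := by
    refine hf.gen_le_ker ?_
    rintro u ⟨μ, hμ, hu⟩
    by_contra hne
    exact hμ (hwts μ _ (hf.mem_weightSpace hu) hne)
  exact ⟨_, hf.liftQ hker, (hfψ _).trans h0⟩

end UniversalProperty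

end Weyl

end TwistedWeyl
end

noncomputable section

namespace TwistedWeyl

/-! ### Uniqueness of the universal object -/

section Uniqueness

theorem eq_of_mem_part {V : Type*} [AddCommGroup V] [Module ℂ V] [SuperSpace V] {i j : ZMod 2}
    {v : V} (hi : v ∈ part V i) (hj : v ∈ part V j) (h0 : v ≠ 0) : i = j := by
  have hd : ∀ {v : V}, v ∈ part V 0 → v ∈ part V 1 → v = 0 := fun h h' =>
    (Submodule.mem_bot ℂ).1 ((SuperSpace.isCompl (V := V)).disjoint.le_bot ⟨h, h'⟩)
  have h2 : ∀ k : ZMod 2, k = 0 ∨ k = 1 := by decide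
  rcases h2 i with rfl | rfl <;> rcases h2 j with rfl | rfl
  · rfl
  · exact absurd (hd hi hj) h0
  · exact absurd (hd hj hi) h0
  · rfl

theorem IsHom.symm {L : Type*} [AddCommGroup L] [Module ℂ L] [SuperSpace L] [LieSuperalgebra L]
    {V : Type*} [AddCommGroup V] [Module ℂ V] [SuperSpace V] [LieSupermodule L V]
    {V' : Type*} [AddCommGroup V'] [Module ℂ V'] [SuperSpace V'] [LieSupermodule L V']
    {d : ZMod 2} {e : V ≃ₗ[ℂ] V'} (he : IsHom L d e.toLinearMap) :
    IsHom L d e.symm.toLinearMap := by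
  refine isHom_of_twist (fun v => ?_) fun x v => ?_
  · obtain ⟨u, rfl⟩ := e.surjective v
    have h1 : parity V' (e u) = (-1 : ℂ) ^ d.val • e (parity V u) := he.map_parity u
    change parity V (e.symm (e u)) = (-1 : ℂ) ^ d.val • e.symm (parity V' (e u))
    rw [h1, map_smul, e.symm_apply_apply, e.symm_apply_apply, smul_smul, ← mul_pow]
    simp
  · obtain ⟨u, rfl⟩ := e.surjective v
    have h1 : act x (e u) = e (act (twist d x) u) := he.act_map x u
    change e.symm (act x (e u)) = act (twist d x) (e.symm (e u))
    rw [h1, e.symm_apply_apply, e.symm_apply_apply]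

variable {g : Type u} [AddCommGroup g] [Module ℂ g] [SuperSpace g] [LieSuperalgebra g]
variable {A : Type v} [CommRing A] [Algebra ℂ A] {Γ : Type w} [Group Γ]
variable {ρ : SuperAction Γ g} {τ : Γ →* (A ≃ₐ[ℂ] A)} {n : ℕ} {C : ChevalleyGenerators g n}
variable {Δ : Set (Weight ρ C)} {lam : Weight ρ C}

/-- The elements of (𝔥 ⊗ A)^Γ are even, so homomorphisms of either degree commute with their action
without signs. -/
theorem IsHom.map_cartanAlgebra {V : Type*} [AddCommGroup V] [Module ℂ V] [SuperSpace V]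
    [LieSupermodule (EqMap ρ τ) V] {d : ZMod 2} {f : V →ₗ[ℂ] V} (hf : IsHom (EqMap ρ τ) d f)
    {a : Module.End ℂ V} (ha : a ∈ cartanAlgebra ρ τ C V) (v : V) : f (a v) = a (f v) := by
  induction ha using Algebra.adjoin_induction generalizing v with
  | mem x hx =>
    obtain ⟨z, hz, rfl⟩ := hx
    exact hf.map_act_even (even_of_cartan hz) v
  | algebraMap r => exact map_smul f r v
  | add x y _ _ hx hy => rw [LinearMap.add_apply, map_add, hx, hy, LinearMap.add_apply]
  | mul x y _ _ hx hy => rw [Module.End.mul_apply, hx, hy, Module.End.mul_apply]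

variable [Finite Γ] (hdiag : ∀ γ, C.IsDiagramAutomorphism (ρ.toHom γ))
  (hΔ : IsConsistentSimpleSystem ρ C Δ)
include hdiag hΔ

theorem isHighestWeightVector_weylVector (h0 : weylVector τ Δ lam ≠ 0) :
    IsHighestWeightVector τ lam (weylVector τ Δ lam) where
  ne_zero := h0
  homogeneous := ⟨0, weylVector_mem_part⟩
  nPos_act := (weylVector_mem_highestWeightSpace hdiag hΔ).2
  cartan_act := weylVector_mem_weightSpace

/-- Surjective endomorphisms of the twisted global Weyl module are injective. -/
theorem weyl_endomorphism_injective (hW : InCategory ρ τ (WeylModule τ Δ lam))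
    (h0 : weylVector τ Δ lam ≠ 0) {d : ZMod 2}
    {F : WeylModule τ Δ lam →ₗ[ℂ] WeylModule τ Δ lam} (hF : IsHom (EqMap ρ τ) d F)
    (hs : Function.Surjective F) : Function.Injective F := by
  have hw := weylVector_mem_highestWeightSpace (τ := τ) (lam := lam) hdiag hΔ
  obtain ⟨a, ha, haz⟩ := exists_cartanAlgebra_apply_eq hdiag hΔ generates_weylVector hw
    (hF.mem_weightSpace weylVector_mem_weightSpace)
  have hz : F (weylVector τ Δ lam) ∈ highestWeightSpace τ lam (WeylModule τ Δ lam) := by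
    rw [← haz]; exact cartanAlgebra_mem_highestWeightSpace ha hw
  -- F maps the generator w to a w. By surjectivity F w generates too, so the cyclicity of the
  -- highest weight space can be used from F w back to w.
  obtain ⟨b, hb, hbw⟩ := exists_cartanAlgebra_apply_eq hdiag hΔ
    (hF.generates hs generates_weylVector) hz weylVector_mem_weightSpace
  have hb0 : b (weylVector τ Δ lam) ≠ 0 := fun h => h0 (by
    rw [← hbw, ← hF.map_cartanAlgebra hb, h, map_zero])
  have hbm := cartanAlgebra_mem_highestWeightSpace hb hw
  have hbp := cartanAlgebra_mem_part hb (weylVector_mem_part (τ := τ) (Δ := Δ) (lam := lam))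
  -- The endomorphism sending w to b w is the left inverse of F: by commutativity, ψ(F w) = ψ(a w) =
  -- a b w = b a w = b F w = w.
  obtain ⟨ψ, hψ, hψw⟩ := exists_weyl_hom hW hΔ
    (fun _ _ hv hv0 => weyl_sub_mem_posLattice hdiag hΔ hv hv0) ⟨hb0, ⟨0, hbp⟩, hbm.2, hbm.1⟩ hbp
  have hid : (ψ ∘ₗ F) (weylVector τ Δ lam) = weylVector τ Δ lam := by
    rw [LinearMap.comp_apply, ← haz, hψ.map_cartanAlgebra ha, hψw, ← Module.End.mul_apply,
      cartanAlgebra_comm ha hb, Module.End.mul_apply, haz, hbw]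
  have hG := hψ.comp hF
  -- The composite fixes a nonzero even vector, so it has degree zero and is determined by its value
  -- on the generator.
  have hd := hG.1 0 _ weylVector_mem_part
  rw [hid] at hd
  have hd0 := eq_of_mem_part hd weylVector_mem_part h0
  rw [zero_add] at hd0
  rw [hd0] at hG
  have h1 := hG.eq_id generates_weylVector hid
  exact Function.LeftInverse.injective (g := ψ) fun u => LinearMap.congr_fun h1 u

end Uniqueness

end TwistedWeyl
end

/-! ### The proposition. -/

open TwistedWeyl
theorem mainTheorem2 {g : Type u} [AddCommGroup g] [Module ℂ g] [SuperSpace g] [LieSuperalgebra g]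
    {A : Type v} [CommRing A] [Algebra ℂ A] {Γ : Type w} [Group Γ] [Finite Γ]
    (ρ : SuperAction Γ g) (τ : Γ →* (A ≃ₐ[ℂ] A)) {n : ℕ} (C : ChevalleyGenerators g n)
    (hg : IsBasicClassical g) (hdiag : ∀ γ, C.IsDiagramAutomorphism (ρ.toHom γ))
    (hgΓ : IsBasicClassical (Fixed ρ))
    (Δ : Set (Weight ρ C)) (hΔ : IsConsistentSimpleSystem ρ C Δ)
    (lam : Weight ρ C) (hlam : lam ∈ dominantWeights ρ C) :
    InCategory ρ τ (WeylModule τ Δ lam) ∧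
    Generates (EqMap ρ τ) (weylVector τ Δ lam) ∧
    (Nontrivial (WeylModule τ Δ lam) → IsHighestWeightVector τ lam (weylVector τ Δ lam)) ∧
    (∀ (V : Type w₁) [AddCommGroup V] [Module ℂ V] [SuperSpace V] [LieSupermodule (EqMap ρ τ) V],
      InCategory ρ τ V →
      ∀ v : V, IsHighestWeightVector τ lam v → Generates (EqMap ρ τ) v →
        ∃ (d : ZMod 2) (f : WeylModule τ Δ lam →ₗ[ℂ] V), IsHom (EqMap ρ τ) d f ∧
          f (weylVector τ Δ lam) = v ∧ Function.Surjective f) ∧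
    (∀ (W : Type w₂) [AddCommGroup W] [Module ℂ W] [SuperSpace W] [LieSupermodule (EqMap ρ τ) W],
      IsHighestWeightObject τ W lam →
      (∀ (V : Type (max u v)) [AddCommGroup V] [Module ℂ V] [SuperSpace V]
        [LieSupermodule (EqMap ρ τ) V], IsHighestWeightObject τ V lam →
          ∃ (d : ZMod 2) (f : W →ₗ[ℂ] V), IsHom (EqMap ρ τ) d f ∧ Function.Surjective f) →
      ∃ (d : ZMod 2) (f : W ≃ₗ[ℂ] WeylModule τ Δ lam), IsHom (EqMap ρ τ) d f.toLinearMap) := by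
  have := hg.finiteDimensional
  have hW := weyl_inCategory (τ := τ) hdiag hΔ hgΓ hlam
  refine ⟨hW, generates_weylVector, fun _ => ?_, ?_, ?_⟩
  -- If the generator were zero, the zero subspace would be a stable subspace containing it, and the
  -- module would be trivial.
  · refine isHighestWeightVector_weylVector hdiag hΔ fun h0 => ?_
    exact bot_ne_top (generates_weylVector (τ := τ) (Δ := Δ) (lam := lam) ⊥
      ((Submodule.mem_bot ℂ).2 h0) fun x u hu => by
        rw [Submodule.mem_bot] at hu ⊢
        rw [hu, map_zero])
  · intro V _ _ _ _ hV v hv hgen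
    obtain ⟨d, hd⟩ := hv.homogeneous
    obtain ⟨f, hf, hfv⟩ := exists_weyl_hom hV hΔ
      (fun _ _ hu hu0 => sub_mem_posLattice hdiag hΔ hgen hv.mem hu hu0) hv hd
    exact ⟨d, f, hf, hfv, hf.surjective (hfv ▸ hgen)⟩
  · rintro W _ _ _ _ ⟨hV, v, hv, hgen⟩ huniv
    obtain ⟨d, hd⟩ := hv.homogeneous
    obtain ⟨f, hf, hfv⟩ := exists_weyl_hom hV hΔ
      (fun _ _ hu hu0 => sub_mem_posLattice hdiag hΔ hgen hv.mem hu hu0) hv hd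
    have hs : Function.Surjective f := hf.surjective (hfv ▸ hgen)
    have h0 : weylVector τ Δ lam ≠ 0 := fun h => hv.ne_zero (by rw [← hfv, h, map_zero])
    -- The Weyl module is itself an object of the required kind, nonzero since it maps onto W. The
    -- universality of W gives a surjection back; the composite p ∘ f is a surjective endomorphism
    -- of the Weyl module, hence injective, and so is f.
    obtain ⟨e, p, hp, hps⟩ := huniv (WeylModule τ Δ lam)
      ⟨hW, _, isHighestWeightVector_weylVector hdiag hΔ h0, generates_weylVector⟩
    have hinj := weyl_endomorphism_injective hdiag hΔ hW h0 (hp.comp hf) (hps.comp hs)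
    exact ⟨d, (LinearEquiv.ofBijective f ⟨Function.Injective.of_comp hinj, hs⟩).symm,
      IsHom.symm hf⟩
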